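/- Let $r>0$, $\lambda>0$, $\pi\in(0,1)$, let $u:[0,1]\to\mathbb R$ be continuous, and let $c:[0,1]\to[0,\infty]$ be convex, continuous as an extended-valued function, and finite and continuously differentiable on $(0,1)$. Write $c'(0)\in[-\infty,\infty)$ and $c'(1)\in(-\infty,\infty]$ for the limits of $c'$ at the endpoints, and put $\zeta_s q=e^{-\lambda s}q+(1-e^{-\lambda s})\pi$. An information acquisition policy with initial belief $p\in[0,1]$ consists of random times $0=\tau_0<\tau_1<\dots\le\infty$ (strictly increasing as long as they are finite) and random probability measures $F_i$ on $[0,1]$, inducing a process $(P_t)_{t\ge0}$ in $[0,1]$ such that: $P_t=\zeta_{t-\tau_i}P_{\tau_i}$ for $t\in[\tau_i,\tau_{i+1})$; on $\{\tau_i<\infty\}$ the belief $P_{\tau_i}$ is drawn from $F_i$ conditionally on the past of $P$ strictly before $\tau_i$, and $\int q\,dF_i(q)=P_{\tau_i^-}$ (where $P_{0^-}=p$); if $\tau_i\uparrow T<\infty$, then $P_T=P_{T^-}$ and $P_t=\zeta_{t-T}P_T$ for $t\ge T$; each $\tau_i$ is a stopping time of the filtration generated by $P$; and $F_i$ is measurable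 with respect to the past of $P$ strictly before $\tau_i$. The cost of an experiment $F$ with mean $m$ is $C(F)=\int (c(q)-c(m))\,dF(q)\in[0,\infty]$ (equal to $0$ if $F=\delta_m$). The value function without fixed cost ($\kappa=0$) and the net value function are $$v_0(p)=\sup\ \mathbb E\Bigl[\int_0^\infty e^{-rt}u(P_t)\,dt-\sum_{i\ge0}e^{-r\tau_i}C(F_i)\Bigr],\qquad w_0(p)=v_0(p)-c(p),$$ the supremum being over all information acquisition policies with initial belief $p$. Let $\mathcal B(p)$ be the set of càdlàg processes $(P_t)_{t\ge0}$ in $[0,1]$ with $\mathbb E[P_0]=p$ and $\mathbb E[P_{t+s}\mid P_t]=e^{-\lambda s}P_t+(1-e^{-\lambda s})\pi$ almost surely for all $t,s\ge0$, and let $$f(q)=u(q)-r\,c(q)+\lambda(\pi-q)\,c'(q)\in[-\infty,\infty),\qquad q\in[0,1],$$ be the virtual flow payoff. Then for every $p\in[0,1]$ $$w_0(p)=\sup_{P\in\mathcal B(p)}\mathbb E\Bigl[\int_0^\infty e^{-rt}f(P_t)\,dt\Bigr],$$ as an identity in $[-\infty,\infty)$. -/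

import Mathlib

open MeasureTheory ProbabilityTheory Filter Topology Set
open scoped NNReal ENNReal

noncomputable section

namespace InfoAcq

/-- Integral of an extended-real function, `∫ X⁺ dμ - ∫ X⁻ dμ` in `[-∞, ∞]`.  It is only used for
functions whose positive part has a finite integral, so that no `∞ - ∞` occurs. -/
def extIntegral {α : Type} [MeasurableSpace α] (μ : Measure α) (X : α → EReal) : EReal :=
  ((∫⁻ a, (X a).toENNReal ∂μ : ℝ≥0∞) : EReal) - ((∫⁻ a, (-X a).toENNReal ∂μ : ℝ≥0∞) : EReal)

/-! ### Beliefs, experiments and costs -/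

/-- Deterministic drift of beliefs: the position at time `s` of the solution of
`dp = lam * (π - p) dt` that starts at `q`. -/
def flow (lam π : ℝ) (s : ℝ≥0) (q : ℝ) : ℝ :=
  Real.exp (-lam * s) * q + (1 - Real.exp (-lam * s)) * π

/-- `F` is a Bayes-plausible distribution of posteriors at the belief `q`: a probability measure
carried by `[0, 1]` with mean `q`. -/
structure BayesPlausible (q : ℝ) (F : Measure ℝ) : Prop where
  prob : IsProbabilityMeasure F
  carried : F (Icc (0 : ℝ) 1)ᶜ = 0
  mean : ∫ x, x ∂F = q

/-- The standing assumptions on the function `c : [0, 1] → [0, ∞]` generating the information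
costs: convex, continuous (as an extended-valued function), finite and `C¹` on `(0, 1)`. -/
structure IsCertaintyMeasure (c : ℝ → ℝ≥0∞) : Prop where
  convex : ConvexOn ℝ≥0 (Icc (0 : ℝ) 1) c
  continuous : ContinuousOn c (Icc (0 : ℝ) 1)
  finite : ∀ x ∈ Ioo (0 : ℝ) 1, c x ≠ ∞
  contDiff : ContDiffOn ℝ 1 (fun x => (c x).toReal) (Ioo (0 : ℝ) 1)

/-- Uniformly posterior separable cost `C(F) = ∫ (c(q) - c(p)) dF(q)`, `p` being the mean of `F`.
By convexity it is nonnegative.  The truncated subtraction of `[0, ∞]` only matters at `∞ - ∞`,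
i.e. when `p ∈ {0, 1}` and `c p = ∞`: then `F` is the uninformative experiment, of cost `0`. -/
def upsCost (c : ℝ → ℝ≥0∞) (F : Measure ℝ) : ℝ≥0∞ :=
  (∫⁻ q, c q ∂F) - c (∫ q, q ∂F)

/-- The derivative of `c` on `[0, 1]`, extended-valued at the endpoints, where it is the limit of
`c'` from the inside.  As `c'` is nondecreasing on `(0, 1)`, this limit is an infimum at `0`
and a supremum at `1`. -/
def cDeriv (c : ℝ → ℝ≥0∞) (p : ℝ) : EReal :=
  if p ≤ 0 then ⨅ x ∈ Ioo (0 : ℝ) 1, ((deriv (fun y => (c y).toReal) x : ℝ) : EReal)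
  else if 1 ≤ p then ⨆ x ∈ Ioo (0 : ℝ) 1, ((deriv (fun y => (c y).toReal) x : ℝ) : EReal)
  else ((deriv (fun y => (c y).toReal) p : ℝ) : EReal)

/-- The virtual flow payoff `f(p) = u(p) - r c(p) + lam (π - p) c'(p)`, with values in
`[-∞, ∞)` on `[0, 1]` and finite on `(0, 1)`. -/
def virtualFlow (r lam π : ℝ) (u : ℝ → ℝ) (c : ℝ → ℝ≥0∞) (p : ℝ) : EReal :=
  (u p : EReal) - (r : EReal) * (c p : EReal) + ((lam * (π - p) : ℝ) : EReal) * cDeriv c p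

/-! ### Feasible belief processes -/

/-- `P` is a feasible belief process with initial belief `p`: a càdlàg process in `[0, 1]` with
`E[P₀] = p` and `E[P_{t+s} | P_t] = e^{-lam s} P_t + (1 - e^{-lam s}) π` for all `t, s ≥ 0`. -/
structure IsBeliefProcess (lam π p : ℝ) {Ω : Type} [MeasurableSpace Ω] (Q : Measure Ω)
    (P : ℝ≥0 → Ω → ℝ) : Prop where
  meas : ∀ t, Measurable (P t)
  mem : ∀ t ω, P t ω ∈ Icc (0 : ℝ) 1
  rightCont : ∀ ω t, ContinuousWithinAt (fun s => P s ω) (Ici t) t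
  leftLim : ∀ ω t, ∃ l, Tendsto (fun s => P s ω) (𝓝[<] t) (𝓝 l)
  mean_zero : ∫ ω, P 0 ω ∂Q = p
  drift : ∀ t s : ℝ≥0,
    Q[P (t + s) | MeasurableSpace.comap (P t) inferInstance] =ᵐ[Q] fun ω => flow lam π s (P t ω)

/-- The supremum over all feasible belief processes `P` started at `p` (on arbitrary probability
spaces) of `E ∫₀^∞ e^{-rt} g(P_t) dt`. -/
def supOverProcesses (r lam π : ℝ) (g : ℝ → EReal) (p : ℝ) : EReal :=
  sSup {x : EReal | ∃ (Ω : Type) (_ : MeasurableSpace Ω) (Q : Measure Ω) (P : ℝ≥0 → Ω → ℝ),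
    IsProbabilityMeasure Q ∧ IsBeliefProcess lam π p Q P ∧
    x = extIntegral Q fun ω =>
      extIntegral (volume.restrict (Ioi (0 : ℝ))) fun t =>
        ((Real.exp (-r * t) : ℝ) : EReal) * g (P t.toNNReal ω)}

/-! ### Information acquisition policies and the value function -/

/-- The `σ`-algebra `𝓕_{τ-}` of the events strictly before the random time `τ`, generated by the
events `A ∩ {s < τ}` with `A ∈ 𝓕_s`. -/
@[reducible] def strictPast {Ω : Type} {m : MeasurableSpace Ω} (ℱ : Filtration ℝ≥0 m) (τ : Ω → ℝ≥0∞) :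
    MeasurableSpace Ω :=
  MeasurableSpace.generateFrom
    {B | ∃ (s : ℝ≥0) (A : Set Ω), MeasurableSet[ℱ s] A ∧ B = A ∩ {ω | (s : ℝ≥0∞) < τ ω}}

/-- The belief held right after the `i`-th acquisition (meaningful when `τ i ω < ∞`). -/
def beliefAt {Ω : Type} (τ : ℕ → Ω → ℝ≥0∞) (P : ℝ≥0 → Ω → ℝ) (i : ℕ) (ω : Ω) : ℝ :=
  P (τ i ω).toNNReal ω

/-- The belief `P_{τ i -}` held right before the `i`-th acquisition: the initial belief `p` for
`i = 0`, and the drifted previous belief afterwards (meaningful when `τ i ω < ∞`). -/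
def beliefBefore (lam π p : ℝ) {Ω : Type} (τ : ℕ → Ω → ℝ≥0∞) (P : ℝ≥0 → Ω → ℝ) :
    ℕ → Ω → ℝ
  | 0, _ => p
  | i + 1, ω => flow lam π ((τ (i + 1) ω).toNNReal - (τ i ω).toNNReal) (beliefAt τ P i ω)

/-- `(τ i, F i)` is an information acquisition policy with initial belief `p`, and `P` is the
belief process that it induces. -/
structure IsPolicy (lam π p : ℝ) {Ω : Type} [MeasurableSpace Ω] (Q : Measure Ω)
    (τ : ℕ → Ω → ℝ≥0∞) (F : ℕ → Ω → Measure ℝ) (P : ℝ≥0 → Ω → ℝ) : Prop where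
  meas : ∀ t, StronglyMeasurable (P t)
  mem : ∀ t ω, P t ω ∈ Icc (0 : ℝ) 1
  /-- The acquisition times start at `0` and increase, strictly so when finite. -/
  time_zero : ∀ ω, τ 0 ω = 0
  time_mono : ∀ᵐ ω ∂Q, ∀ i, τ i ω ≤ τ (i + 1) ω
  time_strict : ∀ᵐ ω ∂Q, ∀ i, τ i ω ≠ ∞ → τ i ω < τ (i + 1) ω
  /-- The acquisition times are stopping times of the belief process. -/
  stopping : ∀ i, IsStoppingTime (Filtration.natural P meas) (τ i)
  /-- Each experiment is chosen on the basis of the beliefs held strictly before it. -/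
  exp_meas : ∀ i, Measurable[strictPast (Filtration.natural P meas) (τ i)] (F i)
  /-- Each experiment is Bayes-plausible at the belief held right before it. -/
  plausible : ∀ i, ∀ᵐ ω ∂Q, τ i ω ≠ ∞ → BayesPlausible (beliefBefore lam π p τ P i ω) (F i ω)
  /-- At `τ i` the new belief is drawn from `F i`: this is its conditional law given the past. -/
  draw : ∀ i, ∀ A, MeasurableSet[strictPast (Filtration.natural P meas) (τ i)] A →
    ∀ B : Set ℝ, MeasurableSet B →
      Q (A ∩ {ω | τ i ω ≠ ∞} ∩ {ω | beliefAt τ P i ω ∈ B}) =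
        ∫⁻ ω in A ∩ {ω | τ i ω ≠ ∞}, F i ω B ∂Q
  /-- Between acquisitions the belief drifts deterministically. -/
  between : ∀ᵐ ω ∂Q, ∀ (i : ℕ) (t : ℝ≥0), τ i ω ≤ t → (t : ℝ≥0∞) < τ (i + 1) ω →
    P t ω = flow lam π (t - (τ i ω).toNNReal) (beliefAt τ P i ω)
  /-- If the acquisition times accumulate at a finite time `T`, the belief reaches its left limit
  at `T` (no information is acquired there) and drifts deterministically from `T` on. -/
  after : ∀ᵐ ω ∂Q, ∀ T : ℝ≥0, (⨆ i, τ i ω) = (T : ℝ≥0∞) →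
    Tendsto (fun s => P s ω) (𝓝[<] T) (𝓝 (P T ω)) ∧
      ∀ t, T ≤ t → P t ω = flow lam π (t - T) (P T ω)

/-- The discount factor `e^{-rτ}`, equal to `0` at `τ = ∞`. -/
def discount (r : ℝ) (τ : ℝ≥0∞) : ℝ≥0∞ :=
  if τ = ∞ then 0 else ENNReal.ofReal (Real.exp (-r * τ.toReal))

/-- Expected payoff of a policy:
`E [∫₀^∞ e^{-rt} u(P_t) dt - ∑ᵢ e^{-r τᵢ} (C(Fᵢ) + κ)]`. -/
def policyPayoff (r : ℝ) (κ : ℝ≥0) (u : ℝ → ℝ) (c : ℝ → ℝ≥0∞) {Ω : Type} [MeasurableSpace Ω]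
    (Q : Measure Ω) (τ : ℕ → Ω → ℝ≥0∞) (F : ℕ → Ω → Measure ℝ) (P : ℝ≥0 → Ω → ℝ) : EReal :=
  extIntegral Q fun ω =>
    ((∫ t in Ioi (0 : ℝ), Real.exp (-r * t) * u (P t.toNNReal ω) : ℝ) : EReal)
      - ((∑' i, discount r (τ i ω) * (upsCost c (F i ω) + κ) : ℝ≥0∞) : EReal)

/-- The value function `v_κ` of the optimal information acquisition problem with fixed cost `κ`:
the supremum of the expected payoff over all information acquisition policies. -/
def value (r lam π : ℝ) (κ : ℝ≥0) (u : ℝ → ℝ) (c : ℝ → ℝ≥0∞) (p : ℝ) : EReal :=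
  sSup {x : EReal | ∃ (Ω : Type) (_ : MeasurableSpace Ω) (Q : Measure Ω)
    (τ : ℕ → Ω → ℝ≥0∞) (F : ℕ → Ω → Measure ℝ) (P : ℝ≥0 → Ω → ℝ),
    IsProbabilityMeasure Q ∧ IsPolicy lam π p Q τ F P ∧ x = policyPayoff r κ u c Q τ F P}

/-- The net value function `w_κ = v_κ - c`. -/
def netValue (r lam π : ℝ) (κ : ℝ≥0) (u : ℝ → ℝ) (c : ℝ → ℝ≥0∞) (p : ℝ) : EReal :=
  value r lam π κ u c p - (c p : EReal)

end InfoAcq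

end

noncomputable section

namespace InfoAcq

/-! ### The deterministic drift -/

/-! Everything rests on one identity along the drift. The derivative of `e^{-rt} c(ζ_t q)` is
`-e^{-rt} (r c + lam (x - π) c'(x))` at `x = ζ_t q`, so holding the certainty `c` for a while is
worth exactly the difference between the flow payoffs `u` and `f`. To keep this meaningful where `c`
or `f` is infinite, a large constant `M` is subtracted: `U = M - u` and `g = M - f` are nonnegative
losses, and all identities are written additively in `[0, ∞]` (`LossData`, built in
`exists_lossData`). Over an infinite horizon the identity says that the `g`-loss of a pure drift
from `q` is `c q` plus its `U`-loss (`LossData.discLoss_drift`).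

Upper bound. Stop a policy after finitely many acquisitions and let the belief drift from then on.
This gives a feasible belief process, because each innovation is orthogonal to the strict past
(`IsPolicy.isBeliefProcess_truncBelief`). Adding one acquisition changes the `g`-loss by the
discounted jump of `c` plus the change of `U`-loss, and the expected jump of `c` is the cost of the
experiment. By induction the expected `g`-loss is at most `c p`, plus the costs, plus the `U`-loss
(`IsPolicy.lintegral_loss_le`). The number of acquisitions then tends to infinity in the `U`-loss
only, which is bounded and continuous (`IsPolicy.policyPayoff_sub_le`).

Lower bound. The expected loss of a process depends only on its one-dimensional laws. Sample a
belief process on a grid and take the Markov chain with the same one-step transition kernels: it is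
the belief sequence of a policy with deterministic acquisition times, and it has the same
one-dimensional laws as the sample (`IsBeliefChain.exists_policy`). The same telescoping, now with
equality, identifies its net payoff with `M / r` minus its `g`-loss (`IsBeliefChain.le_netValue`).

It remains to let the mesh tend to zero although `g` may be infinite at `0` and `1`. The samples are
drifted a little further, into a compact part of `(0, 1)` where `g` is bounded, and this extra drift
is removed at the end, using that drifting raises `g` by at most a constant. To start at `p` itself,
the first belief is left undrifted; its loss over a short initial stretch vanishes because the
expected initial certainty is bounded by the expected `g`-loss
(`IsBeliefProcess.lintegral_initial_le`). -/

/-- The deterministic drift of beliefs, with real time. -/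
def drift (lam π t q : ℝ) : ℝ := Real.exp (-lam * t) * q + (1 - Real.exp (-lam * t)) * π

lemma flow_eq_drift (lam π : ℝ) (s : ℝ≥0) (q : ℝ) : flow lam π s q = drift lam π s q := rfl

lemma drift_zero (lam π q : ℝ) : drift lam π 0 q = q := by simp [drift]

lemma drift_add (lam π s t q : ℝ) :
    drift lam π (s + t) q = drift lam π t (drift lam π s q) := by
  have h : Real.exp (-lam * (s + t)) = Real.exp (-lam * s) * Real.exp (-lam * t) := by
    rw [← Real.exp_add]; ring_nf
  simp only [drift, h]; ring

lemma continuous_drift (lam π : ℝ) : Continuous fun x : ℝ × ℝ => drift lam π x.1 x.2 := by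
  unfold drift; fun_prop

lemma drift_sub_target (lam π t q : ℝ) :
    drift lam π t q - π = Real.exp (-lam * t) * (q - π) := by
  simp only [drift]; ring

lemma hasDerivAt_drift (lam π q t : ℝ) :
    HasDerivAt (fun t => drift lam π t q) (lam * (π - drift lam π t q)) t := by
  have h1 : HasDerivAt (fun t => Real.exp (-lam * t)) (Real.exp (-lam * t) * (-lam * 1)) t :=
    ((hasDerivAt_id t).const_mul (-lam)).exp
  have h2 := (h1.mul_const q).add ((h1.const_sub 1).mul_const π)
  refine h2.congr_deriv ?_
  simp only [drift]; ring

section driftRange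
variable {lam π : ℝ}

lemma exp_neg_mul_mem (hlam : 0 < lam) {t : ℝ} (ht : 0 ≤ t) :
    Real.exp (-lam * t) ∈ Ioc (0 : ℝ) 1 :=
  ⟨Real.exp_pos _, Real.exp_le_one_iff.2 (by nlinarith)⟩

lemma exp_neg_mul_lt_one (hlam : 0 < lam) {t : ℝ} (ht : 0 < t) :
    Real.exp (-lam * t) < 1 := Real.exp_lt_one_iff.2 (by nlinarith)

lemma drift_mem_Icc (hlam : 0 < lam) (hπ : π ∈ Ioo (0 : ℝ) 1) {t : ℝ} (ht : 0 ≤ t) {q : ℝ}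
    (hq : q ∈ Icc (0 : ℝ) 1) : drift lam π t q ∈ Icc (0 : ℝ) 1 := by
  obtain ⟨h1, h2⟩ := exp_neg_mul_mem hlam ht
  obtain ⟨h3, h4⟩ := hq
  obtain ⟨h5, h6⟩ := hπ
  constructor <;> simp only [drift] <;> nlinarith

/-- The range of the drift at times at least `s > 0` lies in a compact subset of `(0, 1)`. -/
lemma drift_mem_of_le (hlam : 0 < lam) (hπ : π ∈ Ioo (0 : ℝ) 1) {s t : ℝ} (hst : s ≤ t)
    {q : ℝ} (hq : q ∈ Icc (0 : ℝ) 1) :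
    drift lam π t q ∈ Icc (drift lam π s 0) (drift lam π s 1) := by
  have h1 : Real.exp (-lam * t) ≤ Real.exp (-lam * s) := Real.exp_le_exp.2 (by nlinarith)
  have h0 := Real.exp_pos (-lam * t)
  obtain ⟨h3, h4⟩ := hq
  obtain ⟨h5, h6⟩ := hπ
  constructor <;> simp only [drift] <;> nlinarith

lemma Icc_drift_subset (hlam : 0 < lam) (hπ : π ∈ Ioo (0 : ℝ) 1) {s : ℝ} (hs : 0 < s) :
    Icc (drift lam π s 0) (drift lam π s 1) ⊆ Ioo (0 : ℝ) 1 := by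
  have h1 := exp_neg_mul_lt_one hlam hs
  have h0 := Real.exp_pos (-lam * s)
  obtain ⟨h5, h6⟩ := hπ
  apply Icc_subset_Ioo <;> simp only [drift] <;> nlinarith

lemma drift_mem_Ioo (hlam : 0 < lam) (hπ : π ∈ Ioo (0 : ℝ) 1) {t : ℝ} (ht : 0 < t) {q : ℝ}
    (hq : q ∈ Icc (0 : ℝ) 1) : drift lam π t q ∈ Ioo (0 : ℝ) 1 :=
  Icc_drift_subset hlam hπ ht (drift_mem_of_le hlam hπ le_rfl hq)

lemma tendsto_drift_atTop (hlam : 0 < lam) (π q : ℝ) :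
    Tendsto (fun t => drift lam π t q) atTop (𝓝 π) := by
  have h : Tendsto (fun t : ℝ => Real.exp (-lam * t)) atTop (𝓝 0) := by
    refine Real.tendsto_exp_atBot.comp ?_
    exact tendsto_id.const_mul_atTop_of_neg (by linarith)
  have := (h.mul_const q).add ((h.const_sub 1).mul_const π)
  simpa [drift] using this

end driftRange

/-! ### Clamping to the unit interval -/

/-- The projection of the real line onto `[0, 1]`. -/
def clamp (q : ℝ) : ℝ := max 0 (min 1 q)

lemma continuous_clamp : Continuous clamp := by unfold clamp; fun_prop

lemma clamp_mem (q : ℝ) : clamp q ∈ Icc (0 : ℝ) 1 :=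
  ⟨le_max_left _ _, max_le zero_le_one (min_le_left _ _)⟩

lemma clamp_of_mem {q : ℝ} (hq : q ∈ Icc (0 : ℝ) 1) : clamp q = q := by
  rw [clamp, min_eq_right hq.2, max_eq_right hq.1]

lemma _root_.ContinuousOn.comp_clamp {β : Type*} [TopologicalSpace β] {f : ℝ → β}
    (hf : ContinuousOn f (Icc (0 : ℝ) 1)) : Continuous fun q => f (clamp q) :=
  hf.comp_continuous continuous_clamp clamp_mem

/-! ### Convexity of the certainty measure -/

section convexity
variable {c : ℝ → ℝ≥0∞}

lemma IsCertaintyMeasure.le_combo (hc : IsCertaintyMeasure c) {x y : ℝ}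
    (hx : x ∈ Icc (0 : ℝ) 1) (hy : y ∈ Icc (0 : ℝ) 1) {a b : ℝ} (ha : 0 ≤ a) (hb : 0 ≤ b)
    (hab : a + b = 1) :
    c (a * x + b * y) ≤ ENNReal.ofReal a * c x + ENNReal.ofReal b * c y := by
  have := hc.convex.2 hx hy (show (0 : ℝ≥0) ≤ a.toNNReal from bot_le)
    (show (0 : ℝ≥0) ≤ b.toNNReal from bot_le) (by rw [← Real.toNNReal_add ha hb, hab, Real.toNNReal_one])
  simpa [NNReal.smul_def, ha, hb, ENNReal.smul_def, ENNReal.ofReal] using this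

lemma IsCertaintyMeasure.convexOn_toReal (hc : IsCertaintyMeasure c) :
    ConvexOn ℝ (Ioo (0 : ℝ) 1) fun x => (c x).toReal := by
  refine ⟨convex_Ioo 0 1, fun x hx y hy a b ha hb hab => ?_⟩
  have h := hc.le_combo (Ioo_subset_Icc_self hx) (Ioo_subset_Icc_self hy) ha hb hab
  have hx' := hc.finite x hx
  have hy' := hc.finite y hy
  have h2 := ENNReal.toReal_mono (by finiteness) h
  rwa [ENNReal.toReal_add (by finiteness) (by finiteness), ENNReal.toReal_mul, ENNReal.toReal_mul,
    ENNReal.toReal_ofReal ha, ENNReal.toReal_ofReal hb] at h2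

lemma IsCertaintyMeasure.hasDerivAt (hc : IsCertaintyMeasure c) {x : ℝ}
    (hx : x ∈ Ioo (0 : ℝ) 1) :
    HasDerivAt (fun y => (c y).toReal) (deriv (fun y => (c y).toReal) x) x :=
  ((hc.contDiff.differentiableOn (by norm_num)).differentiableAt (isOpen_Ioo.mem_nhds hx)).hasDerivAt

lemma IsCertaintyMeasure.monotoneOn_deriv (hc : IsCertaintyMeasure c) :
    MonotoneOn (deriv fun y => (c y).toReal) (Ioo (0 : ℝ) 1) :=
  hc.convexOn_toReal.monotoneOn_deriv fun _ hx => (hc.hasDerivAt hx).differentiableAt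

lemma IsCertaintyMeasure.continuousOn_deriv (hc : IsCertaintyMeasure c) :
    ContinuousOn (deriv fun y => (c y).toReal) (Ioo (0 : ℝ) 1) :=
  hc.contDiff.continuousOn_deriv_of_isOpen isOpen_Ioo le_rfl

lemma IsCertaintyMeasure.tangent_le (hc : IsCertaintyMeasure c) {m x : ℝ}
    (hm : m ∈ Ioo (0 : ℝ) 1) (hx : x ∈ Ioo (0 : ℝ) 1) :
    (c m).toReal + deriv (fun y => (c y).toReal) m * (x - m) ≤ (c x).toReal := by
  rcases lt_trichotomy m x with h | h | h
  · have := hc.convexOn_toReal.le_slope_of_hasDerivAt hm hx h (hc.hasDerivAt hm)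
    rw [slope_def_field, le_div_iff₀ (by linarith)] at this
    linarith
  · simp [h]
  · have := hc.convexOn_toReal.slope_le_of_hasDerivAt hx hm h (hc.hasDerivAt hm)
    rw [slope_def_field, div_le_iff₀ (by linarith)] at this
    linarith

/-- Since `c'` is monotone on `(0, 1)`, its infimum and supremum are its limits at the endpoints. At
`0` the lower estimate is immediate, and a point that nearly attains the infimum controls everything
to its left; the situation at `1` is symmetric. -/
lemma IsCertaintyMeasure.continuousOn_cDeriv (hc : IsCertaintyMeasure c) :
    ContinuousOn (cDeriv c) (Icc (0 : ℝ) 1) := by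
  have hIoo : ∀ x ∈ Ioo (0 : ℝ) 1, cDeriv c x = ((deriv (fun y => (c y).toReal) x : ℝ) : EReal) := by
    intro x hx
    rw [cDeriv, if_neg (not_le.2 hx.1), if_neg (not_le.2 hx.2)]
  have h0 : ∀ x ∈ Icc (0 : ℝ) 1, cDeriv c 0 ≤ cDeriv c x := by
    intro x hx
    rcases hx.1.eq_or_lt with h | h
    · rw [← h]
    · have hle : ∀ y ∈ Ioo (0 : ℝ) 1, cDeriv c 0 ≤ ((deriv (fun y => (c y).toReal) y : ℝ) : EReal) := by
        intro y hy
        rw [cDeriv, if_pos le_rfl]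
        exact iInf₂_le y hy
      rcases hx.2.eq_or_lt with h' | h'
      · rw [h']
        refine (hle (1/2) (by norm_num)).trans ?_
        rw [cDeriv.eq_def c 1, if_neg (by norm_num), if_pos le_rfl]
        exact le_iSup₂ (f := fun x (_ : x ∈ Ioo (0 : ℝ) 1) =>
          ((deriv (fun y => (c y).toReal) x : ℝ) : EReal)) (1/2 : ℝ) (by norm_num)
      · rw [hIoo x ⟨h, h'⟩]; exact hle x ⟨h, h'⟩
  have h1 : ∀ x ∈ Icc (0 : ℝ) 1, cDeriv c x ≤ cDeriv c 1 := by
    intro x hx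
    rcases hx.2.eq_or_lt with h | h
    · rw [← h]
    · rcases hx.1.eq_or_lt with h' | h'
      · rw [← h']; exact h0 1 (by norm_num)
      · rw [hIoo x ⟨h', h⟩, cDeriv.eq_def c 1, if_neg (by norm_num), if_pos le_rfl]
        exact le_iSup₂ (f := fun x (_ : x ∈ Ioo (0 : ℝ) 1) =>
          ((deriv (fun y => (c y).toReal) x : ℝ) : EReal)) x ⟨h', h⟩
  intro x hx
  rcases hx.1.eq_or_lt with h | h
  · subst h
    rw [ContinuousWithinAt, tendsto_order]
    refine ⟨fun a ha => ?_, fun b hb => ?_⟩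
    · filter_upwards [self_mem_nhdsWithin] with y hy using ha.trans_le (h0 y hy)
    · have hb' := hb
      rw [cDeriv, if_pos le_rfl] at hb'
      simp only [iInf_lt_iff] at hb'
      obtain ⟨z, hz, hzb⟩ := hb'
      filter_upwards [self_mem_nhdsWithin,
        mem_nhdsWithin_of_mem_nhds (Iio_mem_nhds hz.1)] with y hy hyz
      rcases hy.1.eq_or_lt with h | h
      · rwa [← h]
      · have hy' : y ∈ Ioo (0 : ℝ) 1 := ⟨h, lt_trans hyz hz.2⟩
        rw [hIoo y hy']
        exact lt_of_le_of_lt (EReal.coe_le_coe_iff.2 (hc.monotoneOn_deriv hy' hz (le_of_lt hyz))) hzb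
  · rcases hx.2.eq_or_lt with h' | h'
    · subst h'
      rw [ContinuousWithinAt, tendsto_order]
      refine ⟨fun a ha => ?_, fun b hb => ?_⟩
      · have hb' := ha
        rw [cDeriv, if_neg (by norm_num), if_pos le_rfl] at hb'
        simp only [lt_iSup_iff] at hb'
        obtain ⟨z, hz, hzb⟩ := hb'
        filter_upwards [self_mem_nhdsWithin,
          mem_nhdsWithin_of_mem_nhds (Ioi_mem_nhds hz.2)] with y hy hyz
        rcases hy.2.eq_or_lt with h | h
        · rwa [h]
        · have hy' : y ∈ Ioo (0 : ℝ) 1 := ⟨lt_trans hz.1 hyz, h⟩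
          rw [hIoo y hy']
          exact lt_of_lt_of_le hzb
            (EReal.coe_le_coe_iff.2 (hc.monotoneOn_deriv hz hy' (le_of_lt hyz)))
      · filter_upwards [self_mem_nhdsWithin] with y hy using (h1 y hy).trans_lt hb
    · have hx' : Ioo (0 : ℝ) 1 ∈ 𝓝 x := isOpen_Ioo.mem_nhds ⟨h, h'⟩
      have := (hc.continuousOn_deriv.continuousAt hx')
      have h2 : ContinuousAt (fun x => ((deriv (fun y => (c y).toReal) x : ℝ) : EReal)) x :=
        continuous_coe_real_ereal.continuousAt.comp this
      refine (h2.congr ?_).continuousWithinAt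
      filter_upwards [hx'] with y hy using (hIoo y hy).symm

/-- Jensen's inequality for the extended-valued certainty measure. -/
lemma IsCertaintyMeasure.jensen (hc : IsCertaintyMeasure c) {F : Measure ℝ}
    [IsProbabilityMeasure F] (hF : ∀ᵐ x ∂F, x ∈ Icc (0 : ℝ) 1) :
    c (∫ x, x ∂F) ≤ ∫⁻ x, c x ∂F := by
  have hint : Integrable (fun x : ℝ => x) F :=
    Integrable.of_bound aestronglyMeasurable_id 1 (hF.mono fun x hx => by
      rw [Real.norm_eq_abs, abs_of_nonneg hx.1]; exact hx.2)
  set m := ∫ x, x ∂F with hm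
  have hm0 : 0 ≤ m := integral_nonneg_of_ae (hF.mono fun x hx => hx.1)
  have hm1 : m ≤ 1 := by
    have := integral_mono_ae hint (integrable_const (1 : ℝ)) (hF.mono fun x hx => hx.2)
    simpa using this
  -- An extreme mean admits no finite tangent in general, but it forces `F` to be a point mass
  -- there.
  rcases hm0.eq_or_lt with h0 | h0
  · have : (fun x : ℝ => x) =ᵐ[F] 0 :=
      (integral_eq_zero_iff_of_nonneg_ae (hF.mono fun x hx => hx.1) hint).1 (by rw [← hm, ← h0])
    rw [← h0, lintegral_congr_ae (g := fun _ => c 0)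
      (this.mono fun x hx => by rw [show x = 0 from hx])]
    simp
  rcases hm1.eq_or_lt with h1 | h1
  · have : (fun x : ℝ => 1 - x) =ᵐ[F] 0 := by
      refine (integral_eq_zero_iff_of_nonneg_ae (hF.mono fun x hx => sub_nonneg.2 hx.2)
        ((integrable_const 1).sub hint)).1 ?_
      rw [integral_sub (integrable_const 1) hint, ← hm, h1]; simp
    rw [h1, lintegral_congr_ae (g := fun _ => c 1) (this.mono fun x hx => by
      rw [show x = 1 by have : 1 - x = 0 := hx; linarith])]
    simp
  set a := deriv (fun y => (c y).toReal) m
  have hmem : m ∈ Ioo (0 : ℝ) 1 := ⟨h0, h1⟩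
  -- Tangent inequality on the open interval, carried to the endpoints by continuity of `c` in `[0,
  -- ∞]`. `ENNReal.ofReal` cuts off negative values of the tangent, which only weakens the bound.
  have htan : ∀ x ∈ Icc (0 : ℝ) 1, ENNReal.ofReal ((c m).toReal + a * (x - m)) ≤ c x := by
    rw [← closure_Ioo (zero_ne_one' ℝ)]
    refine le_on_closure (fun x hx => ?_)
      (ENNReal.continuous_ofReal.comp (by fun_prop)).continuousOn ?_
    · rw [← ENNReal.ofReal_toReal (hc.finite x hx)]
      exact ENNReal.ofReal_le_ofReal (hc.tangent_le hmem hx)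
    · rw [closure_Ioo (zero_ne_one' ℝ)]; exact hc.continuous
  have hint2 : Integrable (fun x => (c m).toReal + a * (x - m)) F :=
    (integrable_const _).add ((hint.sub (integrable_const _)).const_mul a)
  have hval : ∫ x, ((c m).toReal + a * (x - m)) ∂F = (c m).toReal := by
    have h3 : Integrable (fun x => a * (x - m)) F := (hint.sub (integrable_const _)).const_mul a
    rw [integral_add (integrable_const _) h3,
      integral_const_mul, integral_sub hint (integrable_const _), ← hm]
    simp
  calc c m = ENNReal.ofReal (∫ x, ((c m).toReal + a * (x - m)) ∂F) := by
        rw [hval, ENNReal.ofReal_toReal (hc.finite m hmem)]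
    _ ≤ ∫⁻ x, ENNReal.ofReal ((c m).toReal + a * (x - m)) ∂F := by
        rw [integral_eq_lintegral_pos_part_sub_lintegral_neg_part hint2]
        exact (ENNReal.ofReal_le_ofReal (sub_le_self _ ENNReal.toReal_nonneg)).trans
          ENNReal.ofReal_toReal_le
    _ ≤ ∫⁻ x, c x ∂F := lintegral_mono_ae (hF.mono htan)

end convexity

end InfoAcq

end

noncomputable section

namespace InfoAcq

/-! ### Losses relative to a constant flow payoff -/

/-- The discount factor `e^{-rt}` as an extended nonnegative number. -/
def disc (r t : ℝ) : ℝ≥0∞ := ENNReal.ofReal (Real.exp (-r * t))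

lemma continuous_disc (r : ℝ) : Continuous (disc r) :=
  ENNReal.continuous_ofReal.comp (by fun_prop)

@[fun_prop]
lemma measurable_disc (r : ℝ) : Measurable (disc r) := (continuous_disc r).measurable

lemma disc_ne_top (r t : ℝ) : disc r t ≠ ∞ := ENNReal.ofReal_ne_top

lemma disc_zero (r : ℝ) : disc r 0 = 1 := by simp [disc]

lemma disc_add (r s t : ℝ) : disc r (s + t) = disc r s * disc r t := by
  rw [disc, disc, disc, ← ENNReal.ofReal_mul (Real.exp_pos _).le, ← Real.exp_add]; ring_nf

lemma disc_le_one {r t : ℝ} (hr : 0 < r) (ht : 0 ≤ t) : disc r t ≤ 1 := by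
  rw [disc, ← ENNReal.ofReal_one]
  exact ENNReal.ofReal_le_ofReal (Real.exp_le_one_iff.2 (by nlinarith))

lemma tendsto_disc_atTop {r : ℝ} (hr : 0 < r) : Tendsto (disc r) atTop (𝓝 0) := by
  have h : Tendsto (fun t : ℝ => Real.exp (-r * t)) atTop (𝓝 0) :=
    Real.tendsto_exp_atBot.comp (tendsto_id.const_mul_atTop_of_neg (by linarith))
  have h2 := ENNReal.tendsto_ofReal h
  rwa [ENNReal.ofReal_zero] at h2

lemma integrableOn_exp_Ioi {r : ℝ} (hr : 0 < r) :
    IntegrableOn (fun t : ℝ => Real.exp (-r * t)) (Ioi 0) :=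
  exp_neg_integrableOn_Ioi 0 hr

lemma lintegral_disc {r : ℝ} (hr : 0 < r) :
    ∫⁻ t in Ioi (0 : ℝ), disc r t = ENNReal.ofReal (1 / r) := by
  simp only [disc]
  rw [← ofReal_integral_eq_lintegral_ofReal (integrableOn_exp_Ioi hr)
    (ae_of_all _ fun t => (Real.exp_pos _).le), integral_exp_mul_Ioi (by linarith)]
  congr 1
  simp

/-- The functions describing the problem after subtracting a constant flow payoff: the certainty
measure `c`, the loss of virtual flow payoff `g` and the loss of flow payoff `U`. -/
structure LossData (r lam π : ℝ) (c g U : ℝ → ℝ≥0∞) : Prop where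
  cont_c : Continuous c
  cont_g : Continuous g
  cont_U : Continuous U
  U_le : ∃ B : ℝ≥0, ∀ q, U q ≤ B
  c_ne_top : ∀ q ∈ Ioo (0 : ℝ) 1, c q ≠ ∞
  g_ne_top : ∀ q ∈ Ioo (0 : ℝ) 1, g q ≠ ∞
  -- Integrated form of the derivative of `e^{-rt} c(ζ_t q)`, with every term on the side where it
  -- is added, so that it stays valid when `c q = ∞`.
  dynkin : ∀ q ∈ Icc (0 : ℝ) 1, ∀ l : ℝ, 0 ≤ l →
    (∫⁻ t in Ioc 0 l, disc r t * g (drift lam π t q)) + disc r l * c (drift lam π l q) =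
      c q + ∫⁻ t in Ioc 0 l, disc r t * U (drift lam π t q)
  -- Supplies the integrable majorant when a small extra drift is sent to zero.
  dominated : ∃ C : ℝ≥0, ∀ q ∈ Icc (0 : ℝ) 1, ∀ s : ℝ, 0 ≤ s →
    g (drift lam π s q) ≤ g q + C
  jensen : ∀ F : Measure ℝ, IsProbabilityMeasure F → (∀ᵐ x ∂F, x ∈ Icc (0 : ℝ) 1) →
    c (∫ x, x ∂F) ≤ ∫⁻ x, c x ∂F

/-- The drift can sit at an endpoint of `[0, 1]` only at time `0`. Integrals from `l / (n + 1)`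
avoid that time, so identities proved inside `(0, 1)` extend to `(0, l]`. -/
lemma tendsto_setLIntegral_Ioc {φ : ℝ → ℝ≥0∞} (hφ : Measurable φ) {l : ℝ} (hl : 0 ≤ l) :
    Tendsto (fun n : ℕ => ∫⁻ t in Ioc (l / (n + 1)) l, φ t) atTop (𝓝 (∫⁻ t in Ioc 0 l, φ t)) := by
  have h0 : Tendsto (fun n : ℕ => l / ((n : ℝ) + 1)) atTop (𝓝 0) := by
    simpa using (tendsto_one_div_add_atTop_nhds_zero_nat (𝕜 := ℝ)).const_mul l
      |>.congr fun n => by ring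
  have := (aecover_Ioc_of_Ioc (μ := volume) h0 (tendsto_const_nhds (x := l))).lintegral_tendsto_of_countably_generated
    (f := φ) hφ.aemeasurable
  refine this.congr fun n => ?_
  rw [Measure.restrict_restrict measurableSet_Ioc, inter_eq_self_of_subset_left]
  exact Ioc_subset_Ioc_left (by positivity)

lemma tendsto_setLIntegral_Ioi {φ : ℝ → ℝ≥0∞} (hφ : Measurable φ) :
    Tendsto (fun n : ℕ => ∫⁻ t in Ioc (0 : ℝ) n, φ t) atTop (𝓝 (∫⁻ t in Ioi (0 : ℝ), φ t)) := by
  have := (aecover_Iic (μ := volume.restrict (Ioi (0 : ℝ)))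
    (tendsto_natCast_atTop_atTop (R := ℝ))).lintegral_tendsto_of_countably_generated
    (f := φ) hφ.aemeasurable
  refine this.congr fun n => ?_
  rw [Measure.restrict_restrict measurableSet_Iic, inter_comm]
  rfl

section existence
variable {r lam π : ℝ} {u : ℝ → ℝ} {c : ℝ → ℝ≥0∞}

/-- The real-valued virtual flow payoff in the interior. -/
lemma virtualFlow_of_mem_Ioo (hc : IsCertaintyMeasure c) {q : ℝ} (hq : q ∈ Ioo (0 : ℝ) 1) :
    virtualFlow r lam π u c q =
      ((u q - r * (c q).toReal + lam * (π - q) * deriv (fun y => (c y).toReal) q : ℝ) : EReal) := by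
  rw [virtualFlow, cDeriv, if_neg (not_le.2 hq.1), if_neg (not_le.2 hq.2)]
  rw [EReal.coe_add, EReal.coe_sub, EReal.coe_mul r, EReal.coe_mul (lam * (π - q)),
    EReal.coe_ennreal_toReal (hc.finite q hq)]

/-- The signs cooperate at the endpoints: at `0` the factor `π - q` is positive and `c' < ∞`, at `1`
it is negative and `c' > -∞`. Neither summand of `f` is `+∞`, so no `∞ - ∞` arises. -/
lemma virtualFlow_ne_top (hr : 0 < r) (hlam : 0 < lam) (hπ : π ∈ Ioo (0 : ℝ) 1)
    {q : ℝ} (hq : q ∈ Icc (0 : ℝ) 1) :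
    (u q : EReal) - (r : EReal) * (c q : EReal) ≠ ⊤ ∧
      ((lam * (π - q) : ℝ) : EReal) * cDeriv c q ≠ ⊤ := by
  constructor
  · rw [sub_eq_add_neg]
    refine EReal.add_ne_top (EReal.coe_ne_top _) ?_
    rw [Ne, EReal.neg_eq_top_iff]
    refine ne_of_gt (lt_of_lt_of_le EReal.bot_lt_zero ?_)
    exact EReal.mul_nonneg (EReal.coe_nonneg.2 hr.le) (EReal.coe_ennreal_nonneg _)
  · rcases hq.1.eq_or_lt with h | h
    · have hpos : 0 < lam * (π - q) := mul_pos hlam (by rw [← h]; linarith [hπ.1])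
      have : cDeriv c q ≠ ⊤ := by
        rw [cDeriv, if_pos h.ge]
        exact ne_top_of_le_ne_top (EReal.coe_ne_top _)
          (iInf₂_le (1/2 : ℝ) (by norm_num : (1/2 : ℝ) ∈ Ioo (0 : ℝ) 1))
      rw [EReal.mul_ne_top]
      exact ⟨Or.inl (EReal.coe_ne_bot _), Or.inl (EReal.coe_nonneg.2 hpos.le),
        Or.inl (EReal.coe_ne_top _), Or.inr this⟩
    · rcases hq.2.eq_or_lt with h' | h'
      · have hpos : lam * (π - q) < 0 := mul_neg_of_pos_of_neg hlam (by rw [h']; linarith [hπ.2])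
        have : cDeriv c q ≠ ⊥ := by
          rw [cDeriv, if_neg (not_le.2 h), if_pos h'.ge]
          exact ne_bot_of_le_ne_bot (EReal.coe_ne_bot _)
            (le_iSup₂ (f := fun x (_ : x ∈ Ioo (0 : ℝ) 1) =>
              ((deriv (fun y => (c y).toReal) x : ℝ) : EReal)) (1/2 : ℝ) (by norm_num))
        rw [EReal.mul_ne_top]
        exact ⟨Or.inl (EReal.coe_ne_bot _), Or.inr this,
          Or.inl (EReal.coe_ne_top _), Or.inl (EReal.coe_nonpos.2 hpos.le)⟩
      · rw [cDeriv, if_neg (not_le.2 h), if_neg (not_le.2 h'), ← EReal.coe_mul]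
        exact EReal.coe_ne_top _

/-- Extended multiplication and addition are continuous away from `0 * ∞` and `∞ - ∞`. The first is
avoided because `π - q` vanishes only at the interior point `π`, where `c'` is finite; the second by
`virtualFlow_ne_top`. -/
lemma continuousOn_virtualFlow (hr : 0 < r) (hlam : 0 < lam) (hπ : π ∈ Ioo (0 : ℝ) 1)
    (hu : ContinuousOn u (Icc (0 : ℝ) 1)) (hc : IsCertaintyMeasure c) :
    ContinuousOn (virtualFlow r lam π u c) (Icc (0 : ℝ) 1) := by
  intro q hq
  obtain ⟨hn1, hn2⟩ := virtualFlow_ne_top (u := u) (c := c) hr hlam hπ hq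
  have hu' : ContinuousWithinAt (fun q => (u q : EReal)) (Icc (0 : ℝ) 1) q :=
    continuous_coe_real_ereal.continuousAt.comp_continuousWithinAt (hu q hq)
  have hc' : ContinuousWithinAt (fun q => (c q : EReal)) (Icc (0 : ℝ) 1) q :=
    continuous_coe_ennreal_ereal.continuousAt.comp_continuousWithinAt (hc.continuous q hq)
  have hrc : ContinuousWithinAt (fun q => (r : EReal) * (c q : EReal)) (Icc (0 : ℝ) 1) q := by
    have h := EReal.continuousAt_mul (p := ((r : EReal), (c q : EReal)))
      (Or.inl (by simpa using hr.ne')) (Or.inl (by simpa using hr.ne'))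
      (Or.inl (EReal.coe_ne_bot _)) (Or.inl (EReal.coe_ne_top _))
    exact h.comp_continuousWithinAt (f := fun q => ((r : EReal), (c q : EReal)))
      (continuousWithinAt_const.prodMk hc')
  have h1 : ContinuousWithinAt (fun q => (u q : EReal) - (r : EReal) * (c q : EReal))
      (Icc (0 : ℝ) 1) q := by
    have h0 : ∀ q, (-((r : EReal) * (c q : EReal))) ≠ ⊤ := fun q => by
      rw [Ne, EReal.neg_eq_top_iff]
      refine ne_of_gt (lt_of_lt_of_le EReal.bot_lt_zero ?_)
      exact EReal.mul_nonneg (EReal.coe_nonneg.2 hr.le) (EReal.coe_ennreal_nonneg _)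
    have h := EReal.continuousAt_add (p := ((u q : EReal), -((r : EReal) * (c q : EReal))))
      (Or.inl (EReal.coe_ne_top _)) (Or.inl (EReal.coe_ne_bot _))
    simp only [sub_eq_add_neg]
    exact h.comp_continuousWithinAt
      (f := fun q => ((u q : EReal), -((r : EReal) * (c q : EReal))))
      (hu'.prodMk (continuous_neg.continuousAt.comp_continuousWithinAt hrc))
  have h2 : ContinuousWithinAt (fun q => ((lam * (π - q) : ℝ) : EReal) * cDeriv c q)
      (Icc (0 : ℝ) 1) q := by
    have hd := hc.continuousOn_cDeriv q hq
    have hl : ContinuousWithinAt (fun q => ((lam * (π - q) : ℝ) : EReal)) (Icc (0 : ℝ) 1) q :=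
      (continuous_coe_real_ereal.comp (by fun_prop)).continuousWithinAt
    have hor : lam * (π - q) ≠ 0 ∨ (cDeriv c q ≠ ⊥ ∧ cDeriv c q ≠ ⊤) := by
      by_cases h : q ∈ Ioo (0 : ℝ) 1
      · right
        rw [cDeriv, if_neg (not_le.2 h.1), if_neg (not_le.2 h.2)]
        exact ⟨EReal.coe_ne_bot _, EReal.coe_ne_top _⟩
      · left
        refine mul_ne_zero hlam.ne' (sub_ne_zero.2 ?_)
        rintro rfl
        exact h hπ
    have h := EReal.continuousAt_mul (p := (((lam * (π - q) : ℝ) : EReal), cDeriv c q))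
      (hor.imp EReal.coe_ne_zero.2 (·.1)) (hor.imp EReal.coe_ne_zero.2 (·.2))
      (Or.inl (EReal.coe_ne_bot _)) (Or.inl (EReal.coe_ne_top _))
    exact h.comp_continuousWithinAt
      (f := fun q => (((lam * (π - q) : ℝ) : EReal), cDeriv c q)) (hl.prodMk hd)
  have h := EReal.continuousAt_add
    (p := ((u q : EReal) - (r : EReal) * (c q : EReal), ((lam * (π - q) : ℝ) : EReal) * cDeriv c q))
    (Or.inl hn1) (Or.inr hn2)
  exact h.comp_continuousWithinAt
    (f := fun q => ((u q : EReal) - (r : EReal) * (c q : EReal),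
      ((lam * (π - q) : ℝ) : EReal) * cDeriv c q)) (h1.prodMk h2)

end existence

end InfoAcq

end

noncomputable section

namespace InfoAcq

/-! ### Virtual losses and the integral identity along the drift -/

section existence
variable {r lam π : ℝ} {u : ℝ → ℝ} {c : ℝ → ℝ≥0∞}

/-- The loss `r c(q) + lam (q - π) c'(q)` of virtual flow payoff due to the certainty measure. -/
def certLoss (r lam π : ℝ) (c : ℝ → ℝ≥0∞) (q : ℝ) : ℝ :=
  r * (c q).toReal + lam * (q - π) * deriv (fun y => (c y).toReal) q

lemma virtualFlow_eq_sub_certLoss (hc : IsCertaintyMeasure c) {q : ℝ} (hq : q ∈ Ioo (0 : ℝ) 1) :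
    virtualFlow r lam π u c q = ((u q - certLoss r lam π c q : ℝ) : EReal) := by
  rw [virtualFlow_of_mem_Ioo hc hq, certLoss]
  congr 1; ring

/-- The tangent at `q`, evaluated at `π`, together with `c ≥ 0` gives `(q - π) c'(q) ≥ -c(π)`. This
bound is what makes `M - f` nonnegative for large `M`. -/
lemma le_certLoss (hr : 0 < r) (hlam : 0 < lam) (hπ : π ∈ Ioo (0 : ℝ) 1)
    (hc : IsCertaintyMeasure c) {q : ℝ} (hq : q ∈ Ioo (0 : ℝ) 1) :
    -(lam * (c π).toReal) ≤ certLoss r lam π c q := by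
  have h1 := hc.tangent_le hq hπ
  have h2 : 0 ≤ (c q).toReal := ENNReal.toReal_nonneg
  set d := deriv (fun y => (c y).toReal) q
  have h3 : -(c π).toReal ≤ (q - π) * d := by linarith
  have h4 := mul_le_mul_of_nonneg_left h3 hlam.le
  have h5 := mul_nonneg hr.le h2
  simp only [certLoss]
  linarith

/-- The drifted belief `x` lies between `q` and `π`. Convexity gives `c x ≤ c q + c π`; monotonicity
of `c'` gives `(x - π) c'(x) ≤ e^{-lam s} (q - π) c'(q)`, and the factor `e^{-lam s}` can be dropped
at the price of `c π` because `(q - π) c'(q) ≥ -c π`. -/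
lemma certLoss_drift_le (hr : 0 < r) (hlam : 0 < lam) (hπ : π ∈ Ioo (0 : ℝ) 1)
    (hc : IsCertaintyMeasure c) {q : ℝ} (hq : q ∈ Ioo (0 : ℝ) 1) {s : ℝ} (hs : 0 ≤ s) :
    certLoss r lam π c (drift lam π s q) ≤ certLoss r lam π c q + (r + lam) * (c π).toReal := by
  obtain ⟨he0, he1⟩ := exp_neg_mul_mem hlam hs
  have hx : drift lam π s q ∈ Ioo (0 : ℝ) 1 := by
    rcases hs.eq_or_lt with h | h
    · rwa [← h, drift_zero]
    · exact drift_mem_Ioo hlam hπ h (Ioo_subset_Icc_self hq)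
  have hxπ := drift_sub_target lam π s q
  have hconv := hc.convexOn_toReal.2 hq hπ he0.le (sub_nonneg.2 he1) (by ring)
  have hxe : drift lam π s q = Real.exp (-lam * s) • q + (1 - Real.exp (-lam * s)) • π := by
    simp [drift]
  rw [← hxe] at hconv
  simp only [smul_eq_mul] at hconv
  set x := drift lam π s q
  set e := Real.exp (-lam * s)
  have hq0 : 0 ≤ (c q).toReal := ENNReal.toReal_nonneg
  have hπ0 : 0 ≤ (c π).toReal := ENNReal.toReal_nonneg
  have hmono : (q - π) * deriv (fun y => (c y).toReal) x ≤
      (q - π) * deriv (fun y => (c y).toReal) q := by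
    rcases le_total q π with h | h
    · refine mul_le_mul_of_nonpos_left (hc.monotoneOn_deriv hq hx ?_) (by linarith)
      nlinarith
    · refine mul_le_mul_of_nonneg_left (hc.monotoneOn_deriv hx hq ?_) (by linarith)
      nlinarith
  have h1 := hc.tangent_le hq hπ
  set k := (q - π) * deriv (fun y => (c y).toReal) q with hk
  have hk0 : -(c π).toReal ≤ k := by
    rw [hk]; linarith
  have h2 : (x - π) * deriv (fun y => (c y).toReal) x ≤ k + (c π).toReal := by
    rw [hxπ, mul_assoc]
    have := mul_le_mul_of_nonneg_left hmono he0.le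
    nlinarith
  have h3 : (c x).toReal ≤ (c q).toReal + (c π).toReal := by nlinarith
  have h4 := mul_le_mul_of_nonneg_left h2 hlam.le
  have h5 := mul_le_mul_of_nonneg_left h3 hr.le
  simp only [certLoss, mul_assoc, ← hk]
  linarith

lemma continuousOn_certLoss (hc : IsCertaintyMeasure c) :
    ContinuousOn (certLoss r lam π c) (Ioo (0 : ℝ) 1) :=
  (continuousOn_const.mul hc.contDiff.continuousOn).add
    ((by fun_prop : ContinuousOn (fun q => lam * (q - π)) (Ioo (0 : ℝ) 1)).mul hc.continuousOn_deriv)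

/-- Integration of the discounted certainty measure along the drift, away from the boundary. -/
lemma setLIntegral_drift_interior (hr : 0 < r) (hlam : 0 < lam) (hπ : π ∈ Ioo (0 : ℝ) 1)
    (hu : ContinuousOn u (Icc (0 : ℝ) 1)) (hc : IsCertaintyMeasure c) {M : ℝ}
    (hM : ∀ q ∈ Icc (0 : ℝ) 1, u q + lam * (c π).toReal ≤ M) {q : ℝ} (hq : q ∈ Icc (0 : ℝ) 1)
    {ε l : ℝ} (hε : 0 < ε) (hεl : ε ≤ l) :
    (∫⁻ t in Ioc ε l, disc r t * ENNReal.ofReal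
        (M - u (drift lam π t q) + certLoss r lam π c (drift lam π t q))) +
        disc r l * c (drift lam π l q) =
      disc r ε * c (drift lam π ε q) +
        ∫⁻ t in Ioc ε l, disc r t * ENNReal.ofReal (M - u (drift lam π t q)) := by
  have hmem : ∀ t ∈ Icc ε l, drift lam π t q ∈ Ioo (0 : ℝ) 1 := fun t ht =>
    drift_mem_Ioo hlam hπ (hε.trans_le ht.1) hq
  have hd : Continuous fun t => drift lam π t q :=
    (continuous_drift lam π).comp (continuous_id.prodMk continuous_const)
  have he : Continuous fun t : ℝ => Real.exp (-r * t) := by fun_prop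
  set V : ℝ → ℝ := fun t => Real.exp (-r * t) * (M - u (drift lam π t q)) with hV
  set H : ℝ → ℝ := fun t => Real.exp (-r * t) * certLoss r lam π c (drift lam π t q) with hH
  set Φ : ℝ → ℝ := fun t => Real.exp (-r * t) * (c (drift lam π t q)).toReal with hΦ
  have hVc : ContinuousOn V (Icc ε l) := he.continuousOn.mul (continuousOn_const.sub
    (hu.comp hd.continuousOn fun t ht => Ioo_subset_Icc_self (hmem t ht)))
  have hHc : ContinuousOn H (Icc ε l) := he.continuousOn.mul
    ((continuousOn_certLoss hc).comp hd.continuousOn hmem)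
  have hVi : IntervalIntegrable V volume ε l := (by rwa [uIcc_of_le hεl] :
    ContinuousOn V (uIcc ε l)).intervalIntegrable
  have hHi : IntervalIntegrable H volume ε l := (by rwa [uIcc_of_le hεl] :
    ContinuousOn H (uIcc ε l)).intervalIntegrable
  -- The product rule and the drift equation produce exactly `certLoss`.
  have hder : ∀ t ∈ uIcc ε l, HasDerivAt Φ (-H t) t := by
    intro t ht
    rw [uIcc_of_le hεl] at ht
    have h1 : HasDerivAt (fun t => Real.exp (-r * t)) (Real.exp (-r * t) * (-r * 1)) t :=
      ((hasDerivAt_id t).const_mul (-r)).exp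
    have h2 := (hc.hasDerivAt (hmem t ht)).comp t (hasDerivAt_drift lam π q t)
    refine (h1.mul h2).congr_deriv ?_
    simp only [hH, certLoss, Function.comp]
    ring
  have hFTC := intervalIntegral.integral_eq_sub_of_hasDerivAt hder hHi.neg
  rw [intervalIntegral.integral_neg] at hFTC
  have hV0 : ∀ t ∈ Ioc ε l, 0 ≤ V t := fun t ht => mul_nonneg (Real.exp_pos _).le (by
    have h1 := hM _ (Ioo_subset_Icc_self (hmem t (Ioc_subset_Icc_self ht)))
    have h2 : 0 ≤ lam * (c π).toReal := mul_nonneg hlam.le ENNReal.toReal_nonneg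
    linarith)
  -- The choice of `M` absorbs the lower bound of `le_certLoss`, so both integrands are nonnegative
  -- and real integrals can be read in `[0, ∞]`.
  have hVH0 : ∀ t ∈ Ioc ε l, 0 ≤ V t + H t := fun t ht => by
    have h1 := hM _ (Ioo_subset_Icc_self (hmem t (Ioc_subset_Icc_self ht)))
    have h2 := le_certLoss hr hlam hπ hc (hmem t (Ioc_subset_Icc_self ht))
    simp only [hV, hH]
    rw [← mul_add]
    exact mul_nonneg (Real.exp_pos _).le (by linarith)
  have e1 : (∫⁻ t in Ioc ε l, disc r t * ENNReal.ofReal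
      (M - u (drift lam π t q) + certLoss r lam π c (drift lam π t q))) =
      ENNReal.ofReal (∫ t in ε..l, (V t + H t)) := by
    rw [intervalIntegral.integral_of_le hεl, ofReal_integral_eq_lintegral_ofReal
      (hVi.add hHi).1 ((ae_restrict_iff' measurableSet_Ioc).2 (ae_of_all _ hVH0))]
    refine lintegral_congr fun t => ?_
    rw [disc, ← ENNReal.ofReal_mul (Real.exp_pos _).le, mul_add]
  have e2 : (∫⁻ t in Ioc ε l, disc r t * ENNReal.ofReal (M - u (drift lam π t q))) =
      ENNReal.ofReal (∫ t in ε..l, V t) := by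
    rw [intervalIntegral.integral_of_le hεl, ofReal_integral_eq_lintegral_ofReal
      hVi.1 ((ae_restrict_iff' measurableSet_Ioc).2 (ae_of_all _ hV0))]
    refine lintegral_congr fun t => ?_
    rw [disc, ← ENNReal.ofReal_mul (Real.exp_pos _).le]
  have e3 : ∀ t ∈ Icc ε l, disc r t * c (drift lam π t q) = ENNReal.ofReal (Φ t) := fun t ht => by
    rw [hΦ, ENNReal.ofReal_mul (Real.exp_pos _).le, ENNReal.ofReal_toReal (hc.finite _ (hmem t ht)),
      disc]
  have hΦ0 : ∀ t, 0 ≤ Φ t := fun t => mul_nonneg (Real.exp_pos _).le ENNReal.toReal_nonneg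
  rw [e1, e2, e3 l ⟨hεl, le_rfl⟩, e3 ε ⟨le_rfl, hεl⟩, ← ENNReal.ofReal_add _ (hΦ0 l),
    ← ENNReal.ofReal_add (hΦ0 ε), intervalIntegral.integral_add hVi hHi]
  · congr 1; linarith
  · rw [intervalIntegral.integral_of_le hεl]
    exact setIntegral_nonneg measurableSet_Ioc hV0
  · rw [intervalIntegral.integral_of_le hεl]
    exact setIntegral_nonneg measurableSet_Ioc hVH0

/-- After subtracting a large constant, the flow payoff and the virtual flow payoff become
losses. -/
theorem exists_lossData (hr : 0 < r) (hlam : 0 < lam) (hπ : π ∈ Ioo (0 : ℝ) 1)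
    (hu : ContinuousOn u (Icc (0 : ℝ) 1)) (hc : IsCertaintyMeasure c) :
    ∃ (M : ℝ≥0) (c' g U : ℝ → ℝ≥0∞), LossData r lam π c' g U ∧
      (∀ q ∈ Icc (0 : ℝ) 1, c' q = c q) ∧
      (∀ q ∈ Icc (0 : ℝ) 1, virtualFlow r lam π u c q = ((M : ℝ) : EReal) - (g q : EReal)) ∧
      (∀ q ∈ Icc (0 : ℝ) 1, u q ≤ M ∧ U q = ENNReal.ofReal (M - u q)) := by
  obtain ⟨K, hK⟩ := isCompact_Icc.exists_bound_of_continuousOn hu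
  have hπ0 : 0 ≤ lam * (c π).toReal := mul_nonneg hlam.le ENNReal.toReal_nonneg
  have hK0 : 0 ≤ K := (norm_nonneg _).trans (hK 0 (by norm_num))
  -- `K` bounds `|u|`, and `lam * c π` compensates the possible negativity of `certLoss`; together
  -- they give `f ≤ M`.
  set M : ℝ≥0 := (K + lam * (c π).toReal).toNNReal with hMdef
  have hMe : (M : ℝ) = K + lam * (c π).toReal := Real.coe_toNNReal _ (by positivity)
  have hM : ∀ q ∈ Icc (0 : ℝ) 1, u q + lam * (c π).toReal ≤ M := fun q hq => by
    rw [hMe]; linarith [le_abs_self (u q), hK q hq, Real.norm_eq_abs (u q)]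
  have hfc := continuousOn_virtualFlow (u := u) hr hlam hπ hu hc
  set f := virtualFlow r lam π u c with hf
  have hfM : ∀ q ∈ Icc (0 : ℝ) 1, f q ≤ ((M : ℝ) : EReal) := by
    rw [← closure_Ioo (zero_ne_one' ℝ)]
    refine le_on_closure (fun q hq => ?_) ?_ continuousOn_const
    · rw [hf, virtualFlow_eq_sub_certLoss hc hq, EReal.coe_le_coe_iff]
      linarith [hM q (Ioo_subset_Icc_self hq), le_certLoss hr hlam hπ hc hq]
    · rwa [closure_Ioo (zero_ne_one' ℝ)]
  -- Clamping the argument turns continuity on `[0, 1]` into continuity on the whole line.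
  set g : ℝ → ℝ≥0∞ := fun q => (((M : ℝ) : EReal) - f (clamp q)).toENNReal with hg
  set U : ℝ → ℝ≥0∞ := fun q => ENNReal.ofReal (M - u (clamp q)) with hU
  have hgc : Continuous g := by
    refine ContinuousOn.comp_clamp (f := fun q => (((M : ℝ) : EReal) - f q).toENNReal) ?_
    intro q hq
    refine EReal.continuous_toENNReal.continuousAt.comp_continuousWithinAt ?_
    have h := EReal.continuousAt_add (p := (((M : ℝ) : EReal), - f q))
      (Or.inl (EReal.coe_ne_top _)) (Or.inl (EReal.coe_ne_bot _))
    simp only [sub_eq_add_neg]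
    exact h.comp_continuousWithinAt (f := fun q => (((M : ℝ) : EReal), - f q))
      (continuousWithinAt_const.prodMk (continuous_neg.continuousAt.comp_continuousWithinAt
        (hfc q hq)))
  have hUc : Continuous U := ENNReal.continuous_ofReal.comp
    (continuous_const.sub hu.comp_clamp)
  have hgIoo : ∀ q ∈ Ioo (0 : ℝ) 1,
      g q = ENNReal.ofReal (M - u q + certLoss r lam π c q) := fun q hq => by
    rw [hg]
    simp only
    rw [clamp_of_mem (Ioo_subset_Icc_self hq), hf, virtualFlow_eq_sub_certLoss hc hq,
      ← EReal.coe_sub, EReal.real_coe_toENNReal]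
    congr 1; ring
  have hUIcc : ∀ q ∈ Icc (0 : ℝ) 1, U q = ENNReal.ofReal (M - u q) := fun q hq => by
    rw [hU]; simp only [clamp_of_mem hq]
  refine ⟨M, fun q => c (clamp q), g, U, ⟨hc.continuous.comp_clamp, hgc, hUc,
    ⟨(M + K).toNNReal, fun q => ?_⟩, fun q hq => ?_, fun q hq => ?_, fun q hq l hl => ?_, ?_,
    fun F hF hF1 => ?_⟩,
    fun q hq => by simp only [clamp_of_mem hq], fun q hq => ?_, fun q hq => ⟨?_, hUIcc q hq⟩⟩
  · refine ENNReal.ofReal_le_ofReal ?_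
    linarith [neg_abs_le (u (clamp q)), hK _ (clamp_mem q), Real.norm_eq_abs (u (clamp q))]
  · rw [clamp_of_mem (Ioo_subset_Icc_self hq)]; exact hc.finite q hq
  · rw [hgIoo q hq]; exact ENNReal.ofReal_ne_top
  · rcases hl.eq_or_lt with h | h
    · rw [← h]; simp [disc_zero, drift_zero]
    have hd : Continuous fun t => drift lam π t q :=
      (continuous_drift lam π).comp (continuous_id.prodMk continuous_const)
    have hcc : Continuous fun q => c (clamp q) := hc.continuous.comp_clamp
    have hlim0 : Tendsto (fun n : ℕ => l / ((n : ℝ) + 1)) atTop (𝓝 0) := by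
      simpa using (tendsto_one_div_add_atTop_nhds_zero_nat (𝕜 := ℝ)).const_mul l
        |>.congr fun n => by ring
    have hlim1 := (tendsto_setLIntegral_Ioc (φ := fun t => disc r t * g (drift lam π t q))
      ((measurable_disc r).mul (hgc.comp hd).measurable) hl).add
        (tendsto_const_nhds (x := disc r l * c (clamp (drift lam π l q))))
    -- The limit is correct even if `c q = ∞`, because the discount factor tends to `1` and not to
    -- `0`.
    have hB : Tendsto (fun n : ℕ => disc r (l / ((n : ℝ) + 1)) *
        c (clamp (drift lam π (l / ((n : ℝ) + 1)) q))) atTop (𝓝 (c (clamp q))) := by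
      have h1 : Tendsto (fun n : ℕ => disc r (l / ((n : ℝ) + 1))) atTop (𝓝 1) := by
        have := ((continuous_disc r).tendsto 0).comp hlim0
        rwa [disc_zero] at this
      have h2 : Tendsto (fun n : ℕ => c (clamp (drift lam π (l / ((n : ℝ) + 1)) q))) atTop
          (𝓝 (c (clamp q))) := by
        have := ((hcc.comp hd).tendsto 0).comp hlim0
        simp only [Function.comp, drift_zero] at this
        exact this
      have := ENNReal.Tendsto.mul h1 (Or.inl one_ne_zero) h2 (Or.inr ENNReal.one_ne_top)
      rwa [one_mul] at this
    have hlim2 := hB.add (tendsto_setLIntegral_Ioc (φ := fun t => disc r t * U (drift lam π t q))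
      ((measurable_disc r).mul (hUc.comp hd).measurable) hl)
    refine tendsto_nhds_unique hlim1 (hlim2.congr fun n => ?_)
    have hpos : 0 < l / ((n : ℝ) + 1) := by positivity
    have hle : l / ((n : ℝ) + 1) ≤ l := div_le_self hl (by linarith [Nat.cast_nonneg (α := ℝ) n])
    rw [clamp_of_mem (drift_mem_Icc hlam hπ hpos.le hq), clamp_of_mem (drift_mem_Icc hlam hπ hl hq)]
    have key := setLIntegral_drift_interior hr hlam hπ hu hc hM hq hpos hle
    have i1 : ∫⁻ t in Ioc (l / ((n : ℝ) + 1)) l, disc r t * g (drift lam π t q) =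
        ∫⁻ t in Ioc (l / ((n : ℝ) + 1)) l, disc r t * ENNReal.ofReal
          (M - u (drift lam π t q) + certLoss r lam π c (drift lam π t q)) :=
      setLIntegral_congr_fun measurableSet_Ioc fun t ht => by
        simp only [hgIoo _ (drift_mem_Ioo hlam hπ (hpos.trans ht.1) hq)]
    have i2 : ∫⁻ t in Ioc (l / ((n : ℝ) + 1)) l, disc r t * U (drift lam π t q) =
        ∫⁻ t in Ioc (l / ((n : ℝ) + 1)) l, disc r t * ENNReal.ofReal (M - u (drift lam π t q)) :=
      setLIntegral_congr_fun measurableSet_Ioc fun t ht => by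
        simp only [hUIcc _ (drift_mem_Icc hlam hπ (hpos.trans ht.1).le hq)]
    rw [i1, i2]
    exact key.symm
  · refine ⟨(2 * K + (r + lam) * (c π).toReal).toNNReal, fun q hq s hs => ?_⟩
    rw [← closure_Ioo (zero_ne_one' ℝ)] at hq
    revert q
    refine le_on_closure (fun q hq => ?_) (Continuous.continuousOn ?_)
      (hgc.add continuous_const).continuousOn
    · have hx : drift lam π s q ∈ Ioo (0 : ℝ) 1 := by
        rcases hs.eq_or_lt with h | h
        · rwa [← h, drift_zero]
        · exact drift_mem_Ioo hlam hπ h (Ioo_subset_Icc_self hq)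
      have h0 : 0 ≤ (c π).toReal := ENNReal.toReal_nonneg
      rw [hgIoo _ hx, hgIoo _ hq, ← ENNReal.ofReal, ← ENNReal.ofReal_add _ (by positivity)]
      · refine ENNReal.ofReal_le_ofReal ?_
        linarith [certLoss_drift_le hr hlam hπ hc hq hs, neg_abs_le (u (drift lam π s q)),
          hK _ (Ioo_subset_Icc_self hx), Real.norm_eq_abs (u (drift lam π s q)),
          le_abs_self (u q), hK _ (Ioo_subset_Icc_self hq), Real.norm_eq_abs (u q)]
      · linarith [hM q (Ioo_subset_Icc_self hq), le_certLoss hr hlam hπ hc hq]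
    · exact hgc.comp ((continuous_drift lam π).comp (continuous_const.prodMk continuous_id))
  · have hint : Integrable (fun x : ℝ => x) F :=
      Integrable.of_bound aestronglyMeasurable_id 1 (hF1.mono fun x hx => by
        rw [Real.norm_eq_abs, abs_of_nonneg hx.1]; exact hx.2)
    have hm : ∫ x, x ∂F ∈ Icc (0 : ℝ) 1 := (convex_Icc 0 1).integral_mem isClosed_Icc hF1 hint
    simp only [clamp_of_mem hm]
    refine (hc.jensen hF1).trans_eq (lintegral_congr_ae (hF1.mono fun x hx => ?_))
    simp only [clamp_of_mem hx]
  · rw [hg]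
    simp only [clamp_of_mem hq]
    have h0 : (0 : EReal) ≤ ((M : ℝ) : EReal) - f q :=
      (EReal.sub_nonneg (Or.inl (EReal.coe_ne_top _)) (Or.inl (EReal.coe_ne_bot _))).2 (hfM q hq)
    rw [EReal.coe_toENNReal h0]
    induction hfq : f q with
    | bot => simp
    | coe x => norm_cast; ring
    | top => exact absurd (hfM q hq) (by rw [hfq]; simp)
  · linarith [hM q hq]

end existence

end InfoAcq

end

noncomputable section

namespace InfoAcq

/-! ### Extended integrals of differences -/

/-- As `A` and `B` are finite, `D` and `G` are infinite together, and otherwise this is real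
arithmetic. -/
lemma ereal_sub_eq_sub {A B D G : ℝ≥0∞} (hA : A ≠ ∞) (hB : B ≠ ∞) (h : B + G = A + D) :
    (B : EReal) - (D : EReal) = (A : EReal) - (G : EReal) := by
  rcases eq_or_ne G ∞ with hG | hG
  · have hD : D = ∞ := by
      by_contra hD
      rw [hG, add_top] at h
      exact (ENNReal.add_ne_top.2 ⟨hA, hD⟩) h.symm
    rw [hG, hD, EReal.coe_ennreal_top, EReal.sub_top, EReal.sub_top]
  · have hD : D ≠ ∞ := by
      rintro rfl
      rw [add_top] at h
      exact (ENNReal.add_ne_top.2 ⟨hB, hG⟩) h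
    lift A to ℝ≥0 using hA
    lift B to ℝ≥0 using hB
    lift D to ℝ≥0 using hD
    lift G to ℝ≥0 using hG
    have h' : (B : ℝ) + G = A + D := by exact_mod_cast h
    simp only [EReal.coe_nnreal_eq_coe_real]
    rw [← EReal.coe_sub, ← EReal.coe_sub]
    congr 1; linarith

/-- Pointwise `(a - g)⁺ + g = max a g = a + (g - a)⁺`. Integrating and rearranging is legitimate
because only `∫ a` has to be finite; `∫ g` may be infinite. -/
lemma extIntegral_sub {α : Type} [MeasurableSpace α] {μ : Measure α} {a : α → ℝ≥0}
    {g : α → ℝ≥0∞} (ha : AEMeasurable a μ) (hg : AEMeasurable g μ)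
    (hA : ∫⁻ x, a x ∂μ ≠ ∞) :
    extIntegral μ (fun x => ((a x : ℝ) : EReal) - (g x : EReal)) =
      ((∫⁻ x, a x ∂μ : ℝ≥0∞) : EReal) - ((∫⁻ x, g x ∂μ : ℝ≥0∞) : EReal) := by
  have ha' : AEMeasurable (fun x => (a x : ℝ≥0∞)) μ := ha.coe_nnreal_ennreal
  have e1 : ∀ x, (((a x : ℝ) : EReal) - (g x : EReal)).toENNReal = a x - g x := fun x => by
    rw [EReal.toENNReal_sub (EReal.coe_ennreal_nonneg _), EReal.toENNReal_coe,
      EReal.real_coe_toENNReal, ENNReal.ofReal_coe_nnreal]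
  have e2 : ∀ x, (-(((a x : ℝ) : EReal) - (g x : EReal))).toENNReal = g x - a x := fun x => by
    rw [EReal.neg_sub (Or.inl (EReal.coe_ne_bot _)) (Or.inl (EReal.coe_ne_top _)), add_comm,
      ← sub_eq_add_neg, EReal.toENNReal_sub (EReal.coe_nonneg.2 (NNReal.coe_nonneg _)),
      EReal.toENNReal_coe, EReal.real_coe_toENNReal, ENNReal.ofReal_coe_nnreal]
  simp only [extIntegral, e1, e2]
  refine ereal_sub_eq_sub hA (ne_top_of_le_ne_top hA (lintegral_mono fun x => tsub_le_self)) ?_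
  rw [← lintegral_add_right' _ hg, ← lintegral_add_left' ha']
  refine lintegral_congr fun x => ?_
  rw [tsub_add_eq_max, add_comm, tsub_add_eq_max, max_comm]

/-! ### Discounted losses along a path -/

/-- The discounted integral of a loss along a path. -/
def discLoss (r : ℝ) (φ : ℝ → ℝ≥0∞) (x : ℝ → ℝ) : ℝ≥0∞ :=
  ∫⁻ t in Ioi (0 : ℝ), disc r t * φ (x t)

lemma extIntegral_path {r : ℝ} (hr : 0 < r) {M : ℝ≥0} {f : ℝ → EReal} {g : ℝ → ℝ≥0∞}
    (hg : Measurable g)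
    (hf : ∀ q ∈ Icc (0 : ℝ) 1, f q = ((M : ℝ) : EReal) - (g q : EReal)) {x : ℝ → ℝ}
    (hx : Measurable x) (hmem : ∀ t, x t ∈ Icc (0 : ℝ) 1) :
    extIntegral (volume.restrict (Ioi (0 : ℝ)))
        (fun t => ((Real.exp (-r * t) : ℝ) : EReal) * f (x t)) =
      ((M / r : ℝ) : EReal) - (discLoss r g x : EReal) := by
  have he : ∀ t, ((Real.exp (-r * t) : ℝ) : EReal) * f (x t) =
      ((((Real.exp (-r * t)).toNNReal * M : ℝ≥0) : ℝ) : EReal) -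
        ((disc r t * g (x t) : ℝ≥0∞) : EReal) := by
    intro t
    have hpos : (0 : ℝ) ≤ Real.exp (-r * t) := (Real.exp_pos _).le
    rw [hf _ (hmem t), EReal.mul_sub_of_nonneg_of_ne_top (EReal.coe_nonneg.2 hpos)
      (EReal.coe_ne_top _), EReal.coe_ennreal_mul, disc, EReal.coe_ennreal_ofReal,
      max_eq_left hpos, NNReal.coe_mul, EReal.coe_mul, Real.coe_toNNReal _ hpos]
  have hint : ∫⁻ t in Ioi (0 : ℝ), (((Real.exp (-r * t)).toNNReal * M : ℝ≥0) : ℝ≥0∞) =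
      ENNReal.ofReal (M / r) := by
    have : ∀ t : ℝ, (((Real.exp (-r * t)).toNNReal * M : ℝ≥0) : ℝ≥0∞) =
        disc r t * M := fun t => by
      rw [ENNReal.coe_mul, disc, ENNReal.ofReal]
    simp only [this]
    rw [lintegral_mul_const _ (measurable_disc r), lintegral_disc hr,
      ← ENNReal.ofReal_coe_nnreal (p := M), ← ENNReal.ofReal_mul (by positivity)]
    congr 1; ring
  simp only [he]
  rw [extIntegral_sub, hint]
  · rw [EReal.coe_ennreal_ofReal, max_eq_left (by positivity)]; rfl
  · exact (by fun_prop : Measurable fun t : ℝ => (Real.exp (-r * t)).toNNReal * M).aemeasurable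
  · exact ((measurable_disc r).mul (hg.comp hx)).aemeasurable
  · rw [hint]; exact ENNReal.ofReal_ne_top

/-- The expected discounted virtual flow payoff in terms of the expected discounted loss. -/
lemma extIntegral_process {r : ℝ} (hr : 0 < r) {M : ℝ≥0} {f : ℝ → EReal} {g : ℝ → ℝ≥0∞}
    (hg : Measurable g)
    (hf : ∀ q ∈ Icc (0 : ℝ) 1, f q = ((M : ℝ) : EReal) - (g q : EReal))
    {Ω : Type} [MeasurableSpace Ω] {Q : Measure Ω} [IsProbabilityMeasure Q] {P : ℝ≥0 → Ω → ℝ}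
    (hP : Measurable fun x : ℝ≥0 × Ω => P x.1 x.2) (hmem : ∀ t ω, P t ω ∈ Icc (0 : ℝ) 1) :
    extIntegral Q (fun ω => extIntegral (volume.restrict (Ioi (0 : ℝ)))
        fun t => ((Real.exp (-r * t) : ℝ) : EReal) * f (P t.toNNReal ω)) =
      ((M / r : ℝ) : EReal) -
        ((∫⁻ ω, discLoss r g (fun t => P t.toNNReal ω) ∂Q : ℝ≥0∞) : EReal) := by
  have hm : Measurable fun x : Ω × ℝ => P x.2.toNNReal x.1 :=
    hP.comp ((measurable_real_toNNReal.comp measurable_snd).prodMk measurable_fst)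
  have h1 : ∀ ω, extIntegral (volume.restrict (Ioi (0 : ℝ)))
      (fun t => ((Real.exp (-r * t) : ℝ) : EReal) * f (P t.toNNReal ω)) =
      (((M / r.toNNReal : ℝ≥0) : ℝ) : EReal) -
        (discLoss r g (fun t => P t.toNNReal ω) : EReal) := fun ω => by
    rw [extIntegral_path hr hg hf (x := fun t => P t.toNNReal ω)
      (hm.comp measurable_prodMk_left) fun t => hmem _ _]
    rw [NNReal.coe_div, Real.coe_toNNReal r hr.le]
  simp only [h1]
  rw [extIntegral_sub (a := fun _ => M / r.toNNReal) measurable_const.aemeasurable]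
  · rw [lintegral_const, measure_univ, mul_one, EReal.coe_nnreal_eq_coe_real, NNReal.coe_div, Real.coe_toNNReal r hr.le]
  · refine (Measurable.lintegral_prod_right' (f := fun x : Ω × ℝ =>
      disc r x.2 * g (P x.2.toNNReal x.1)) ?_).aemeasurable
    exact ((measurable_disc r).comp measurable_snd).mul (hg.comp hm)
  · simp

/-- The first point of the grid `(n + 1)⁻¹ ℕ` strictly above `t`. -/
def gridAbove (n : ℕ) (t : ℝ≥0) : ℝ≥0 := (⌊(n + 1 : ℝ≥0) * t⌋₊ + 1 : ℕ) / (n + 1 : ℝ≥0)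

lemma lt_gridAbove (n : ℕ) (t : ℝ≥0) : t < gridAbove n t := by
  rw [gridAbove, lt_div_iff₀ (by positivity), mul_comm]
  exact_mod_cast Nat.lt_floor_add_one _

lemma tendsto_gridAbove (t : ℝ≥0) : Tendsto (fun n => gridAbove n t) atTop (𝓝[>] t) := by
  refine tendsto_nhdsWithin_iff.2 ⟨?_, Eventually.of_forall fun n => lt_gridAbove n t⟩
  have hlim : Tendsto (fun n : ℕ => t + 1 / ((n : ℝ≥0) + 1)) atTop (𝓝 t) := by
    simpa using tendsto_const_nhds.add (tendsto_one_div_add_atTop_nhds_zero_nat (𝕜 := ℝ≥0))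
  refine tendsto_of_tendsto_of_tendsto_of_le_of_le tendsto_const_nhds hlim
    (fun n => (lt_gridAbove n t).le) (fun n => ?_)
  simp only
  rw [gridAbove, div_le_iff₀ (by positivity), add_mul t, div_mul_cancel₀ _ (by positivity)]
  push_cast
  gcongr
  rw [mul_comm t]
  exact Nat.floor_le zero_le

/-- The grid is countable, so measurability of each `P t` suffices for evaluation at a random grid
time. -/
lemma measurable_gridAbove {Ω Ω' : Type} [MeasurableSpace Ω] [MeasurableSpace Ω'] {P : ℝ≥0 → Ω → ℝ}
    (hm : ∀ t, Measurable (P t)) (n : ℕ) {σ : Ω' → ℝ≥0} (hσ : Measurable σ) {ψ : Ω' → Ω}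
    (hψ : Measurable ψ) : Measurable fun x => P (gridAbove n (σ x)) (ψ x) := by
  have h1 : ∀ z : ℕ → ℝ≥0, Measurable fun x : ℕ × Ω => P (z x.1) x.2 := fun z =>
    measurable_from_prod_countable_right fun k => hm (z k)
  have h2 : Measurable fun x => (⌊(n + 1 : ℝ≥0) * σ x⌋₊, ψ x) :=
    (Nat.measurable_floor.comp (hσ.const_mul _)).prodMk hψ
  obtain ⟨z, hz⟩ : ∃ z : ℕ → ℝ≥0, ∀ k : ℕ, z k = (k + 1 : ℕ) / (n + 1 : ℝ≥0) := ⟨_, fun _ => rfl⟩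
  have h3 : ∀ x, gridAbove n (σ x) = z ⌊(n + 1 : ℝ≥0) * σ x⌋₊ := fun x => by rw [hz, gridAbove]
  simp only [h3]
  exact (h1 z).comp h2

/-- A process with right-continuous paths is jointly measurable. -/
lemma measurable_uncurry_of_rightCont {Ω : Type} [MeasurableSpace Ω] {P : ℝ≥0 → Ω → ℝ}
    (hm : ∀ t, Measurable (P t)) (hr : ∀ ω t, ContinuousWithinAt (fun s => P s ω) (Ici t) t) :
    Measurable fun x : ℝ≥0 × Ω => P x.1 x.2 := by
  refine measurable_of_tendsto_metrizable (f := fun n (x : ℝ≥0 × Ω) => P (gridAbove n x.1) x.2)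
    (fun n => measurable_gridAbove hm n measurable_fst measurable_snd) ?_
  rw [tendsto_pi_nhds]
  rintro ⟨t, ω⟩
  exact (hr ω t).tendsto.comp ((tendsto_gridAbove t).mono_right
    (nhdsWithin_mono _ Ioi_subset_Ici_self))

section LossData
variable {r lam π : ℝ} {c g U : ℝ → ℝ≥0∞}

lemma LossData.measurable_g (h : LossData r lam π c g U) : Measurable g := h.cont_g.measurable
lemma LossData.measurable_c (h : LossData r lam π c g U) : Measurable c := h.cont_c.measurable
lemma LossData.measurable_U (h : LossData r lam π c g U) : Measurable U := h.cont_U.measurable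

lemma measurable_drift (lam π q : ℝ) : Measurable fun t => drift lam π t q :=
  ((continuous_drift lam π).comp (continuous_id.prodMk continuous_const)).measurable

/-- The discounted loss of virtual flow payoff along the drift. -/
lemma LossData.discLoss_drift (h : LossData r lam π c g U) (hr : 0 < r) (hlam : 0 < lam)
    (hπ : π ∈ Ioo (0 : ℝ) 1) {q : ℝ} (hq : q ∈ Icc (0 : ℝ) 1) :
    discLoss r g (fun t => drift lam π t q) = c q + discLoss r U fun t => drift lam π t q := by
  have h1 := tendsto_setLIntegral_Ioi (φ := fun t => disc r t * g (drift lam π t q))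
    ((measurable_disc r).mul (h.measurable_g.comp (measurable_drift lam π q)))
  have h2 := tendsto_setLIntegral_Ioi (φ := fun t => disc r t * U (drift lam π t q))
    ((measurable_disc r).mul (h.measurable_U.comp (measurable_drift lam π q)))
  -- The boundary term of the integral identity vanishes: the drift tends to `π`, where `c` is
  -- finite, while the discount tends to `0`.
  have h3 : Tendsto (fun n : ℕ => disc r n * c (drift lam π n q)) atTop (𝓝 0) := by
    have e1 := (tendsto_disc_atTop hr).comp (tendsto_natCast_atTop_atTop (R := ℝ))
    have e2 := ((h.cont_c.tendsto π).comp (tendsto_drift_atTop hlam π q)).comp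
      (tendsto_natCast_atTop_atTop (R := ℝ))
    have := ENNReal.Tendsto.mul e1 (Or.inr (h.c_ne_top π hπ)) e2 (Or.inr ENNReal.zero_ne_top)
    rwa [zero_mul] at this
  have h4 := h1.add h3
  rw [add_zero] at h4
  exact tendsto_nhds_unique h4 ((h2.const_add (c q)).congr fun n =>
    (h.dynkin q hq n (Nat.cast_nonneg n)).symm)

lemma discLoss_U_le (hr : 0 < r) {B : ℝ≥0} (hB : ∀ q, U q ≤ B)
    (x : ℝ → ℝ) : discLoss r U x ≤ ENNReal.ofReal (1 / r) * B := by
  rw [← lintegral_disc hr, ← lintegral_mul_const _ (measurable_disc r)]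
  exact lintegral_mono fun t => by gcongr; exact hB _

lemma LossData.discLoss_U_ne_top (h : LossData r lam π c g U) (hr : 0 < r)
    (x : ℝ → ℝ) : discLoss r U x ≠ ∞ := by
  obtain ⟨B, hB⟩ := h.U_le
  exact ne_top_of_le_ne_top (ENNReal.mul_ne_top ENNReal.ofReal_ne_top ENNReal.coe_ne_top)
    (discLoss_U_le hr hB x)

/-- Splitting a discounted loss at a time `a`. -/
lemma discLoss_split {φ : ℝ → ℝ≥0∞} (hφ : Measurable φ) {x : ℝ → ℝ} (hx : Measurable x) {a : ℝ}
    (ha : 0 ≤ a) :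
    discLoss r φ x = (∫⁻ t in Ioc 0 a, disc r t * φ (x t)) +
      disc r a * discLoss r φ fun t => x (a + t) := by
  have h1 : Measurable fun t => disc r t * φ (x t) := (measurable_disc r).mul (hφ.comp hx)
  have h2 : ∫⁻ t in Ioi a, disc r t * φ (x t) = disc r a * discLoss r φ fun t => x (a + t) := by
    have := (measurePreserving_add_left (volume : Measure ℝ) a).setLIntegral_comp_preimage
      (measurableSet_Ioi (a := a)) h1
    rw [← this, discLoss, ← lintegral_const_mul]
    · have hs : (fun t => a + t) ⁻¹' Ioi a = Ioi 0 := by ext t; simp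
      rw [hs]
      refine lintegral_congr fun t => ?_
      rw [disc_add, mul_assoc]
    · exact (measurable_disc r).mul (hφ.comp (hx.comp (measurable_const_add a)))
  rw [← h2, discLoss, ← Ioc_union_Ioi_eq_Ioi ha,
    lintegral_union measurableSet_Ioi (Ioc_disjoint_Ioi le_rfl)]

end LossData

end InfoAcq

end

noncomputable section

namespace InfoAcq

/-! ### Acquisition times and drawn beliefs of a policy -/

/-- Two functions with equal integrals over the events of a sub-`σ`-algebra have equal integrals
against every weight measurable with respect to it. -/
lemma lintegral_mul_eq_of_setLIntegral_eq {Ω : Type} {m mΩ : MeasurableSpace Ω} (hle : m ≤ mΩ)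
    {ν : Measure Ω} {φ ψ : Ω → ℝ≥0∞} (hφ : Measurable φ) (hψ : Measurable ψ)
    (h : ∀ A, MeasurableSet[m] A → ∫⁻ ω in A, φ ω ∂ν = ∫⁻ ω in A, ψ ω ∂ν) {w : Ω → ℝ≥0∞}
    (hw : Measurable[m] w) : ∫⁻ ω, w ω * φ ω ∂ν = ∫⁻ ω, w ω * ψ ω ∂ν := by
  -- The hypothesis says that the measures with densities `φ` and `ψ` coincide on the smaller
  -- `σ`-algebra, which is all that an integrand measurable for it can see.
  have htrim : (ν.withDensity φ).trim hle = (ν.withDensity ψ).trim hle := by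
    refine @Measure.ext _ m _ _ fun A hA => ?_
    rw [trim_measurableSet_eq hle hA, trim_measurableSet_eq hle hA,
      withDensity_apply _ (hle A hA), withDensity_apply _ (hle A hA), h A hA]
  have hres : ∀ χ : Ω → ℝ≥0∞, Measurable χ →
      ∫⁻ ω, w ω * χ ω ∂ν = ∫⁻ ω, w ω ∂((ν.withDensity χ).trim hle) := by
    intro χ hχ
    rw [lintegral_trim hle hw, lintegral_withDensity_eq_lintegral_mul _ hχ (hw.mono hle le_rfl)]
    simp only [Pi.mul_apply, mul_comm]
  rw [hres _ hφ, hres _ hψ, htrim]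

section policy
variable {r lam π p : ℝ} {Ω : Type} [mΩ : MeasurableSpace Ω] {Q : Measure Ω}
  {τ : ℕ → Ω → ℝ≥0∞} {F : ℕ → Ω → Measure ℝ} {P : ℝ≥0 → Ω → ℝ}

lemma IsPolicy.measurableSet_lt (h : IsPolicy lam π p Q τ F P) (i : ℕ) (s : ℝ≥0) :
    MeasurableSet[Filtration.natural P h.meas s] {ω | (s : ℝ≥0∞) < τ i ω} := by
  have h1 := (h.stopping i s).compl
  convert h1 using 1
  ext ω
  simp only [mem_ofPred_eq, mem_compl_iff]
  exact not_le.symm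

lemma IsPolicy.measurable_time (h : IsPolicy lam π p Q τ F P) (i : ℕ) : Measurable (τ i) := by
  refine measurable_of_Ioi fun a => ?_
  induction a with
  | top => simp
  | coe s => exact (Filtration.natural P h.meas).le s _ (h.measurableSet_lt i s)

lemma IsPolicy.strictPast_le (h : IsPolicy lam π p Q τ F P) (i : ℕ) :
    strictPast (Filtration.natural P h.meas) (τ i) ≤ mΩ := by
  refine MeasurableSpace.generateFrom_le ?_
  rintro B ⟨s, A, hA, rfl⟩
  exact ((Filtration.natural P h.meas).le s _ hA).inter
    ((Filtration.natural P h.meas).le s _ (h.measurableSet_lt i s))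

/-- The event `{s < τ i}` is itself a generator of the strict past, with `A = univ`. -/
lemma IsPolicy.measurable_time_strictPast (h : IsPolicy lam π p Q τ F P) (i : ℕ) :
    Measurable[strictPast (Filtration.natural P h.meas) (τ i)] (τ i) := by
  let _ := strictPast (Filtration.natural P h.meas) (τ i)
  refine measurable_of_Ioi fun a => ?_
  induction a with
  | top => simp
  | coe s =>
    exact MeasurableSpace.measurableSet_generateFrom ⟨s, univ, MeasurableSet.univ, by simp; rfl⟩

/-- The beliefs drawn by a policy have measurable versions with values in `[0, 1]`. -/
lemma IsPolicy.exists_drawn (h : IsPolicy lam π p Q τ F P) (i : ℕ) :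
    ∃ b : Ω → ℝ, Measurable b ∧ (∀ ω, b ω ∈ Icc (0 : ℝ) 1) ∧
      ∀ᵐ ω ∂Q, τ i ω ≠ ∞ → b ω = beliefAt τ P i ω := by
  classical
  have hσ : Measurable fun ω => (τ i ω).toNNReal := (h.measurable_time i).ennreal_toNNReal
  have hfin : MeasurableSet {ω | τ i ω = ∞} := h.measurable_time i (measurableSet_singleton _)
  -- A policy's process is only assumed measurable at fixed times. Right after `τ i` the path almost
  -- surely drifts continuously, so the belief at `τ i` is the limit of its values at grid times
  -- above `τ i`.
  have hlim : AEMeasurable (fun ω => if τ i ω = ∞ then 0 else beliefAt τ P i ω) Q := by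
    refine aemeasurable_of_tendsto_metrizable_ae atTop (f := fun n ω =>
      if τ i ω = ∞ then 0 else P (gridAbove n (τ i ω).toNNReal) ω)
      (fun n => (Measurable.ite hfin measurable_const
        (measurable_gridAbove (fun t => (h.meas t).measurable) n hσ measurable_id)).aemeasurable) ?_
    filter_upwards [h.time_strict, h.between] with ω hs hb
    by_cases hi : τ i ω = ∞
    · simp [hi]
    simp only [hi, if_false]
    set a := (τ i ω).toNNReal
    have ha : (a : ℝ≥0∞) = τ i ω := ENNReal.coe_toNNReal hi
    have hev : ∀ᶠ t : ℝ≥0 in 𝓝[>] a, drift lam π (t - a) (beliefAt τ P i ω) = P t ω := by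
      have h1 : ∀ᶠ t : ℝ≥0 in 𝓝[>] a, (t : ℝ≥0∞) < τ (i + 1) ω := by
        have : Tendsto (fun t : ℝ≥0 => (t : ℝ≥0∞)) (𝓝[>] a) (𝓝 (a : ℝ≥0∞)) :=
          (ENNReal.continuous_coe.tendsto a).mono_left nhdsWithin_le_nhds
        exact this.eventually_lt_const (by rw [ha]; exact hs i hi)
      filter_upwards [h1, self_mem_nhdsWithin] with t ht hta
      have hta' : a ≤ t := le_of_lt hta
      rw [hb i t (by rw [← ha]; exact_mod_cast hta') ht, flow_eq_drift, NNReal.coe_sub hta']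
    have hcont : Tendsto (fun t : ℝ≥0 => drift lam π (t - a) (beliefAt τ P i ω)) (𝓝[>] a)
        (𝓝 (beliefAt τ P i ω)) := by
      have : Continuous fun t : ℝ≥0 => drift lam π (t - a) (beliefAt τ P i ω) :=
        (continuous_drift lam π).comp ((by fun_prop : Continuous fun t : ℝ≥0 => (t : ℝ) - a).prodMk
          continuous_const)
      have := (this.tendsto a).mono_left (nhdsWithin_le_nhds (s := Ioi a))
      simpa [drift_zero] using this
    exact (hcont.congr' hev).comp (tendsto_gridAbove a)
  refine ⟨fun ω => clamp (hlim.mk _ ω), continuous_clamp.measurable.comp hlim.measurable_mk,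
    fun ω => clamp_mem _, ?_⟩
  filter_upwards [hlim.ae_eq_mk] with ω hω hi
  rw [← hω, if_neg hi, clamp_of_mem (q := beliefAt τ P i ω) (h.mem _ _)]

/-- The drawn belief has conditional law `F i` given the strict past: integrated version. -/
lemma IsPolicy.lintegral_drawn [IsProbabilityMeasure Q] (h : IsPolicy lam π p Q τ F P) (i : ℕ)
    {b : Ω → ℝ}
    (hbm : Measurable b) (hb : ∀ᵐ ω ∂Q, τ i ω ≠ ∞ → b ω = beliefAt τ P i ω) {φ : ℝ → ℝ≥0∞}
    (hφ : Measurable φ) {w : Ω → ℝ≥0∞}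
    (hw : Measurable[strictPast (Filtration.natural P h.meas) (τ i)] w)
    (hw0 : ∀ ω, τ i ω = ∞ → w ω = 0) :
    ∫⁻ ω, w ω * φ (b ω) ∂Q = ∫⁻ ω, w ω * ∫⁻ x, φ x ∂(F i ω) ∂Q := by
  have hle := h.strictPast_le i
  have hF : Measurable (F i) := (h.exp_meas i).mono hle le_rfl
  have hT : MeasurableSet {ω | τ i ω ≠ ∞} :=
    (h.measurable_time i (measurableSet_singleton ∞)).compl
  have hψm : Measurable fun ω => ∫⁻ x, φ x ∂(F i ω) := (Measure.measurable_lintegral hφ).comp hF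
  have hres : ∀ ψ : Ω → ℝ≥0∞, ∫⁻ ω, w ω * ψ ω ∂Q = ∫⁻ ω in {ω | τ i ω ≠ ∞}, w ω * ψ ω ∂Q := by
    intro ψ
    rw [← lintegral_indicator hT]
    refine lintegral_congr fun ω => ?_
    by_cases hi : τ i ω = ∞
    · rw [hw0 ω hi, zero_mul, indicator_of_notMem (by simpa using hi)]
    · rw [indicator_of_mem (by simpa using hi)]
  rw [hres, hres]
  refine lintegral_mul_eq_of_setLIntegral_eq hle (hφ.comp hbm) hψm (fun A hA => ?_) hw
  have hA' := hle A hA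
  -- On events of the strict past, the law of the drawn belief is the mixture of the experiments;
  -- this is the property `draw` read as an equality of measures.
  have hmeas : ((Q.restrict {ω | τ i ω ≠ ∞}).restrict A).map b =
      ((Q.restrict {ω | τ i ω ≠ ∞}).restrict A).bind (F i) := by
    ext B hB
    rw [Measure.map_apply hbm hB, Measure.bind_apply hB hF.aemeasurable,
      Measure.restrict_restrict hA', ← h.draw i A hA B hB,
      Measure.restrict_apply (hbm hB)]
    refine measure_congr ?_
    filter_upwards [hb] with ω hω
    refine propext ⟨fun ⟨h1, h2⟩ => ⟨h2, ?_⟩, fun ⟨h1, h2⟩ => ⟨?_, h1⟩⟩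
    · change beliefAt τ P i ω ∈ B
      rw [← hω h2.2]; exact h1
    · change b ω ∈ B
      rw [hω h1.2]; exact h2
  simp only [Function.comp]
  rw [← lintegral_map hφ hbm, hmeas, Measure.lintegral_bind hF.aemeasurable hφ.aemeasurable]

end policy

end InfoAcq

end

noncomputable section

namespace InfoAcq

/-! ### Truncating a policy after finitely many acquisitions -/

section truncation
variable {r lam π p : ℝ} {Ω : Type} {τ : ℕ → Ω → ℝ≥0∞} {b : ℕ → Ω → ℝ}

/-- The belief process obtained from the first `n + 1` acquisitions, at times `τ i` with
outcomes `b i`. -/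
def truncBelief (lam π : ℝ) (τ : ℕ → Ω → ℝ≥0∞) (b : ℕ → Ω → ℝ) : ℕ → ℝ≥0 → Ω → ℝ
  | 0, t, ω => flow lam π t (b 0 ω)
  | n + 1, t, ω =>
    if τ (n + 1) ω ≤ t then flow lam π (t - (τ (n + 1) ω).toNNReal) (b (n + 1) ω)
    else truncBelief lam π τ b n t ω

/-- The belief right before the `i`-th acquisition, in terms of the outcomes `b i`. -/
def meanBefore (lam π p : ℝ) (τ : ℕ → Ω → ℝ≥0∞) (b : ℕ → Ω → ℝ) : ℕ → Ω → ℝ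
  | 0, _ => p
  | i + 1, ω => flow lam π ((τ (i + 1) ω).toNNReal - (τ i ω).toNNReal) (b i ω)

lemma flow_mem_Icc (hlam : 0 < lam) (hπ : π ∈ Ioo (0 : ℝ) 1) (s : ℝ≥0) {q : ℝ}
    (hq : q ∈ Icc (0 : ℝ) 1) : flow lam π s q ∈ Icc (0 : ℝ) 1 :=
  drift_mem_Icc hlam hπ s.2 hq

lemma flow_add (lam π : ℝ) (s t : ℝ≥0) (q : ℝ) :
    flow lam π (s + t) q = flow lam π t (flow lam π s q) := by
  rw [flow_eq_drift, flow_eq_drift, flow_eq_drift, NNReal.coe_add, drift_add]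

lemma flow_zero (lam π q : ℝ) : flow lam π 0 q = q := by simp [flow]

lemma measurable_flow (lam π : ℝ) : Measurable fun x : ℝ≥0 × ℝ => flow lam π x.1 x.2 := by
  unfold flow; fun_prop

lemma continuous_flow_sub (lam π q : ℝ) (a : ℝ≥0) :
    Continuous fun s : ℝ≥0 => flow lam π (s - a) q := by
  unfold flow; fun_prop

lemma meanBefore_mem (hlam : 0 < lam) (hπ : π ∈ Ioo (0 : ℝ) 1) (hp : p ∈ Icc (0 : ℝ) 1)
    (hb : ∀ i ω, b i ω ∈ Icc (0 : ℝ) 1) (i : ℕ) (ω : Ω) :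
    meanBefore lam π p τ b i ω ∈ Icc (0 : ℝ) 1 := by
  cases i with
  | zero => exact hp
  | succ i => exact flow_mem_Icc hlam hπ _ (hb i ω)

lemma truncBelief_mem (hlam : 0 < lam) (hπ : π ∈ Ioo (0 : ℝ) 1)
    (hb : ∀ i ω, b i ω ∈ Icc (0 : ℝ) 1) (n : ℕ) (t : ℝ≥0) (ω : Ω) :
    truncBelief lam π τ b n t ω ∈ Icc (0 : ℝ) 1 := by
  induction n with
  | zero => exact flow_mem_Icc hlam hπ _ (hb 0 ω)
  | succ n ih =>
    rw [truncBelief]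
    split_ifs
    · exact flow_mem_Icc hlam hπ _ (hb _ ω)
    · exact ih

/-- Right continuity holds for every `ω`, as required of belief processes, since the truncation is
built from finitely many drifts; the process of a policy is known to drift only almost surely. -/
lemma truncBelief_rightCont (n : ℕ) (ω : Ω) (t : ℝ≥0) :
    ContinuousWithinAt (fun s => truncBelief lam π τ b n s ω) (Ici t) t := by
  induction n with
  | zero =>
    have := continuous_flow_sub lam π (b 0 ω) 0
    simp only [tsub_zero] at this
    exact this.continuousWithinAt
  | succ n ih =>
    by_cases h : τ (n + 1) ω ≤ t
    · refine (continuous_flow_sub lam π (b (n + 1) ω) (τ (n + 1) ω).toNNReal).continuousWithinAt.congr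
        (fun s hs => ?_) ?_
      · rw [truncBelief, if_pos (h.trans (by exact_mod_cast hs))]
      · rw [truncBelief, if_pos h]
    · refine ih.congr_of_eventuallyEq ?_ (by rw [truncBelief, if_neg h])
      have : ∀ᶠ s : ℝ≥0 in 𝓝[≥] t, (s : ℝ≥0∞) < τ (n + 1) ω :=
        ((ENNReal.continuous_coe.tendsto t).mono_left nhdsWithin_le_nhds).eventually_lt_const
          (not_le.1 h)
      filter_upwards [this] with s hs
      rw [truncBelief, if_neg (not_le.2 hs)]

lemma truncBelief_leftLim (n : ℕ) (ω : Ω) (t : ℝ≥0) :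
    ∃ l, Tendsto (fun s => truncBelief lam π τ b n s ω) (𝓝[<] t) (𝓝 l) := by
  induction n with
  | zero =>
    have := continuous_flow_sub lam π (b 0 ω) 0
    simp only [tsub_zero] at this
    exact ⟨_, (this.tendsto t).mono_left nhdsWithin_le_nhds⟩
  | succ n ih =>
    by_cases h : τ (n + 1) ω < t
    · refine ⟨_, Tendsto.congr' ?_
        (((continuous_flow_sub lam π (b (n + 1) ω) (τ (n + 1) ω).toNNReal).tendsto t).mono_left
          nhdsWithin_le_nhds)⟩
      have : ∀ᶠ s : ℝ≥0 in 𝓝[<] t, τ (n + 1) ω < (s : ℝ≥0∞) :=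
        ((ENNReal.continuous_coe.tendsto t).mono_left nhdsWithin_le_nhds).eventually_const_lt h
      filter_upwards [this] with s hs
      rw [truncBelief, if_pos hs.le]
    · obtain ⟨l, hl⟩ := ih
      refine ⟨l, hl.congr' ?_⟩
      filter_upwards [self_mem_nhdsWithin] with s hs
      have : (s : ℝ≥0∞) < t := by exact_mod_cast hs
      rw [truncBelief, if_neg (not_le.2 (this.trans_le (not_lt.1 h)))]

/-- After the `n`-th acquisition, the truncated process drifts. -/
lemma truncBelief_after (h0 : ∀ ω, τ 0 ω = 0) (n : ℕ) (ω : Ω) (t : ℝ≥0) (ht : τ n ω ≤ t) :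
    truncBelief lam π τ b n t ω = flow lam π (t - (τ n ω).toNNReal) (b n ω) := by
  cases n with
  | zero => rw [truncBelief, h0]; simp
  | succ n => rw [truncBelief, if_pos ht]

variable [MeasurableSpace Ω] {Q : Measure Ω} {F : ℕ → Ω → Measure ℝ} {P : ℝ≥0 → Ω → ℝ}

/-- The `b i` are measurable versions of the beliefs drawn by a policy. -/
structure IsDrawn (Q : Measure Ω) (τ : ℕ → Ω → ℝ≥0∞) (P : ℝ≥0 → Ω → ℝ) (b : ℕ → Ω → ℝ) :
    Prop where
  meas : ∀ i, Measurable (b i)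
  mem : ∀ i ω, b i ω ∈ Icc (0 : ℝ) 1
  eq : ∀ᵐ ω ∂Q, ∀ i, τ i ω ≠ ∞ → b i ω = beliefAt τ P i ω

lemma IsPolicy.exists_isDrawn (h : IsPolicy lam π p Q τ F P) : ∃ b, IsDrawn Q τ P b := by
  choose b h1 h2 h3 using h.exists_drawn
  exact ⟨b, h1, h2, ae_all_iff.2 h3⟩

lemma measurable_meanBefore (hτ : ∀ i, Measurable (τ i)) (hb : ∀ i, Measurable (b i)) (i : ℕ) :
    Measurable (meanBefore lam π p τ b i) := by
  cases i with
  | zero => exact measurable_const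
  | succ i =>
    exact (measurable_flow lam π).comp
      (((hτ (i + 1)).ennreal_toNNReal.sub (hτ i).ennreal_toNNReal).prodMk (hb i))

lemma measurable_truncBelief (hτ : ∀ i, Measurable (τ i)) (hb : ∀ i, Measurable (b i)) (n : ℕ)
    (t : ℝ≥0) : Measurable (truncBelief lam π τ b n t) := by
  induction n with
  | zero => exact (measurable_flow lam π).comp (measurable_const.prodMk (hb 0))
  | succ n ih =>
    refine Measurable.ite (measurableSet_le (hτ _) measurable_const) ?_ ih
    exact (measurable_flow lam π).comp
      ((measurable_const.sub (hτ (n + 1)).ennreal_toNNReal).prodMk (hb (n + 1)))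

lemma IsPolicy.time_le (h : IsPolicy lam π p Q τ F P) :
    ∀ᵐ ω ∂Q, Monotone fun i => τ i ω :=
  h.time_mono.mono fun _ hω => monotone_nat_of_le_succ hω

/-- Before the next acquisition, the truncated process is the original one. -/
lemma IsPolicy.truncBelief_before (h : IsPolicy lam π p Q τ F P) (hb : IsDrawn Q τ P b) :
    ∀ᵐ ω ∂Q, ∀ (n : ℕ) (t : ℝ≥0), (t : ℝ≥0∞) < τ (n + 1) ω →
      truncBelief lam π τ b n t ω = P t ω := by
  filter_upwards [h.between, hb.eq] with ω h1 h2 n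
  induction n with
  | zero =>
    intro t ht
    have h0 := h.time_zero ω
    rw [truncBelief_after h.time_zero 0 ω t (by rw [h0]; exact zero_le),
      h1 0 t (by rw [h0]; exact zero_le) ht, h2 0 (by rw [h0]; simp)]
  | succ n ih =>
    intro t ht
    by_cases hle : τ (n + 1) ω ≤ t
    · rw [truncBelief_after h.time_zero (n + 1) ω t hle, h1 (n + 1) t hle ht,
        h2 (n + 1) (ne_top_of_le_ne_top ENNReal.coe_ne_top hle)]
    · rw [truncBelief, if_neg hle, ih t (not_le.1 hle)]

/-- After the next acquisition time, the truncated process drifts from the belief right before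
it. -/
lemma IsPolicy.truncBelief_late (h : IsPolicy lam π p Q τ F P) :
    ∀ᵐ ω ∂Q, ∀ (n : ℕ) (t : ℝ≥0), τ (n + 1) ω ≤ t →
      truncBelief lam π τ b n t ω =
        flow lam π (t - (τ (n + 1) ω).toNNReal) (meanBefore lam π p τ b (n + 1) ω) := by
  filter_upwards [h.time_mono] with ω h1 n t ht
  have hfin : τ (n + 1) ω ≠ ∞ := ne_top_of_le_ne_top ENNReal.coe_ne_top ht
  rw [truncBelief_after h.time_zero n ω t ((h1 n).trans ht), meanBefore, ← flow_add]
  congr 1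
  have e1 : (τ n ω).toNNReal ≤ (τ (n + 1) ω).toNNReal := ENNReal.toNNReal_mono hfin (h1 n)
  have e2 : (τ (n + 1) ω).toNNReal ≤ t := (ENNReal.toNNReal_mono ENNReal.coe_ne_top ht).trans_eq
    (ENNReal.toNNReal_coe t)
  rw [add_comm, tsub_add_tsub_cancel e2 e1]

lemma IsPolicy.meanBefore_eq (h : IsPolicy lam π p Q τ F P) (hb : IsDrawn Q τ P b) :
    ∀ᵐ ω ∂Q, ∀ i, τ i ω ≠ ∞ → meanBefore lam π p τ b i ω = beliefBefore lam π p τ P i ω := by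
  filter_upwards [h.time_mono, hb.eq] with ω h1 h2 i hi
  cases i with
  | zero => rfl
  | succ i => rw [meanBefore, beliefBefore, h2 i (ne_top_of_le_ne_top hi (h1 i))]

lemma IsPolicy.plausible_meanBefore (h : IsPolicy lam π p Q τ F P) (hb : IsDrawn Q τ P b) :
    ∀ᵐ ω ∂Q, ∀ i, τ i ω ≠ ∞ → BayesPlausible (meanBefore lam π p τ b i ω) (F i ω) := by
  filter_upwards [h.meanBefore_eq hb, ae_all_iff.2 h.plausible] with ω h1 h2 i hi
  rw [h1 i hi]
  exact h2 i hi

lemma BayesPlausible.ae_mem {q : ℝ} {F : Measure ℝ} (h : BayesPlausible q F) :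
    ∀ᵐ x ∂F, x ∈ Icc (0 : ℝ) 1 := h.carried

lemma BayesPlausible.lintegral_eq {q : ℝ} {F : Measure ℝ} (h : BayesPlausible q F) :
    ∫⁻ x, ENNReal.ofReal x ∂F = ENNReal.ofReal q := by
  have := h.prob
  rw [← h.mean, ofReal_integral_eq_lintegral_ofReal _ (h.ae_mem.mono fun x hx => hx.1)]
  exact Integrable.of_bound aestronglyMeasurable_id 1 (h.ae_mem.mono fun x hx => by
    rw [Real.norm_eq_abs, abs_of_nonneg hx.1]; exact hx.2)

/-- The innovations of the belief process are orthogonal to the strict past. -/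
lemma IsPolicy.integral_weight_mul_sub [IsProbabilityMeasure Q] (hlam : 0 < lam)
    (hπ : π ∈ Ioo (0 : ℝ) 1) (hp : p ∈ Icc (0 : ℝ) 1)
    (h : IsPolicy lam π p Q τ F P) (hb : IsDrawn Q τ P b) (i : ℕ) {w : Ω → ℝ}
    (hw : Measurable[strictPast (Filtration.natural P h.meas) (τ i)] w)
    (hw0 : ∀ ω, τ i ω = ∞ → w ω = 0) (hw1 : ∀ ω, w ω ∈ Icc (0 : ℝ) 1) :
    ∫ ω, w ω * (b i ω - meanBefore lam π p τ b i ω) ∂Q = 0 := by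
  have hwm : Measurable w := hw.mono (h.strictPast_le i) le_rfl
  have hmm := measurable_meanBefore (lam := lam) (π := π) (p := p) h.measurable_time hb.meas i
  have hmem := meanBefore_mem (τ := τ) hlam hπ hp hb.mem i
  have hint : ∀ {φ : Ω → ℝ}, Measurable φ → (∀ ω, φ ω ∈ Icc (0 : ℝ) 1) →
      Integrable (fun ω => w ω * φ ω) Q := fun {φ} hφ hφ1 =>
    Integrable.of_bound (hwm.mul hφ).aestronglyMeasurable 1 (ae_of_all _ fun ω => by
      rw [Real.norm_eq_abs, abs_of_nonneg (mul_nonneg (hw1 ω).1 (hφ1 ω).1)]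
      exact mul_le_one₀ (hw1 ω).2 (hφ1 ω).1 (hφ1 ω).2)
  have hlin : ∀ {φ : Ω → ℝ}, Measurable φ → (∀ ω, φ ω ∈ Icc (0 : ℝ) 1) →
      ENNReal.ofReal (∫ ω, w ω * φ ω ∂Q) =
        ∫⁻ ω, ENNReal.ofReal (w ω) * ENNReal.ofReal (φ ω) ∂Q := fun {φ} hφ hφ1 => by
    rw [ofReal_integral_eq_lintegral_ofReal (hint hφ hφ1)
      (ae_of_all _ fun ω => mul_nonneg (hw1 ω).1 (hφ1 ω).1)]
    exact lintegral_congr fun ω => ENNReal.ofReal_mul (hw1 ω).1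
  -- In `[0, ∞]`, the drawn belief may be replaced by the mean of its experiment under any weight
  -- from the strict past.
  have hkey : ∫ ω, w ω * b i ω ∂Q = ∫ ω, w ω * meanBefore lam π p τ b i ω ∂Q := by
    rw [← ENNReal.ofReal_eq_ofReal_iff
      (integral_nonneg fun ω => mul_nonneg (hw1 ω).1 (hb.mem i ω).1)
      (integral_nonneg fun ω => mul_nonneg (hw1 ω).1 (hmem ω).1),
      hlin (hb.meas i) (hb.mem i), hlin hmm hmem,
      h.lintegral_drawn i (hb.meas i) (hb.eq.mono fun ω hω => hω i) ENNReal.measurable_ofReal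
        (@Measurable.ennreal_ofReal _ (strictPast (Filtration.natural P h.meas) (τ i)) _ hw)
        (fun ω hω => by rw [hw0 ω hω, ENNReal.ofReal_zero])]
    refine lintegral_congr_ae ((h.plausible_meanBefore hb).mono fun ω hω => ?_)
    by_cases hi : τ i ω = ∞
    · simp only [hw0 ω hi, ENNReal.ofReal_zero, zero_mul]
    · simp only [(hω i hi).lintegral_eq]
  simp only [mul_sub]
  rw [integral_sub (hint (hb.meas i) (hb.mem i)) (hint hmm hmem), hkey, sub_self]

end truncation

end InfoAcq

end

noncomputable section

namespace InfoAcq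

/-! ### Truncated policies are feasible belief processes -/

section truncation
variable {r lam π p : ℝ} {Ω : Type} [MeasurableSpace Ω] {Q : Measure Ω}
  {τ : ℕ → Ω → ℝ≥0∞} {F : ℕ → Ω → Measure ℝ} {P : ℝ≥0 → Ω → ℝ} {b : ℕ → Ω → ℝ}

lemma integrable_of_mem_Icc [IsFiniteMeasure Q] {φ : Ω → ℝ} (hφ : Measurable φ)
    (h : ∀ ω, φ ω ∈ Icc (0 : ℝ) 1) : Integrable φ Q :=
  Integrable.of_bound hφ.aestronglyMeasurable 1 (ae_of_all _ fun ω => by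
    rw [Real.norm_eq_abs, abs_of_nonneg (h ω).1]; exact (h ω).2)

lemma flow_sub_flow (lam π : ℝ) (s : ℝ≥0) (x y : ℝ) :
    flow lam π s x - flow lam π s y = Real.exp (-lam * s) * (x - y) := by
  simp only [flow]; ring

/-- The increment of the truncated process between consecutive truncations. -/
lemma IsPolicy.truncBelief_succ_sub (h : IsPolicy lam π p Q τ F P) (s : ℝ≥0) :
    ∀ᵐ ω ∂Q, ∀ (k : ℕ) (t : ℝ≥0),
      truncBelief lam π τ b (k + 1) (t + s) ω - flow lam π s (truncBelief lam π τ b (k + 1) t ω) =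
        truncBelief lam π τ b k (t + s) ω - flow lam π s (truncBelief lam π τ b k t ω) +
        (if (t : ℝ≥0∞) < τ (k + 1) ω ∧ τ (k + 1) ω ≤ (t + s : ℝ≥0) then
          Real.exp (-lam * (t + s - (τ (k + 1) ω).toNNReal : ℝ≥0)) else 0) *
          (b (k + 1) ω - meanBefore lam π p τ b (k + 1) ω) := by
  filter_upwards [h.truncBelief_late (b := b)] with ω hlate k t
  set a := τ (k + 1) ω with ha
  by_cases h1 : a ≤ t
  · have h2 : a ≤ (t + s : ℝ≥0) := h1.trans (by exact_mod_cast le_self_add)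
    have e2 : a.toNNReal ≤ t := (ENNReal.toNNReal_mono ENNReal.coe_ne_top h1).trans_eq
      (ENNReal.toNNReal_coe t)
    rw [if_neg (fun h => absurd h.1 (not_lt.2 h1)), truncBelief, if_pos h2, truncBelief,
      if_pos h1, hlate k _ h1, hlate k _ h2, ← flow_add, ← flow_add, ← ha,
      tsub_add_eq_add_tsub e2]
    ring
  · by_cases h2 : a ≤ (t + s : ℝ≥0)
    · rw [if_pos ⟨not_le.1 h1, h2⟩, truncBelief, if_pos h2, truncBelief, if_neg h1, hlate k _ h2,
        ← flow_sub_flow lam π]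
      ring
    · rw [if_neg (fun h => h2 h.2), truncBelief, if_neg h2, truncBelief, if_neg h1]
      ring

/-- Induction on the truncation level `k`, the event being fixed at level `n`. At level `0` the
process is a pure drift. Passing from `k` to `k + 1` adds the innovation of the new acquisition,
weighted by its decay and restricted to acquisitions in `(t, t + s]`; the event `{X_t ∈ B}` is
decided before such an acquisition, so the contribution integrates to zero. -/
lemma IsPolicy.setIntegral_truncBelief [IsProbabilityMeasure Q] (hlam : 0 < lam)
    (hπ : π ∈ Ioo (0 : ℝ) 1) (hp : p ∈ Icc (0 : ℝ) 1)
    (h : IsPolicy lam π p Q τ F P) (hb : IsDrawn Q τ P b) (n : ℕ) (t s : ℝ≥0) {B : Set ℝ}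
    (hB : MeasurableSet B) {k : ℕ} (hk : k ≤ n) :
    ∫ ω in truncBelief lam π τ b n t ⁻¹' B,
      (truncBelief lam π τ b k (t + s) ω - flow lam π s (truncBelief lam π τ b k t ω)) ∂Q = 0 := by
  have hX := measurable_truncBelief (lam := lam) (π := π) h.measurable_time hb.meas
  have hXm := truncBelief_mem (τ := τ) hlam hπ hb.mem
  induction k with
  | zero =>
    simp only [truncBelief, flow_add, sub_self, integral_zero]
  | succ k ih =>
    have hA := hX n t hB
    set A := truncBelief lam π τ b n t ⁻¹' B
    set w : Ω → ℝ := fun ω => if (t : ℝ≥0∞) < τ (k + 1) ω ∧ τ (k + 1) ω ≤ (t + s : ℝ≥0) then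
          Real.exp (-lam * (t + s - (τ (k + 1) ω).toNNReal : ℝ≥0)) else 0 with hw
    -- While `t < τ (k + 1)`, the truncation at level `n ≥ k` agrees almost surely with `P`.
    -- Replacing `A` by `A'` changes nothing where `w` is nonzero and yields a generator of the
    -- strict past.
    set A' : Set Ω := P t ⁻¹' B ∩ {ω | (t : ℝ≥0∞) < τ (k + 1) ω} with hA'
    have hAA' : ∀ᵐ ω ∂Q, A.indicator (fun ω => w ω * (b (k + 1) ω -
        meanBefore lam π p τ b (k + 1) ω)) ω = A'.indicator w ω * (b (k + 1) ω -
        meanBefore lam π p τ b (k + 1) ω) := by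
      filter_upwards [h.truncBelief_before hb, h.time_le] with ω h1 h2
      by_cases ht : (t : ℝ≥0∞) < τ (k + 1) ω
      · have hPX := h1 n t (ht.trans_le (h2 (by omega)))
        have hiff : ω ∈ A ↔ ω ∈ A' := by
          rw [hA', mem_inter_iff, mem_preimage, mem_preimage, hPX]
          exact ⟨fun h => ⟨h, ht⟩, fun h => h.1⟩
        by_cases hm : ω ∈ A
        · rw [indicator_of_mem hm, indicator_of_mem (hiff.1 hm)]
        · rw [indicator_of_notMem hm, indicator_of_notMem (fun h => hm (hiff.2 h)), zero_mul]
      · have hw0 : w ω = 0 := if_neg fun h => ht h.1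
        rw [indicator_of_notMem (s := A') (fun h => ht h.2), zero_mul]
        by_cases hm : ω ∈ A
        · rw [indicator_of_mem hm, hw0, zero_mul]
        · rw [indicator_of_notMem hm]
    have hw1 : ∀ ω, w ω ∈ Icc (0 : ℝ) 1 := fun ω => by
      simp only [hw]
      split_ifs
      · exact Ioc_subset_Icc_self (exp_neg_mul_mem hlam (NNReal.coe_nonneg _))
      · simp
    have hwm : ∀ {m : MeasurableSpace Ω}, Measurable[m] (τ (k + 1)) → Measurable[m] w :=
      fun {m} hτ => by
        have hf : Measurable fun x : ℝ≥0∞ => if (t : ℝ≥0∞) < x ∧ x ≤ (t + s : ℝ≥0) then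
          Real.exp (-lam * (t + s - x.toNNReal : ℝ≥0)) else 0 :=
          Measurable.ite (measurableSet_Ioc) (by fun_prop) measurable_const
        exact hf.comp hτ
    have hwA' : Measurable[strictPast (Filtration.natural P h.meas) (τ (k + 1))]
        (A'.indicator w) := by
      have hw' := hwm (h.measurable_time_strictPast (k + 1))
      have hset : MeasurableSet[strictPast (Filtration.natural P h.meas) (τ (k + 1))] A' :=
        MeasurableSpace.measurableSet_generateFrom ⟨t, P t ⁻¹' B,
          (le_iSup₂_of_le (f := fun j (_ : j ≤ t) => MeasurableSpace.comap (P j) inferInstance)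
            t le_rfl le_rfl) _ ⟨B, hB, rfl⟩, rfl⟩
      let _ := strictPast (Filtration.natural P h.meas) (τ (k + 1))
      exact hw'.indicator hset
    have hzero := h.integral_weight_mul_sub hlam hπ hp hb (k + 1) hwA' (fun ω hω => by
        have : w ω = 0 := if_neg fun h => by
          rw [hω] at h; exact absurd h.2 (by simp)
        by_cases hm : ω ∈ A'
        · rw [indicator_of_mem hm, this]
        · rw [indicator_of_notMem hm])
      (fun ω => by
        by_cases hm : ω ∈ A'
        · rw [indicator_of_mem hm]; exact hw1 ω
        · rw [indicator_of_notMem hm]; simp)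
    have hpost : ∫ ω in A, w ω * (b (k + 1) ω - meanBefore lam π p τ b (k + 1) ω) ∂Q = 0 := by
      rw [← integral_indicator hA, integral_congr_ae hAA', hzero]
    have hi1 : Integrable (fun ω => truncBelief lam π τ b k (t + s) ω -
        flow lam π s (truncBelief lam π τ b k t ω)) Q :=
      (integrable_of_mem_Icc (hX k _) (hXm k _)).sub (integrable_of_mem_Icc
        ((measurable_flow lam π).comp (measurable_const.prodMk (hX k t)))
        fun ω => flow_mem_Icc hlam hπ s (hXm k t ω))
    have hmm := measurable_meanBefore (lam := lam) (π := π) (p := p) h.measurable_time hb.meas (k + 1)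
    have hmem := meanBefore_mem (τ := τ) hlam hπ hp hb.mem (k + 1)
    have hwm' := hwm (h.measurable_time (k + 1))
    have hi2 : Integrable (fun ω => w ω * (b (k + 1) ω - meanBefore lam π p τ b (k + 1) ω)) Q := by
      refine Integrable.of_bound (hwm'.mul ((hb.meas _).sub hmm)).aestronglyMeasurable 1
        (ae_of_all _ fun ω => ?_)
      rw [norm_mul, Real.norm_eq_abs, Real.norm_eq_abs]
      refine mul_le_one₀ (abs_le.2 ⟨by linarith [(hw1 ω).1], (hw1 ω).2⟩) (abs_nonneg _)
        (abs_le.2 ⟨?_, ?_⟩) <;> linarith [(hb.mem (k + 1) ω).1, (hb.mem (k + 1) ω).2, (hmem ω).1, (hmem ω).2]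
    rw [setIntegral_congr_ae hA ((h.truncBelief_succ_sub (b := b) s).mono fun ω hω _ => hω k t),
      integral_add hi1.integrableOn hi2.integrableOn, ih (by omega), hpost, add_zero]

/-- Truncated policies induce feasible belief processes. -/
lemma IsPolicy.isBeliefProcess_truncBelief [IsProbabilityMeasure Q] (hlam : 0 < lam)
    (hπ : π ∈ Ioo (0 : ℝ) 1) (hp : p ∈ Icc (0 : ℝ) 1)
    (h : IsPolicy lam π p Q τ F P) (hb : IsDrawn Q τ P b) (n : ℕ) :
    IsBeliefProcess lam π p Q (truncBelief lam π τ b n) := by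
  have hX := measurable_truncBelief (lam := lam) (π := π) h.measurable_time hb.meas
  have hXm := truncBelief_mem (τ := τ) hlam hπ hb.mem
  refine ⟨hX n, hXm n, truncBelief_rightCont n, truncBelief_leftLim n, ?_, fun t s => ?_⟩
  · have h0 : ∀ᵐ ω ∂Q, truncBelief lam π τ b n 0 ω = b 0 ω := by
      filter_upwards [h.truncBelief_before hb, h.time_strict, h.time_le] with ω h1 h2 h3
      have hpos : 0 < τ 1 ω := by
        have := h2 0 (by rw [h.time_zero]; simp)
        -- As the first later acquisition is strictly after `0`, the belief at time `0` is the first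
        -- draw, whose mean is `p`.
        rwa [h.time_zero] at this
      rw [h1 n 0 (hpos.trans_le (h3 (by omega))), ← h1 0 0 hpos, truncBelief, flow_zero]
    rw [integral_congr_ae h0]
    have hz := h.integral_weight_mul_sub hlam hπ hp hb 0 (w := fun _ => 1)
      (@measurable_const _ _ _ (strictPast (Filtration.natural P h.meas) (τ 0)) _)
      (fun ω hω => by rw [h.time_zero] at hω; simp at hω) (fun ω => by simp)
    simp only [one_mul, meanBefore] at hz
    rw [integral_sub (integrable_of_mem_Icc (hb.meas 0) (hb.mem 0)) (integrable_const _)] at hz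
    simp at hz
    linarith
  · have hle : MeasurableSpace.comap (truncBelief lam π τ b n t) inferInstance ≤
        (inferInstance : MeasurableSpace Ω) := (hX n t).comap_le
    have hi1 : Integrable (truncBelief lam π τ b n (t + s)) Q :=
      integrable_of_mem_Icc (hX n _) (hXm n _)
    have hi2 : Integrable (fun ω => flow lam π s (truncBelief lam π τ b n t ω)) Q :=
      integrable_of_mem_Icc ((measurable_flow lam π).comp (measurable_const.prodMk (hX n t)))
        fun ω => flow_mem_Icc hlam hπ s (hXm n t ω)
    refine (ae_eq_condExp_of_forall_setIntegral_eq hle hi1 (fun A _ _ => hi2.integrableOn) ?_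
      ?_).symm
    · rintro A ⟨B, hB, rfl⟩ -
      have := h.setIntegral_truncBelief hlam hπ hp hb n t s hB le_rfl
      rw [integral_sub hi1.integrableOn hi2.integrableOn] at this
      linarith
    · refine StronglyMeasurable.aestronglyMeasurable (Measurable.stronglyMeasurable ?_)
      have hφ : Measurable fun q => flow lam π s q :=
        (measurable_flow lam π).comp (measurable_const.prodMk measurable_id)
      exact hφ.comp (comap_measurable _)

end truncation

end InfoAcq

end

noncomputable section

namespace InfoAcq

/-! ### The payoff of a policy is at most that of a belief process -/

section truncation
variable {r lam π p : ℝ} {Ω : Type} [MeasurableSpace Ω] {Q : Measure Ω}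
  {τ : ℕ → Ω → ℝ≥0∞} {F : ℕ → Ω → Measure ℝ} {P : ℝ≥0 → Ω → ℝ} {b : ℕ → Ω → ℝ}

lemma extIntegral_congr_ae {X Y : Ω → EReal} (h : X =ᵐ[Q] Y) :
    extIntegral Q X = extIntegral Q Y := by
  have h1 : ∫⁻ ω, (X ω).toENNReal ∂Q = ∫⁻ ω, (Y ω).toENNReal ∂Q :=
    lintegral_congr_ae (h.fun_comp EReal.toENNReal)
  have h2 : ∫⁻ ω, (-X ω).toENNReal ∂Q = ∫⁻ ω, (-Y ω).toENNReal ∂Q :=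
    lintegral_congr_ae (h.fun_comp fun x => (-x).toENNReal)
  rw [extIntegral, extIntegral, h1, h2]

lemma measurable_discount (r : ℝ) : Measurable (discount r) := by
  unfold discount
  exact Measurable.ite (measurableSet_singleton _) measurable_const (by fun_prop)

lemma discount_coe (r : ℝ) (a : ℝ≥0) : discount r a = disc r a := by
  simp [discount, disc]

/-- The truncated process as a function of real time. -/
abbrev truncPath (lam π : ℝ) (τ : ℕ → Ω → ℝ≥0∞) (b : ℕ → Ω → ℝ) (n : ℕ) (ω : Ω) (t : ℝ) : ℝ :=
  truncBelief lam π τ b n t.toNNReal ω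

lemma measurable_truncPath_uncurry (hτ : ∀ i, Measurable (τ i)) (hb : ∀ i, Measurable (b i))
    (n : ℕ) : Measurable fun x : Ω × ℝ => truncPath lam π τ b n x.1 x.2 :=
  (measurable_uncurry_of_rightCont (measurable_truncBelief hτ hb n)
    (truncBelief_rightCont n)).comp
      ((measurable_real_toNNReal.comp measurable_snd).prodMk measurable_fst)

lemma measurable_truncPath (hτ : ∀ i, Measurable (τ i)) (hb : ∀ i, Measurable (b i))
    (n : ℕ) (ω : Ω) : Measurable (truncPath lam π τ b n ω) :=
  (measurable_truncPath_uncurry hτ hb n).comp measurable_prodMk_left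

lemma measurable_discLoss_truncPath (hτ : ∀ i, Measurable (τ i)) (hb : ∀ i, Measurable (b i))
    (n : ℕ) {φ : ℝ → ℝ≥0∞} (hφ : Measurable φ) :
    Measurable fun ω => discLoss r φ (truncPath lam π τ b n ω) :=
  Measurable.lintegral_prod_right' (f := fun x : Ω × ℝ =>
    disc r x.2 * φ (truncPath lam π τ b n x.1 x.2))
    (((measurable_disc r).comp measurable_snd).mul (hφ.comp (measurable_truncPath_uncurry hτ hb n)))

/-- One more acquisition replaces the loss along the drift from the belief before the acquisition
with the loss along the drift from its outcome. -/
lemma IsPolicy.discLoss_truncPath_succ (h : IsPolicy lam π p Q τ F P) (hbm : ∀ i, Measurable (b i)) :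
    ∀ᵐ ω ∂Q, ∀ (n : ℕ) (φ : ℝ → ℝ≥0∞), Measurable φ →
      discLoss r φ (truncPath lam π τ b (n + 1) ω) + discount r (τ (n + 1) ω) *
        discLoss r φ (fun t => drift lam π t (meanBefore lam π p τ b (n + 1) ω)) =
      discLoss r φ (truncPath lam π τ b n ω) + discount r (τ (n + 1) ω) *
        discLoss r φ (fun t => drift lam π t (b (n + 1) ω)) := by
  filter_upwards [h.truncBelief_late (b := b)] with ω hlate n φ hφ
  by_cases hfin : τ (n + 1) ω = ∞
  · have heq : truncPath lam π τ b (n + 1) ω = truncPath lam π τ b n ω := by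
      funext t
      rw [truncPath, truncBelief, if_neg (by simp [hfin])]
    simp [hfin, discount, heq]
  · obtain ⟨a, ha⟩ : ∃ a : ℝ≥0, (a : ℝ≥0∞) = τ (n + 1) ω := ⟨_, ENNReal.coe_toNNReal hfin⟩
    rw [← ha, discount_coe]
    rw [discLoss_split hφ (measurable_truncPath h.measurable_time hbm (n + 1) ω) a.coe_nonneg,
      discLoss_split hφ (measurable_truncPath h.measurable_time hbm n ω) a.coe_nonneg]
    have hsplit : ∀ t : ℝ, 0 < t → (a + t).toNNReal = a + t.toNNReal := fun t ht => by
      rw [Real.toNNReal_add a.coe_nonneg ht.le, Real.toNNReal_coe]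
    have hcast : ∀ t : ℝ≥0, τ (n + 1) ω ≤ (a + t : ℝ≥0) := fun t => by
      rw [← ha]; exact_mod_cast le_self_add
    have e1 : discLoss r φ (fun t => truncPath lam π τ b (n + 1) ω (a + t)) =
        discLoss r φ (fun t => drift lam π t (b (n + 1) ω)) :=
      setLIntegral_congr_fun measurableSet_Ioi fun t ht => by
        simp only [truncPath]
        rw [hsplit t ht, truncBelief, if_pos (hcast _), ← ha, ENNReal.toNNReal_coe,
          add_tsub_cancel_left, flow_eq_drift, Real.coe_toNNReal t (le_of_lt ht)]
    have e2 : discLoss r φ (fun t => truncPath lam π τ b n ω (a + t)) =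
        discLoss r φ (fun t => drift lam π t (meanBefore lam π p τ b (n + 1) ω)) :=
      setLIntegral_congr_fun measurableSet_Ioi fun t ht => by
        simp only [truncPath]
        rw [hsplit t ht, hlate n _ (hcast _), ← ha, ENNReal.toNNReal_coe,
          add_tsub_cancel_left, flow_eq_drift, Real.coe_toNNReal t (le_of_lt ht)]
    have e3 : ∫⁻ t in Ioc 0 (a : ℝ), disc r t * φ (truncPath lam π τ b (n + 1) ω t) =
        ∫⁻ t in Ioc 0 (a : ℝ), disc r t * φ (truncPath lam π τ b n ω t) := by
      -- The two paths may differ at the acquisition time `a` itself, a null set.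
      rw [← setLIntegral_congr Ioo_ae_eq_Ioc, ← setLIntegral_congr Ioo_ae_eq_Ioc]
      refine setLIntegral_congr_fun measurableSet_Ioo fun t ht => ?_
      simp only [truncPath]
      rw [truncBelief, if_neg]
      rw [← ha, not_le]
      have : t.toNNReal < a := by
        rw [Real.toNNReal_lt_iff_lt_coe ht.1.le]; exact ht.2
      exact_mod_cast this
    rw [e1, e2, e3]
    ring

variable {c c₀ g U : ℝ → ℝ≥0∞}

/-- The change of loss due to one more acquisition. -/
lemma IsPolicy.loss_succ (h : IsPolicy lam π p Q τ F P) (hb : IsDrawn Q τ P b)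
    (hL : LossData r lam π c g U) (hr : 0 < r) (hlam : 0 < lam) (hπ : π ∈ Ioo (0 : ℝ) 1)
    (hp : p ∈ Icc (0 : ℝ) 1) :
    ∀ᵐ ω ∂Q, ∀ n : ℕ,
      discLoss r g (truncPath lam π τ b (n + 1) ω) +
        discount r (τ (n + 1) ω) * c (meanBefore lam π p τ b (n + 1) ω) +
        discLoss r U (truncPath lam π τ b n ω) =
      discLoss r g (truncPath lam π τ b n ω) + discount r (τ (n + 1) ω) * c (b (n + 1) ω) +
        discLoss r U (truncPath lam π τ b (n + 1) ω) := by
  filter_upwards [h.discLoss_truncPath_succ (r := r) hb.meas] with ω hω n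
  have h1 := hω n g hL.measurable_g
  have h2 := hω n U hL.measurable_U
  rw [hL.discLoss_drift hr hlam hπ (meanBefore_mem hlam hπ hp hb.mem _ _),
    hL.discLoss_drift hr hlam hπ (hb.mem _ _), mul_add, mul_add] at h1
  have hdisc : discount r (τ (n + 1) ω) ≠ ∞ := by
    rw [discount]; split_ifs <;> simp
  have hm := ENNReal.mul_ne_top hdisc (hL.discLoss_U_ne_top hr
    fun t => drift lam π t (meanBefore lam π p τ b (n + 1) ω))
  have hb' := ENNReal.mul_ne_top hdisc (hL.discLoss_U_ne_top hr fun t => drift lam π t (b (n + 1) ω))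
  generalize discount r (τ (n + 1) ω) * discLoss r U
    (fun t => drift lam π t (meanBefore lam π p τ b (n + 1) ω)) = x at *
  generalize discount r (τ (n + 1) ω) * discLoss r U
    (fun t => drift lam π t (b (n + 1) ω)) = y at *
  -- Only the `U`-losses `x` and `y` of the two drifts are known to be finite and may be cancelled;
  -- the terms in `g` and `c` stay on their sides.
  refine (ENNReal.add_left_inj (ENNReal.add_ne_top.2 ⟨hm, hb'⟩)).1 ?_
  calc _ = (discLoss r g (truncPath lam π τ b (n + 1) ω) +
        (discount r (τ (n + 1) ω) * c (meanBefore lam π p τ b (n + 1) ω) + x)) +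
        (discLoss r U (truncPath lam π τ b n ω) + y) := by ring
    _ = _ := by rw [h1, ← h2]; ring

/-- The belief before an acquisition has finite discounted certainty if the loss is finite. -/
lemma IsPolicy.discount_mul_le (h : IsPolicy lam π p Q τ F P) (hb : IsDrawn Q τ P b)
    (hL : LossData r lam π c g U) (hr : 0 < r) (hlam : 0 < lam) (hπ : π ∈ Ioo (0 : ℝ) 1)
    (hp : p ∈ Icc (0 : ℝ) 1) :
    ∀ᵐ ω ∂Q, ∀ n : ℕ, discount r (τ (n + 1) ω) * c (meanBefore lam π p τ b (n + 1) ω) ≤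
      discLoss r g (truncPath lam π τ b n ω) := by
  filter_upwards [h.truncBelief_late (b := b)] with ω hlate n
  by_cases hfin : τ (n + 1) ω = ∞
  · simp [hfin, discount]
  · obtain ⟨a, ha⟩ : ∃ a : ℝ≥0, (a : ℝ≥0∞) = τ (n + 1) ω := ⟨_, ENNReal.coe_toNNReal hfin⟩
    rw [discLoss_split hL.measurable_g (measurable_truncPath h.measurable_time hb.meas n ω) a.coe_nonneg]
    refine le_add_left ?_
    rw [← ha, discount_coe]
    refine mul_le_mul_right ?_ _
    have e2 : discLoss r g (fun t => truncPath lam π τ b n ω (a + t)) =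
        discLoss r g (fun t => drift lam π t (meanBefore lam π p τ b (n + 1) ω)) :=
      setLIntegral_congr_fun measurableSet_Ioi fun t ht => by
        have ht' : (0 : ℝ) ≤ t := le_of_lt ht
        simp only [truncPath]
        rw [Real.toNNReal_add a.coe_nonneg ht', Real.toNNReal_coe, hlate n _ (by
          rw [← ha]; exact_mod_cast le_self_add), ← ha, ENNReal.toNNReal_coe,
          add_tsub_cancel_left, flow_eq_drift, Real.coe_toNNReal t ht']
    refine le_trans ?_ e2.ge
    rw [hL.discLoss_drift hr hlam hπ (meanBefore_mem hlam hπ hp hb.mem _ _)]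
    exact le_self_add

/-- The cost of an experiment in terms of the clamped certainty measure. -/
lemma IsPolicy.cost_eq (h : IsPolicy lam π p Q τ F P) (hb : IsDrawn Q τ P b)
    (hlam : 0 < lam) (hπ : π ∈ Ioo (0 : ℝ) 1) (hp : p ∈ Icc (0 : ℝ) 1)
    (hc : ∀ q ∈ Icc (0 : ℝ) 1, c q = c₀ q) :
    ∀ᵐ ω ∂Q, ∀ i, discount r (τ i ω) * (upsCost c₀ (F i ω) + (0 : ℝ≥0)) =
      discount r (τ i ω) * (∫⁻ x, c x ∂(F i ω) - c (meanBefore lam π p τ b i ω)) := by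
  filter_upwards [h.plausible_meanBefore hb] with ω hω i
  by_cases hfin : τ i ω = ∞
  · simp [hfin, discount]
  · have hF := hω i hfin
    rw [upsCost, hF.mean, hc _ (meanBefore_mem hlam hπ hp hb.mem _ _), ENNReal.coe_zero, add_zero,
      lintegral_congr_ae (hF.ae_mem.mono fun x hx => (hc x hx).symm)]

lemma IsPolicy.measurable_cost (h : IsPolicy lam π p Q τ F P) (hb : IsDrawn Q τ P b)
    (hcm : Measurable c) (i : ℕ) : Measurable fun ω =>
      discount r (τ i ω) * (∫⁻ x, c x ∂(F i ω) - c (meanBefore lam π p τ b i ω)) :=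
  ((measurable_discount r).comp (h.measurable_time i)).mul
    (((Measure.measurable_lintegral hcm).comp ((h.exp_meas i).mono (h.strictPast_le i) le_rfl)).sub
      (hcm.comp (measurable_meanBefore h.measurable_time hb.meas i)))

/-- The expected discounted certainty of the outcome of an experiment is bounded by its cost. -/
lemma IsPolicy.lintegral_discount_mul_le [IsProbabilityMeasure Q] (h : IsPolicy lam π p Q τ F P)
    (hb : IsDrawn Q τ P b)
    (hlam : 0 < lam) (hπ : π ∈ Ioo (0 : ℝ) 1) (hp : p ∈ Icc (0 : ℝ) 1)
    (hcm : Measurable c) (hc : ∀ q ∈ Icc (0 : ℝ) 1, c q = c₀ q) (i : ℕ) :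
    ∫⁻ ω, discount r (τ i ω) * c (b i ω) ∂Q ≤
      ∫⁻ ω, discount r (τ i ω) * (upsCost c₀ (F i ω) + (0 : ℝ≥0)) ∂Q +
        ∫⁻ ω, discount r (τ i ω) * c (meanBefore lam π p τ b i ω) ∂Q := by
  rw [h.lintegral_drawn i (hb.meas i) (hb.eq.mono fun ω hω => hω i) hcm
      (w := fun ω => discount r (τ i ω))
      ((measurable_discount r).comp (h.measurable_time_strictPast i))
      (fun ω hω => by simp [hω, discount]),
    lintegral_congr_ae ((h.cost_eq hb hlam hπ hp hc).mono fun ω hω => hω i),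
    ← lintegral_add_left (h.measurable_cost hb hcm i)]
  refine lintegral_mono fun ω => ?_
  rw [← mul_add]
  exact mul_le_mul_right le_tsub_add _

/-- The loss of virtual flow payoff of a truncated policy is at most the sum of its loss of flow
payoff, the initial certainty, and the costs of its experiments. -/
lemma IsPolicy.lintegral_loss_le [IsProbabilityMeasure Q] (h : IsPolicy lam π p Q τ F P)
    (hb : IsDrawn Q τ P b) (hL : LossData r lam π c g U) (hr : 0 < r) (hlam : 0 < lam)
    (hπ : π ∈ Ioo (0 : ℝ) 1) (hp : p ∈ Icc (0 : ℝ) 1) (hc : ∀ q ∈ Icc (0 : ℝ) 1, c q = c₀ q)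
    (n : ℕ) :
    ∫⁻ ω, discLoss r g (truncPath lam π τ b n ω) ∂Q ≤
      c p + ∑ i ∈ Finset.range (n + 1),
        ∫⁻ ω, discount r (τ i ω) * (upsCost c₀ (F i ω) + (0 : ℝ≥0)) ∂Q +
      ∫⁻ ω, discLoss r U (truncPath lam π τ b n ω) ∂Q := by
  have hmg := fun n => measurable_discLoss_truncPath (r := r) (lam := lam) (π := π)
    h.measurable_time hb.meas n hL.measurable_g
  have hmU := fun n => measurable_discLoss_truncPath (r := r) (lam := lam) (π := π)
    h.measurable_time hb.meas n hL.measurable_U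
  have hcb : ∀ i, Measurable fun ω => c (b i ω) := fun i => hL.measurable_c.comp (hb.meas i)
  induction n with
  | zero =>
    have h0 : ∀ ω, discLoss r g (truncPath lam π τ b 0 ω) =
        c (b 0 ω) + discLoss r U (truncPath lam π τ b 0 ω) := fun ω => by
      have e : ∀ φ, discLoss r φ (truncPath lam π τ b 0 ω) =
          discLoss r φ (fun t => drift lam π t (b 0 ω)) := fun φ =>
        setLIntegral_congr_fun measurableSet_Ioi fun t ht => by
          simp only [truncPath]
          rw [truncBelief, flow_eq_drift, Real.coe_toNNReal t (le_of_lt ht)]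
      rw [e, e, hL.discLoss_drift hr hlam hπ (hb.mem 0 ω)]
    have h1 := h.lintegral_discount_mul_le (r := r) hb hlam hπ hp hL.measurable_c hc 0
    simp only [h.time_zero, meanBefore] at h1
    have hd0 : discount r 0 = 1 := by simp [discount]
    simp only [h0, zero_add, Finset.range_one, Finset.sum_singleton, h.time_zero, hd0, one_mul] at h1 ⊢
    rw [lintegral_add_left (hcb 0)]
    simp only [lintegral_const, measure_univ, mul_one] at h1
    rw [add_comm (c p)]
    gcongr
  | succ n ih =>
    rw [Finset.sum_range_succ]
    set K := c p + ∑ i ∈ Finset.range (n + 1),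
        ∫⁻ ω, discount r (τ i ω) * (upsCost c₀ (F i ω) + (0 : ℝ≥0)) ∂Q with hK
    by_cases hKt : K = ∞
    · rw [← add_assoc, ← hK, hKt]; simp
    have hU_fin : ∀ n, ∫⁻ ω, discLoss r U (truncPath lam π τ b n ω) ∂Q ≠ ∞ := fun n => by
      obtain ⟨B, hB⟩ := hL.U_le
      refine ne_top_of_le_ne_top (b := ENNReal.ofReal (1 / r) * B) (by finiteness) ?_
      calc _ ≤ ∫⁻ _, ENNReal.ofReal (1 / r) * B ∂Q := lintegral_mono fun ω => discLoss_U_le hr hB _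
        _ = _ := by simp
    -- The certainty before the next acquisition is part of the present `g`-loss, hence finite by
    -- the induction hypothesis. This permits cancelling it from both sides.
    have hm_fin : ∫⁻ ω, discount r (τ (n + 1) ω) * c (meanBefore lam π p τ b (n + 1) ω) ∂Q ≠ ∞ :=
      ne_top_of_le_ne_top (ENNReal.add_ne_top.2 ⟨hKt, hU_fin n⟩)
        ((lintegral_mono_ae ((h.discount_mul_le hb hL hr hlam hπ hp).mono fun ω hω => hω n)).trans ih)
    have hdm : Measurable fun ω => discount r (τ (n + 1) ω) :=
      (measurable_discount r).comp (h.measurable_time (n + 1))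
    have hmm : Measurable fun ω =>
        discount r (τ (n + 1) ω) * c (meanBefore lam π p τ b (n + 1) ω) :=
      hdm.mul (hL.measurable_c.comp (measurable_meanBefore h.measurable_time hb.meas (n + 1)))
    have hrec : ∫⁻ ω, discLoss r g (truncPath lam π τ b (n + 1) ω) ∂Q +
        ∫⁻ ω, discount r (τ (n + 1) ω) * c (meanBefore lam π p τ b (n + 1) ω) ∂Q +
        ∫⁻ ω, discLoss r U (truncPath lam π τ b n ω) ∂Q =
        ∫⁻ ω, discLoss r g (truncPath lam π τ b n ω) ∂Q +
        ∫⁻ ω, discount r (τ (n + 1) ω) * c (b (n + 1) ω) ∂Q +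
        ∫⁻ ω, discLoss r U (truncPath lam π τ b (n + 1) ω) ∂Q := by
      rw [← lintegral_add_left (hmg _), ← lintegral_add_right _ (hmU _),
        ← lintegral_add_left (hmg _), ← lintegral_add_right _ (hmU _)]
      exact lintegral_congr_ae ((h.loss_succ hb hL hr hlam hπ hp).mono fun ω hω => hω n)
    have hcost := h.lintegral_discount_mul_le (r := r) hb hlam hπ hp hL.measurable_c hc (n + 1)
    refine (ENNReal.add_le_add_iff_right (ENNReal.add_ne_top.2 ⟨hm_fin, hU_fin n⟩)).1 ?_
    rw [← add_assoc, hrec]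
    refine (add_le_add_left (add_le_add ih hcost) _).trans (le_of_eq ?_)
    rw [hK]; ring

end truncation

end InfoAcq

end

noncomputable section

namespace InfoAcq

/-! ### Letting the number of acquisitions tend to infinity -/

lemma continuous_const_sub_coe (x : ℝ) : Continuous fun y : ℝ≥0∞ => (x : EReal) - (y : EReal) := by
  rw [continuous_iff_continuousAt]
  intro y
  have h := EReal.continuousAt_add (p := ((x : EReal), -(y : EReal)))
    (Or.inl (EReal.coe_ne_top _)) (Or.inl (EReal.coe_ne_bot _))
  simp only [sub_eq_add_neg]
  exact h.comp (f := fun y : ℝ≥0∞ => ((x : EReal), -(y : EReal)))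
    (continuousAt_const.prodMk (continuous_neg.comp continuous_coe_ennreal_ereal).continuousAt)

lemma coe_sub_add_eq (x : ℝ) (y z : ℝ≥0∞) :
    (x : EReal) - ((y + z : ℝ≥0∞) : EReal) = (x : EReal) - (y : EReal) - (z : EReal) := by
  rw [EReal.coe_ennreal_add, sub_eq_add_neg, sub_eq_add_neg, sub_eq_add_neg, add_assoc,
    EReal.neg_add (Or.inl (EReal.coe_ennreal_ne_bot _)) (Or.inr (EReal.coe_ennreal_ne_bot _)),
    sub_eq_add_neg]

section truncation
variable {r lam π p : ℝ} {Ω : Type} [MeasurableSpace Ω] {Q : Measure Ω}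
  {τ : ℕ → Ω → ℝ≥0∞} {F : ℕ → Ω → Measure ℝ} {P : ℝ≥0 → Ω → ℝ} {b : ℕ → Ω → ℝ}
  {c c₀ g U : ℝ → ℝ≥0∞}

/-- The truncated processes converge to the belief process of the policy. -/
lemma IsPolicy.tendsto_truncBelief (h : IsPolicy lam π p Q τ F P) (hb : IsDrawn Q τ P b) :
    ∀ᵐ ω ∂Q, ∀ t : ℝ≥0, Tendsto (fun n => truncBelief lam π τ b n t ω) atTop (𝓝 (P t ω)) := by
  filter_upwards [h.truncBelief_before hb, h.time_le, h.time_strict, hb.eq, h.after]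
    with ω h1 hmono hstrict hbeq hafter t
  by_cases ht : (t : ℝ≥0∞) < ⨆ i, τ i ω
  · obtain ⟨i, hi⟩ := lt_iSup_iff.1 ht
    refine tendsto_const_nhds.congr' ?_
    filter_upwards [eventually_ge_atTop i] with n hn
    exact (h1 n t (hi.trans_le (hmono (by omega)))).symm
  · have hle : ⨆ i, τ i ω ≤ t := not_lt.1 ht
    have hfinT : ⨆ i, τ i ω ≠ ∞ := ne_top_of_le_ne_top ENNReal.coe_ne_top hle
    obtain ⟨T, hT⟩ : ∃ T : ℝ≥0, (T : ℝ≥0∞) = ⨆ i, τ i ω := ⟨_, ENNReal.coe_toNNReal hfinT⟩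
    have hfin : ∀ i, τ i ω ≠ ∞ := fun i => ne_top_of_le_ne_top hfinT (le_iSup (fun i => τ i ω) i)
    have hTt : T ≤ t := by rw [← hT] at hle; exact_mod_cast hle
    obtain ⟨hlim, hdrift⟩ := hafter T hT.symm
    -- Strictly increasing times approach their accumulation point `T` from the left, so the drawn
    -- beliefs converge to the left limit, which `after` identifies with `P T`.
    have hlt : ∀ i, (τ i ω).toNNReal < T := fun i => by
      have h2 : τ i ω < T := (hstrict i (hfin i)).trans_le
        (by rw [hT]; exact le_iSup (fun i => τ i ω) (i + 1))
      rw [← ENNReal.coe_toNNReal (hfin i)] at h2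
      exact_mod_cast h2
    have hτ : Tendsto (fun i => (τ i ω).toNNReal) atTop (𝓝 T) := by
      have h3 : Tendsto (fun i => τ i ω) atTop (𝓝 (T : ℝ≥0∞)) := by
        rw [hT]; exact tendsto_atTop_iSup hmono
      have := (ENNReal.tendsto_toNNReal (a := (T : ℝ≥0∞)) ENNReal.coe_ne_top).comp h3
      rwa [ENNReal.toNNReal_coe] at this
    have hbl : Tendsto (fun i => b i ω) atTop (𝓝 (P T ω)) := by
      have h4 : Tendsto (fun i => P (τ i ω).toNNReal ω) atTop (𝓝 (P T ω)) :=
        hlim.comp (tendsto_nhdsWithin_iff.2 ⟨hτ, Eventually.of_forall hlt⟩)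
      exact h4.congr fun i => (hbeq i (hfin i)).symm
    have hflow : Continuous fun x : ℝ≥0 × ℝ => flow lam π x.1 x.2 := by unfold flow; fun_prop
    rw [hdrift t hTt]
    have h5 := (hflow.tendsto (t - T, P T ω)).comp
      ((tendsto_const_nhds.sub hτ).prodMk_nhds hbl)
    refine h5.congr fun n => ?_
    rw [truncBelief_after h.time_zero n ω t ((le_iSup (fun i => τ i ω) n).trans hle)]
    rfl

/-- The loss of flow payoff of the truncated policies converges to the one of the policy. -/
lemma IsPolicy.tendsto_discLoss (h : IsPolicy lam π p Q τ F P) (hb : IsDrawn Q τ P b)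
    (hL : LossData r lam π c g U) (hr : 0 < r) :
    ∀ᵐ ω ∂Q, Tendsto (fun n => discLoss r U (truncPath lam π τ b n ω)) atTop
      (𝓝 (discLoss r U fun t => P t.toNNReal ω)) := by
  obtain ⟨B, hB⟩ := hL.U_le
  filter_upwards [h.tendsto_truncBelief hb] with ω hω
  refine tendsto_lintegral_of_dominated_convergence (fun t => disc r t * B)
    (fun n => (measurable_disc r).mul
      (hL.measurable_U.comp (measurable_truncPath h.measurable_time hb.meas n ω)))
    (fun n => ae_of_all _ fun t => mul_le_mul_right (hB _) _) ?_ (ae_of_all _ fun t => ?_)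
  · rw [lintegral_mul_const _ (measurable_disc r), lintegral_disc hr]
    finiteness
  · exact ENNReal.Tendsto.const_mul ((hL.cont_U.tendsto _).comp (hω t.toNNReal))
      (Or.inr (disc_ne_top r t))

/-- The flow payoff of a policy in terms of its loss. -/
lemma IsPolicy.integral_flow_payoff (h : IsPolicy lam π p Q τ F P) (hb : IsDrawn Q τ P b)
    (hL : LossData r lam π c g U) (hr : 0 < r) {u : ℝ → ℝ} {M : ℝ≥0}
    (hu : ∀ q ∈ Icc (0 : ℝ) 1, u q ≤ M ∧ U q = ENNReal.ofReal (M - u q)) :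
    ∀ᵐ ω ∂Q, ∫ t in Ioi (0 : ℝ), Real.exp (-r * t) * u (P t.toNNReal ω) =
      M / r - (discLoss r U fun t => P t.toNNReal ω).toReal := by
  obtain ⟨B, hB⟩ := hL.U_le
  filter_upwards [h.tendsto_truncBelief hb] with ω hω
  -- Path measurability of `P` is not assumed; almost every path inherits it as a limit of truncated
  -- paths.
  have hPm : Measurable fun t : ℝ => P t.toNNReal ω :=
    measurable_of_tendsto_metrizable (fun n => measurable_truncPath h.measurable_time hb.meas n ω)
      (tendsto_pi_nhds.2 fun t => hω t.toNNReal)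
  set x : ℝ → ℝ := fun t => P t.toNNReal ω
  have hx : ∀ t, x t ∈ Icc (0 : ℝ) 1 := fun t => h.mem _ _
  have hUr : ∀ t, u (x t) = M - (U (x t)).toReal := fun t => by
    obtain ⟨h1, h2⟩ := hu _ (hx t)
    rw [h2, ENNReal.toReal_ofReal (by linarith)]; ring
  have hUm : Measurable fun t => (U (x t)).toReal := (hL.measurable_U.comp hPm).ennreal_toReal
  have hi1 := integrableOn_exp_Ioi hr
  have hi2 : IntegrableOn (fun t => Real.exp (-r * t) * (U (x t)).toReal) (Ioi 0) := by
    refine hi1.mul_bdd (c := B) hUm.aestronglyMeasurable (ae_of_all _ fun t => ?_)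
    rw [Real.norm_eq_abs, abs_of_nonneg ENNReal.toReal_nonneg]
    exact ENNReal.toReal_le_coe_of_le_coe (hB _)
  have hval : ∫ t in Ioi (0 : ℝ), Real.exp (-r * t) * (U (x t)).toReal =
      (discLoss r U x).toReal := by
    rw [integral_eq_lintegral_of_nonneg_ae
      (ae_of_all _ fun t => mul_nonneg (Real.exp_pos _).le ENNReal.toReal_nonneg) hi2.1]
    congr 1
    refine lintegral_congr fun t => ?_
    rw [ENNReal.ofReal_mul (Real.exp_pos _).le, ENNReal.ofReal_toReal
      (ne_top_of_le_ne_top ENNReal.coe_ne_top (hB _)), disc]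
  have hexp : ∫ t in Ioi (0 : ℝ), Real.exp (-r * t) = 1 / r := by
    rw [integral_exp_mul_Ioi (by linarith)]; simp
  rw [← hval]
  change ∫ t in Ioi (0 : ℝ), Real.exp (-r * t) * u (x t) = _
  simp only [hUr, mul_sub]
  rw [integral_sub (hi1.mul_const _) hi2, integral_mul_const, hexp]
  ring

/-- The payoff of a policy in terms of its losses. -/
lemma IsPolicy.policyPayoff_eq [IsProbabilityMeasure Q] (h : IsPolicy lam π p Q τ F P)
    (hL : LossData r lam π c g U) (hr : 0 < r) (hlam : 0 < lam)
    (hπ : π ∈ Ioo (0 : ℝ) 1) (hp : p ∈ Icc (0 : ℝ) 1) (hc : ∀ q ∈ Icc (0 : ℝ) 1, c q = c₀ q)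
    {u : ℝ → ℝ} {M : ℝ≥0} (hu : ∀ q ∈ Icc (0 : ℝ) 1, u q ≤ M ∧ U q = ENNReal.ofReal (M - u q)) :
    policyPayoff r 0 u c₀ Q τ F P = ((M / r : ℝ) : EReal) -
      ((∫⁻ ω, discLoss r U (fun t => P t.toNNReal ω) ∂Q +
        ∑' i, ∫⁻ ω, discount r (τ i ω) * (upsCost c₀ (F i ω) + (0 : ℝ≥0)) ∂Q : ℝ≥0∞) : EReal) := by
  obtain ⟨b, hb⟩ := h.exists_isDrawn
  have hcm : ∀ i, AEMeasurable
      (fun ω => discount r (τ i ω) * (upsCost c₀ (F i ω) + (0 : ℝ≥0))) Q := fun i =>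
    (h.measurable_cost hb hL.measurable_c i).aemeasurable.congr
      ((h.cost_eq hb hlam hπ hp hc).mono fun ω hω => (hω i).symm)
  have hUm : AEMeasurable (fun ω => discLoss r U fun t => P t.toNNReal ω) Q :=
    aemeasurable_of_tendsto_metrizable_ae atTop (fun n => (measurable_discLoss_truncPath
      h.measurable_time hb.meas n hL.measurable_U).aemeasurable) (h.tendsto_discLoss hb hL hr)
  have hae : (fun ω => ((∫ t in Ioi (0 : ℝ), Real.exp (-r * t) * u (P t.toNNReal ω) : ℝ) : EReal)
      - ((∑' i, discount r (τ i ω) * (upsCost c₀ (F i ω) + (0 : ℝ≥0)) : ℝ≥0∞) : EReal)) =ᵐ[Q]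
      fun ω => (((M / r.toNNReal : ℝ≥0) : ℝ) : EReal) -
        ((discLoss r U (fun t => P t.toNNReal ω) +
          ∑' i, discount r (τ i ω) * (upsCost c₀ (F i ω) + (0 : ℝ≥0)) : ℝ≥0∞) : EReal) := by
    filter_upwards [h.integral_flow_payoff hb hL hr hu] with ω hω
    rw [hω, EReal.coe_sub, EReal.coe_ennreal_toReal (hL.discLoss_U_ne_top hr _),
      NNReal.coe_div, Real.coe_toNNReal r hr.le, coe_sub_add_eq]
  have hsum : AEMeasurable
      (fun ω => ∑' i, discount r (τ i ω) * (upsCost c₀ (F i ω) + (0 : ℝ≥0))) Q :=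
    AEMeasurable.tsum hcm
  rw [policyPayoff, extIntegral_congr_ae hae, extIntegral_sub (a := fun _ => M / r.toNNReal)
    (g := fun ω => discLoss r U (fun t => P t.toNNReal ω) +
      ∑' i, discount r (τ i ω) * (upsCost c₀ (F i ω) + (0 : ℝ≥0)))
    aemeasurable_const (hUm.add hsum) (by simp), lintegral_add_right' _ hsum, lintegral_tsum hcm]
  rw [lintegral_const, measure_univ, mul_one,
    EReal.coe_nnreal_eq_coe_real, NNReal.coe_div, Real.coe_toNNReal r hr.le]

/-- The net payoff of every policy is bounded by the supremum over belief processes. -/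
theorem IsPolicy.policyPayoff_sub_le [IsProbabilityMeasure Q] (h : IsPolicy lam π p Q τ F P)
    (hL : LossData r lam π c g U) (hr : 0 < r) (hlam : 0 < lam)
    (hπ : π ∈ Ioo (0 : ℝ) 1) (hp : p ∈ Icc (0 : ℝ) 1) (hc : ∀ q ∈ Icc (0 : ℝ) 1, c q = c₀ q)
    {u : ℝ → ℝ} {M : ℝ≥0} (hu : ∀ q ∈ Icc (0 : ℝ) 1, u q ≤ M ∧ U q = ENNReal.ofReal (M - u q))
    {f : ℝ → EReal} (hf : ∀ q ∈ Icc (0 : ℝ) 1, f q = ((M : ℝ) : EReal) - (g q : EReal)) :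
    policyPayoff r 0 u c₀ Q τ F P - (c₀ p : EReal) ≤ supOverProcesses r lam π f p := by
  obtain ⟨b, hb⟩ := h.exists_isDrawn
  rw [h.policyPayoff_eq hL hr hlam hπ hp hc hu, ← coe_sub_add_eq, ← hc p hp]
  set K := ∑' i, ∫⁻ ω, discount r (τ i ω) * (upsCost c₀ (F i ω) + (0 : ℝ≥0)) ∂Q
  -- With the total cost in place of the partial sum, only the `U`-loss depends on `n`, so no limit
  -- is needed in the possibly unbounded `g`-loss.
  have hbound : ∀ n, ((M / r : ℝ) : EReal) -
      ((∫⁻ ω, discLoss r U (truncPath lam π τ b n ω) ∂Q + K + c p : ℝ≥0∞) : EReal) ≤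
      supOverProcesses r lam π f p := by
    intro n
    have hbp := h.isBeliefProcess_truncBelief hlam hπ hp hb n
    have hle : ((M / r : ℝ) : EReal) -
        ((∫⁻ ω, discLoss r g (truncPath lam π τ b n ω) ∂Q : ℝ≥0∞) : EReal) ≤
        supOverProcesses r lam π f p := by
      refine le_sSup ⟨Ω, inferInstance, Q, truncBelief lam π τ b n, inferInstance, hbp, ?_⟩
      exact (extIntegral_process hr hL.measurable_g hf
        (measurable_uncurry_of_rightCont hbp.meas hbp.rightCont) hbp.mem).symm
    refine le_trans (EReal.sub_le_sub le_rfl (EReal.coe_ennreal_le_coe_ennreal_iff.2 ?_)) hle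
    refine (h.lintegral_loss_le hb hL hr hlam hπ hp hc n).trans ?_
    have : ∑ i ∈ Finset.range (n + 1),
        ∫⁻ ω, discount r (τ i ω) * (upsCost c₀ (F i ω) + (0 : ℝ≥0)) ∂Q ≤ K :=
      ENNReal.sum_le_tsum _
    calc _ ≤ c p + K + ∫⁻ ω, discLoss r U (truncPath lam π τ b n ω) ∂Q := by gcongr
      _ = _ := by ring
  have hlim : Tendsto (fun n => ∫⁻ ω, discLoss r U (truncPath lam π τ b n ω) ∂Q) atTop
      (𝓝 (∫⁻ ω, discLoss r U (fun t => P t.toNNReal ω) ∂Q)) := by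
    obtain ⟨B, hB⟩ := hL.U_le
    refine tendsto_lintegral_of_dominated_convergence (fun _ => ENNReal.ofReal (1 / r) * B)
      (fun n => measurable_discLoss_truncPath h.measurable_time hb.meas n hL.measurable_U)
      (fun n => ae_of_all _ fun ω => discLoss_U_le hr hB _) ?_ (h.tendsto_discLoss hb hL hr)
    simp only [lintegral_const, measure_univ, mul_one]
    finiteness
  exact le_of_tendsto (((continuous_const_sub_coe (M / r)).tendsto _).comp
    ((hlim.add_const K).add_const (c p))) (Eventually.of_forall hbound)

end truncation

/-- The net value is at most the supremum over belief processes. -/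
theorem netValue_le {r lam π p : ℝ} {c c₀ g U : ℝ → ℝ≥0∞} (hL : LossData r lam π c g U)
    (hr : 0 < r) (hlam : 0 < lam)
    (hπ : π ∈ Ioo (0 : ℝ) 1) (hp : p ∈ Icc (0 : ℝ) 1) (hc : ∀ q ∈ Icc (0 : ℝ) 1, c q = c₀ q)
    {u : ℝ → ℝ} {M : ℝ≥0} (hu : ∀ q ∈ Icc (0 : ℝ) 1, u q ≤ M ∧ U q = ENNReal.ofReal (M - u q))
    {f : ℝ → EReal} (hf : ∀ q ∈ Icc (0 : ℝ) 1, f q = ((M : ℝ) : EReal) - (g q : EReal)) :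
    netValue r lam π 0 u c₀ p ≤ supOverProcesses r lam π f p := by
  rw [netValue]
  -- An infinite initial certainty makes the net value `⊥`.
  by_cases hcp : c₀ p = ∞
  · rw [hcp]; simp
  have hcp' : (c₀ p : EReal) ≠ ⊤ := by simpa using hcp
  rw [EReal.sub_le_iff_le_add (Or.inl (EReal.coe_ennreal_ne_bot _)) (Or.inl hcp')]
  refine sSup_le ?_
  rintro x ⟨Ω, _, Q, τ, F, P, hQ, h, rfl⟩
  rw [← EReal.sub_le_iff_le_add (Or.inl (EReal.coe_ennreal_ne_bot _)) (Or.inl hcp')]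
  exact h.policyPayoff_sub_le hL hr hlam hπ hp hc hu hf

end InfoAcq

end

noncomputable section

namespace InfoAcq

/-! ### Markov chains and belief paths with deterministic jump times -/

/-- Existence of an inhomogeneous Markov chain with given initial law and transition kernels. -/
lemma exists_markovChain (μ : Measure ℝ) [IsProbabilityMeasure μ] (K : ℕ → Kernel ℝ ℝ)
    [∀ n, IsMarkovKernel (K n)] :
    ∃ ν : Measure (ℕ → ℝ), IsProbabilityMeasure ν ∧ ν.map (fun x => x 0) = μ ∧
      ∀ (n : ℕ) (A : Set ((i : Finset.Iic n) → ℝ)), MeasurableSet A → ∀ B : Set ℝ, MeasurableSet B →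
        ν (Preorder.frestrictLe n ⁻¹' A ∩ {x : ℕ → ℝ | x (n + 1) ∈ B}) =
          ∫⁻ (x : ℕ → ℝ) in Preorder.frestrictLe n ⁻¹' A, K n (x n) B ∂ν := by
  -- The Ionescu-Tulcea construction takes kernels on whole histories; these look only at the last
  -- coordinate.
  set κ : (n : ℕ) → Kernel ((i : Finset.Iic n) → ℝ) ℝ := fun n =>
    (K n).comap (fun h => h ⟨n, Finset.mem_Iic.2 le_rfl⟩) (measurable_pi_apply _) with hκ
  set e : ℝ → ((i : Finset.Iic 0) → ℝ) := fun q _ => q with he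
  have hem : Measurable e := measurable_pi_lambda _ fun _ => measurable_id
  have := Measure.isProbabilityMeasure_map (μ := μ) hem.aemeasurable
  have hmr : ∀ n, Measurable (Preorder.frestrictLe (π := fun _ : ℕ => ℝ) n) := fun n =>
    Preorder.measurable_frestrictLe n
  refine ⟨(μ.map e).bind (Kernel.traj (X := fun _ => ℝ) κ 0), inferInstance, ?_, ?_⟩
  · ext B hB
    rw [Measure.map_apply (measurable_pi_apply 0) hB,
      Measure.bind_apply (measurable_pi_apply 0 hB) (Kernel.aemeasurable _),
      lintegral_map (Kernel.measurable_coe _ (measurable_pi_apply 0 hB)) hem]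
    have h0 : ∀ q, Kernel.traj (X := fun _ => ℝ) κ 0 (e q) ((fun x : ℕ → ℝ => x 0) ⁻¹' B) =
        B.indicator 1 q := fun q => by
      have h1 := Kernel.traj_map_frestrictLe_apply (X := fun _ => ℝ) (κ := κ) 0 0 (e q)
      rw [Kernel.partialTraj_self, Kernel.id_apply] at h1
      have h2 : (fun x : ℕ → ℝ => x 0) ⁻¹' B = Preorder.frestrictLe (π := fun _ : ℕ => ℝ) 0 ⁻¹'
          ((fun h => h ⟨0, Finset.mem_Iic.2 le_rfl⟩) ⁻¹' B) := rfl
      have hm2 : MeasurableSet ((fun h : (i : Finset.Iic 0) → ℝ =>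
          h ⟨0, Finset.mem_Iic.2 le_rfl⟩) ⁻¹' B) := measurable_pi_apply _ hB
      rw [h2, ← Measure.map_apply (hmr 0) hm2, h1, Measure.dirac_apply' _ hm2]
      rfl
    simp only [h0]
    rw [lintegral_indicator_one hB]
  · intro n A hA B hB
    have hS : MeasurableSet (Preorder.frestrictLe (π := fun _ : ℕ => ℝ) n ⁻¹' A) := hmr n hA
    have hT : MeasurableSet {x : ℕ → ℝ | x (n + 1) ∈ B} := measurable_pi_apply _ hB
    have hKm : Measurable fun x : ℕ → ℝ => K n (x n) B :=
      (Kernel.measurable_coe _ hB).comp (measurable_pi_apply n)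
    rw [Measure.bind_apply (hS.inter hT) (Kernel.aemeasurable _), ← lintegral_indicator hS,
      Measure.lintegral_bind (Kernel.aemeasurable _) (hKm.indicator hS).aemeasurable]
    refine lintegral_congr fun x₀ => ?_
    have h1 := Kernel.partialTraj_compProd_eq_map_traj (X := fun _ => ℝ) (κ := κ) (Nat.zero_le n) (x₀ := x₀)
    have h2 := congrArg (fun ν : Measure _ => ν (A ×ˢ B)) h1
    beta_reduce at h2
    rw [Measure.map_apply ((hmr n).prodMk (measurable_pi_apply _)) (hA.prod hB),
      Measure.compProd_apply_prod hA hB, ← Kernel.traj_map_frestrictLe_apply,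
      setLIntegral_map hA (Kernel.measurable_coe _ hB) (hmr n)] at h2
    rw [lintegral_indicator hS]
    exact h2.symm

section chainPath
variable {r lam π : ℝ} {T : ℕ → ℝ≥0} {Ω : Type}

/-- The number of the interval `[T i, T (i + 1))` containing `t`. -/
def intervalIdx (T : ℕ → ℝ≥0) (t : ℝ≥0) : ℕ :=
  open Classical in if h : ∃ n, t < T (n + 1) then Nat.find h else 0

lemma intervalIdx_spec (hT0 : T 0 = 0) (hT : Tendsto T atTop atTop) (t : ℝ≥0) :
    T (intervalIdx T t) ≤ t ∧ t < T (intervalIdx T t + 1) := by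
  classical
  have h : ∃ n, t < T (n + 1) :=
    (((tendsto_add_atTop_iff_nat 1).2 hT).eventually_gt_atTop t).exists
  rw [intervalIdx, dif_pos h]
  refine ⟨?_, by convert Nat.find_spec h⟩
  rcases hn : Nat.find h with _ | m
  · rw [hT0]; exact zero_le
  · exact not_lt.1 (Nat.find_min h (m := m) (by omega))

lemma intervalIdx_eq (hT0 : T 0 = 0) (hTm : StrictMono T) (hT : Tendsto T atTop atTop) {t : ℝ≥0}
    {i : ℕ} (h1 : T i ≤ t) (h2 : t < T (i + 1)) : intervalIdx T t = i := by
  obtain ⟨h3, h4⟩ := intervalIdx_spec hT0 hT t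
  have h5 := hTm.lt_iff_lt.1 (h3.trans_lt h2)
  have h6 := hTm.lt_iff_lt.1 (h1.trans_lt h4)
  omega

lemma measurable_intervalIdx (hT0 : T 0 = 0) (hTm : StrictMono T) (hT : Tendsto T atTop atTop) :
    Measurable (intervalIdx T) := by
  refine measurable_to_countable' fun i => ?_
  have : intervalIdx T ⁻¹' {i} = Ico (T i) (T (i + 1)) := by
    ext t
    simp only [mem_preimage, mem_singleton_iff, mem_Ico]
    refine ⟨?_, fun h => intervalIdx_eq hT0 hTm hT h.1 h.2⟩
    rintro rfl
    exact intervalIdx_spec hT0 hT t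
  rw [this]
  exact measurableSet_Ico

/-- The belief path that jumps to `Y i` at time `T i` and drifts in between. -/
def chainPath (lam π : ℝ) (T : ℕ → ℝ≥0) (Y : ℕ → Ω → ℝ) (t : ℝ≥0) (ω : Ω) : ℝ :=
  flow lam π (t - T (intervalIdx T t)) (Y (intervalIdx T t) ω)

lemma measurable_chainPath [MeasurableSpace Ω] (hT0 : T 0 = 0) (hTm : StrictMono T)
    (hT : Tendsto T atTop atTop) {Y : ℕ → Ω → ℝ} (hY : ∀ i, Measurable (Y i)) :
    Measurable fun x : ℝ≥0 × Ω => chainPath lam π T Y x.1 x.2 := by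
  have hi := measurable_intervalIdx hT0 hTm hT
  have h1 : Measurable fun x : ℕ × Ω => Y x.1 x.2 := measurable_from_prod_countable_right hY
  have h2 : Measurable fun x : ℝ≥0 × Ω => Y (intervalIdx T x.1) x.2 :=
    h1.comp ((hi.comp measurable_fst).prodMk measurable_snd)
  have h3 : Measurable fun x : ℝ≥0 × Ω => x.1 - T (intervalIdx T x.1) :=
    measurable_fst.sub ((measurable_of_countable T).comp (hi.comp measurable_fst))
  exact (measurable_flow lam π).comp (h3.prodMk h2)

/-- The discounted loss along a path with deterministic jump times. -/
lemma discLoss_chainPath (hT0 : T 0 = 0) (hTm : StrictMono T) (hT : Tendsto T atTop atTop)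
    {Y : ℕ → Ω → ℝ} {φ : ℝ → ℝ≥0∞} (hφ : Measurable φ) (ω : Ω) :
    discLoss r φ (fun t => chainPath lam π T Y t.toNNReal ω) =
      ∑' i, disc r (T i) * ∫⁻ t in Ioc (0 : ℝ) (T (i + 1) - T i),
        disc r t * φ (drift lam π t (Y i ω)) := by
  have hmono : Monotone fun i => (T i : ℝ) := fun i j hij => by
    exact_mod_cast hTm.monotone hij
  have hU : ⋃ i, Ioc (T i : ℝ) (T (i + 1)) = Ioi (0 : ℝ) := by
    have h1 := iUnion_Ioc_map_succ_eq_Ioi (f := fun i => (T i : ℝ))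
      (fun n => by exact_mod_cast hTm.monotone (Nat.zero_le n))
      (not_bddAbove_of_tendsto_atTop (NNReal.tendsto_coe_atTop.2 hT))
    simpa [hT0] using h1
  have hdisj : Pairwise (Function.onFun Disjoint fun i => Ioc (T i : ℝ) (T (i + 1))) :=
    hmono.pairwise_disjoint_on_Ioc_succ
  rw [discLoss, ← hU, lintegral_iUnion (fun i => measurableSet_Ioc) hdisj]
  refine tsum_congr fun i => ?_
  have hle : T i ≤ T (i + 1) := hTm.monotone (Nat.le_succ i)
  have hm : Measurable fun t => disc r t * φ (drift lam π (t - T i) (Y i ω)) :=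
    (measurable_disc r).mul (hφ.comp ((measurable_drift lam π (Y i ω)).comp
      (measurable_id.sub_const (T i : ℝ))))
  -- The path drifts on `[T i, T (i + 1))` while the partition of `(0, ∞)` uses `(T i, T (i + 1)]`;
  -- the difference is null.
  rw [← setLIntegral_congr Ico_ae_eq_Ioc, setLIntegral_congr_fun (g := fun t =>
    disc r t * φ (drift lam π (t - T i) (Y i ω))) measurableSet_Ico, setLIntegral_congr Ico_ae_eq_Ioc,
    ← (measurePreserving_add_left (volume : Measure ℝ) (T i)).setLIntegral_comp_preimage
      measurableSet_Ioc hm, ← lintegral_const_mul]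
  · have hs : (fun t => (T i : ℝ) + t) ⁻¹' Ioc (T i : ℝ) (T (i + 1)) =
        Ioc (0 : ℝ) (T (i + 1) - T i) := by
      ext t; simp [le_sub_iff_add_le']
    rw [hs]
    refine lintegral_congr fun t => ?_
    rw [disc_add, mul_assoc, add_sub_cancel_left]
  · exact (measurable_disc r).mul (hφ.comp (measurable_drift lam π (Y i ω)))
  · intro t ht
    have h0 : (0 : ℝ) ≤ t := (NNReal.coe_nonneg _).trans ht.1
    have h1 : T i ≤ t.toNNReal := by rw [Real.le_toNNReal_iff_coe_le h0]; exact ht.1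
    have h2 : t.toNNReal < T (i + 1) := by rw [Real.toNNReal_lt_iff_lt_coe h0]; exact ht.2
    simp only
    rw [chainPath, intervalIdx_eq hT0 hTm hT h1 h2, flow_eq_drift, NNReal.coe_sub h1,
      Real.coe_toNNReal t h0]

end chainPath

end InfoAcq

end

noncomputable section

namespace InfoAcq

/-! ### Policies with deterministic acquisition times -/

section beliefChain
variable {lam π p : ℝ} {T : ℕ → ℝ≥0} {Ω : Type}

lemma chainPath_of_mem (hT0 : T 0 = 0) (hTm : StrictMono T) (hT : Tendsto T atTop atTop)
    {Y : ℕ → Ω → ℝ} {t : ℝ≥0} {i : ℕ} (h1 : T i ≤ t) (h2 : t < T (i + 1)) (ω : Ω) :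
    chainPath lam π T Y t ω = flow lam π (t - T i) (Y i ω) := by
  rw [chainPath, intervalIdx_eq hT0 hTm hT h1 h2]

lemma chainPath_jump (hT0 : T 0 = 0) (hTm : StrictMono T) (hT : Tendsto T atTop atTop)
    {Y : ℕ → Ω → ℝ} (i : ℕ) (ω : Ω) : chainPath lam π T Y (T i) ω = Y i ω := by
  rw [chainPath_of_mem hT0 hTm hT le_rfl (hTm (Nat.lt_succ_self i)), tsub_self, flow_zero]

variable [MeasurableSpace Ω]

/-- `Y` is a sequence of beliefs in `[0, 1]` with mean `p` that drift on average between the times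
`T i`. -/
structure IsBeliefChain (lam π p : ℝ) (Q : Measure Ω) (T : ℕ → ℝ≥0) (Y : ℕ → Ω → ℝ) : Prop where
  time_zero : T 0 = 0
  time_mono : StrictMono T
  time_tendsto : Tendsto T atTop atTop
  meas : ∀ i, Measurable (Y i)
  mem : ∀ i ω, Y i ω ∈ Icc (0 : ℝ) 1
  mean_zero : ∫ ω, Y 0 ω ∂Q = p
  drift : ∀ i, Q[Y (i + 1) | MeasurableSpace.comap (Y i) inferInstance] =ᵐ[Q]
    fun ω => flow lam π (T (i + 1) - T i) (Y i ω)

variable {Q : Measure Ω} [IsProbabilityMeasure Q] {Y : ℕ → Ω → ℝ}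

/-- The transition kernels of a belief chain are Bayes-plausible. -/
lemma IsBeliefChain.ae_bayesPlausible (h : IsBeliefChain lam π p Q T Y) (i : ℕ) :
    ∀ᵐ y ∂(Q.map (Y i)), BayesPlausible (flow lam π (T (i + 1) - T i) y)
      (condDistrib (Y (i + 1)) (Y i) Q y) := by
  have hcomp := compProd_map_condDistrib (mβ := Real.measurableSpace) (μ := Q) (Y := Y (i + 1)) (X := Y i)
    (h.meas (i + 1)).aemeasurable
  have hcar : ∀ᵐ y ∂(Q.map (Y i)), condDistrib (Y (i + 1)) (Y i) Q y (Icc (0 : ℝ) 1)ᶜ = 0 := by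
    have h1 := congrArg (fun ν : Measure (ℝ × ℝ) => ν (univ ×ˢ (Icc (0 : ℝ) 1)ᶜ)) hcomp
    beta_reduce at h1
    have hm : MeasurableSet (Icc (0 : ℝ) 1)ᶜ := measurableSet_Icc.compl
    rw [Measure.compProd_apply_prod MeasurableSet.univ hm, Measure.restrict_univ,
      Measure.map_apply ((h.meas i).prodMk (h.meas (i + 1))) (MeasurableSet.univ.prod hm)] at h1
    have h2 : (fun a => (Y i a, Y (i + 1) a)) ⁻¹' (univ ×ˢ (Icc (0 : ℝ) 1)ᶜ) = ∅ := by
      ext ω; simp only [mem_preimage, mem_prod, mem_univ, true_and, mem_compl_iff,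
        mem_empty_iff_false, iff_false, not_not]
      exact h.mem _ _
    rw [h2, measure_empty, lintegral_eq_zero_iff (Kernel.measurable_coe _ hm)] at h1
    exact h1
  have hmean : ∀ᵐ y ∂(Q.map (Y i)), ∫ x, x ∂(condDistrib (Y (i + 1)) (Y i) Q y) =
      flow lam π (T (i + 1) - T i) y := by
    have hm1 : StronglyMeasurable fun y => ∫ x, x ∂(condDistrib (Y (i + 1)) (Y i) Q y) :=
      StronglyMeasurable.integral_kernel (f := fun x : ℝ => x) stronglyMeasurable_id
    have hm2 : Measurable (flow lam π (T (i + 1) - T i)) :=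
      (measurable_flow lam π).comp measurable_prodMk_left
    rw [ae_map_iff (h.meas i).aemeasurable (measurableSet_eq_fun hm1.measurable hm2)]
    have hint : Integrable (Y (i + 1)) Q := integrable_of_mem_Icc (h.meas _) (h.mem _)
    have h1 := condExp_ae_eq_integral_condDistrib' (h.meas i) hint
    filter_upwards [h1, h.drift i] with ω h2 h3
    rw [← h2, h3]
  filter_upwards [hcar, hmean] with y h1 h2
  exact ⟨inferInstance, h1, h2⟩

/-- A belief chain is the chain of beliefs of a policy with deterministic acquisition times. -/
lemma IsBeliefChain.exists_policy (hlam : 0 < lam) (hπ : π ∈ Ioo (0 : ℝ) 1)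
    (h : IsBeliefChain lam π p Q T Y) :
    ∃ (ν : Measure (ℕ → ℝ)) (Z : ℕ → (ℕ → ℝ) → ℝ) (F : ℕ → (ℕ → ℝ) → Measure ℝ),
      IsProbabilityMeasure ν ∧ (∀ i, Measurable (Z i)) ∧ (∀ i, ν.map (Z i) = Q.map (Y i)) ∧
      IsPolicy lam π p ν (fun i _ => (T i : ℝ≥0∞)) F (chainPath lam π T Z) := by
  set κ : ℕ → Kernel ℝ ℝ := fun i => condDistrib (Y (i + 1)) (Y i) Q with hκ
  -- The transition depends on the coordinate `x i` only through its clamped value `Z i x`, which is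
  -- what the belief process reveals; this makes the experiments measurable for the past of beliefs.
  set K : ℕ → Kernel ℝ ℝ := fun i => (κ i).comap clamp continuous_clamp.measurable with hK
  have : IsProbabilityMeasure (Q.map (Y 0)) :=
    Measure.isProbabilityMeasure_map (h.meas 0).aemeasurable
  obtain ⟨ν, hν, hν0, hνs⟩ := exists_markovChain (Q.map (Y 0)) K
  set Z : ℕ → (ℕ → ℝ) → ℝ := fun i x => clamp (x i) with hZ
  have hZm : ∀ i, Measurable (Z i) := fun i =>
    continuous_clamp.measurable.comp (measurable_pi_apply i)
  have hZI : ∀ i x, Z i x ∈ Icc (0 : ℝ) 1 := fun i x => clamp_mem _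
  -- Equal initial laws and equal transition kernels give equal laws at each single time. The joint
  -- law of the whole sequence may differ from that of `Y`.
  have hlaw' : ∀ i, ν.map (fun x => x i) = Q.map (Y i) := by
    intro i
    induction i with
    | zero => exact hν0
    | succ i ih =>
      ext B hB
      have h1 := hνs i univ MeasurableSet.univ B hB
      rw [preimage_univ, univ_inter, Measure.restrict_univ] at h1
      have h2 : ∫⁻ (x : ℕ → ℝ), K i (x i) B ∂ν = ∫⁻ y, K i y B ∂(Q.map (Y i)) := by
        rw [← ih, lintegral_map (Kernel.measurable_coe _ hB) (measurable_pi_apply i)]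
      have h3 : ∫⁻ y, K i y B ∂(Q.map (Y i)) = ∫⁻ y, κ i y B ∂(Q.map (Y i)) := by
        rw [lintegral_map (Kernel.measurable_coe _ hB) (h.meas i),
          lintegral_map (Kernel.measurable_coe _ hB) (h.meas i)]
        refine lintegral_congr fun ω => ?_
        rw [hK, Kernel.comap_apply, clamp_of_mem (h.mem i ω)]
      have h4 := congrArg (fun ν : Measure (ℝ × ℝ) => ν (univ ×ˢ B))
        (compProd_map_condDistrib (mβ := Real.measurableSpace) (μ := Q) (Y := Y (i + 1)) (X := Y i)
          (h.meas (i + 1)).aemeasurable)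
      beta_reduce at h4
      rw [Measure.compProd_apply_prod MeasurableSet.univ hB, Measure.restrict_univ,
        Measure.map_apply ((h.meas i).prodMk (h.meas (i + 1))) (MeasurableSet.univ.prod hB)] at h4
      have h5 : Measurable fun x : ℕ → ℝ => x (i + 1) := measurable_pi_apply _
      rw [Measure.map_apply h5 hB, Measure.map_apply (h.meas _) hB]
      refine (h1.trans (h2.trans (h3.trans h4))).trans ?_
      congr 1
      ext ω; simp
  have hlaw : ∀ i, ν.map (Z i) = Q.map (Y i) := by
    intro i
    have h1 : Z i = clamp ∘ fun x => x i := rfl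
    rw [h1, ← Measure.map_map continuous_clamp.measurable (measurable_pi_apply i), hlaw',
      Measure.map_map continuous_clamp.measurable (h.meas i)]
    congr 1
    ext ω
    exact clamp_of_mem (h.mem i ω)
  set F : ℕ → (ℕ → ℝ) → Measure ℝ := fun i x =>
    match i with
    | 0 => Q.map (Y 0)
    | i + 1 => κ i (Z i x) with hF
  set P := chainPath lam π T Z with hP
  have hjump : ∀ i x, P (T i) x = Z i x :=
    chainPath_jump h.time_zero h.time_mono h.time_tendsto
  have hPm : ∀ t, StronglyMeasurable (P t) := fun t =>
    ((measurable_chainPath h.time_zero h.time_mono h.time_tendsto hZm).comp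
      measurable_prodMk_left).stronglyMeasurable
  have hbel : ∀ i x, beliefAt (fun i _ => (T i : ℝ≥0∞)) P i x = Z i x := fun i x => by
    simp only [beliefAt, ENNReal.toNNReal_coe]; exact hjump i x
  have hpl : ∀ i, ∀ᵐ x ∂ν, BayesPlausible (flow lam π (T (i + 1) - T i) (Z i x))
      (κ i (Z i x)) := fun i => by
    have h1 := h.ae_bayesPlausible i
    rw [← hlaw i] at h1
    exact ae_of_ae_map (hZm i).aemeasurable h1
  refine ⟨ν, Z, F, hν, hZm, hlaw, ?_⟩
  refine
    { meas := hPm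
      mem := fun t x => flow_mem_Icc hlam hπ _ (hZI _ x)
      time_zero := fun _ => by simp [h.time_zero]
      time_mono := ae_of_all _ fun _ i => by exact_mod_cast h.time_mono.monotone (Nat.le_succ i)
      time_strict := ae_of_all _ fun _ i _ => by exact_mod_cast h.time_mono (Nat.lt_succ_self i)
      stopping := fun i s => MeasurableSet.const _
      exp_meas := ?_
      plausible := ?_
      draw := ?_
      between := ?_
      after := ?_ }
  · intro i
    rcases i with _ | i
    · exact measurable_const
    · have h1 : Measurable[Filtration.natural P hPm (T i)] (Z i) := by
        have h2 := (Filtration.stronglyAdapted_natural hPm (T i)).measurable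
        rwa [show P (T i) = Z i from funext (hjump i)] at h2
      have h3 : Filtration.natural P hPm (T i) ≤
          strictPast (Filtration.natural P hPm) fun _ => (T (i + 1) : ℝ≥0∞) := by
        intro A hA
        refine MeasurableSpace.measurableSet_generateFrom ⟨T i, A, hA, ?_⟩
        have : (T i : ℝ≥0∞) < T (i + 1) := by exact_mod_cast h.time_mono (Nat.lt_succ_self i)
        simp [this]
      exact (κ i).measurable.comp (h1.mono h3 le_rfl)
  · intro i
    rcases i with _ | i
    · refine ae_of_all _ fun x _ => ⟨inferInstance, ?_, ?_⟩
      · change Q.map (Y 0) (Icc (0 : ℝ) 1)ᶜ = 0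
        rw [Measure.map_apply (h.meas 0) measurableSet_Icc.compl]
        convert measure_empty (μ := Q)
        ext ω; simpa using h.mem 0 ω
      · change ∫ x, x ∂(Q.map (Y 0)) = p
        rw [integral_map (h.meas 0).aemeasurable (by fun_prop)]
        exact h.mean_zero
    · filter_upwards [hpl i] with x hx _
      simp only [beliefBefore, ENNReal.toNNReal_coe]
      rw [hbel]
      exact hx
  · intro i A hA B hB
    have hnt : {ω : ℕ → ℝ | (T i : ℝ≥0∞) ≠ ∞} = univ := by simp
    have hb : {x | beliefAt (fun i _ => (T i : ℝ≥0∞)) P i x ∈ B} = {x | Z i x ∈ B} := by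
      ext x; change beliefAt _ P i x ∈ B ↔ Z i x ∈ B; rw [hbel]
    rw [hb, hnt, inter_univ]
    rcases i with _ | i
    · have hle : strictPast (Filtration.natural P hPm) (fun _ => (T 0 : ℝ≥0∞)) ≤ ⊥ := by
        refine MeasurableSpace.generateFrom_le ?_
        rintro _ ⟨s, A, -, rfl⟩
        rw [h.time_zero]
        simp
      change _ = ∫⁻ x in A, (Q.map (Y 0)) B ∂ν
      rcases MeasurableSpace.measurableSet_bot_iff.1 (hle A hA) with rfl | rfl
      · simp
      · rw [univ_inter, Measure.restrict_univ, lintegral_const, measure_univ, mul_one, ← hlaw 0,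
          Measure.map_apply (hZm 0) hB]
        rfl
    · have hle : strictPast (Filtration.natural P hPm) (fun _ => (T (i + 1) : ℝ≥0∞)) ≤
          MeasurableSpace.comap (Preorder.frestrictLe (π := fun _ : ℕ => ℝ) i) inferInstance := by
        refine MeasurableSpace.generateFrom_le ?_
        rintro _ ⟨s, A, hA, rfl⟩
        by_cases hs : s < T (i + 1)
        · have h1 : {x : ℕ → ℝ | (s : ℝ≥0∞) < T (i + 1)} = univ := by simp [hs]
          rw [h1, inter_univ]
          have h2 : Filtration.natural P hPm s ≤
              MeasurableSpace.comap (Preorder.frestrictLe (π := fun _ : ℕ => ℝ) i)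
                inferInstance := by
            refine iSup₂_le fun j hj => ?_
            have hidx : intervalIdx T j ≤ i := by
              have h3 := (intervalIdx_spec h.time_zero h.time_tendsto j).1
              have h4 := h.time_mono.lt_iff_lt.1 (h3.trans_lt (lt_of_le_of_lt hj hs))
              omega
            set m0 := MeasurableSpace.comap (Preorder.frestrictLe (π := fun _ : ℕ => ℝ) i)
                inferInstance with hm0
            have h5 : Measurable[m0] (P j) := by
              have h6 : Measurable fun y : (k : Finset.Iic i) → ℝ =>
                  flow lam π (j - T (intervalIdx T j))
                    (clamp (y ⟨intervalIdx T j, Finset.mem_Iic.2 hidx⟩)) :=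
                ((measurable_flow lam π).comp measurable_prodMk_left).comp
                  (continuous_clamp.measurable.comp (measurable_pi_apply _))
              exact h6.comp (comap_measurable _)
            have h7 := h5.comap_le
            convert h7 using 2
          exact h2 A hA
        · have h1 : {x : ℕ → ℝ | (s : ℝ≥0∞) < T (i + 1)} = ∅ := by
            simp only [ENNReal.coe_lt_coe, hs, ofPred_false]
          rw [h1, inter_empty]
          exact @MeasurableSet.empty _ (MeasurableSpace.comap
            (Preorder.frestrictLe (π := fun _ : ℕ => ℝ) i) inferInstance)
      obtain ⟨A', hA', rfl⟩ := hle A hA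
      have h1 := hνs i A' hA' (clamp ⁻¹' B) (continuous_clamp.measurable hB)
      refine h1.trans (lintegral_congr_ae (ae_restrict_of_ae ?_))
      filter_upwards [hpl i] with x hx
      change κ i (clamp (x i)) (clamp ⁻¹' B) = κ i (clamp (x i)) B
      refine measure_congr ?_
      have h2 : ∀ᵐ y ∂(κ i (clamp (x i))), y ∈ Icc (0 : ℝ) 1 := hx.carried
      filter_upwards [h2] with y hy
      refine propext ?_
      change clamp y ∈ B ↔ y ∈ B
      rw [clamp_of_mem hy]
  · refine ae_of_all _ fun x i t h1 h2 => ?_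
    rw [hbel, ENNReal.toNNReal_coe]
    exact chainPath_of_mem h.time_zero h.time_mono h.time_tendsto (by exact_mod_cast h1)
      (by exact_mod_cast h2) x
  -- The times tend to infinity, so they never accumulate.
  · refine ae_of_all _ fun x S hS => ?_
    obtain ⟨n, hn⟩ := (h.time_tendsto.eventually_gt_atTop S).exists
    have := le_iSup (fun i => (T i : ℝ≥0∞)) n
    rw [hS] at this
    exact absurd (by exact_mod_cast this) (not_le.2 hn)

end beliefChain

end InfoAcq

end

noncomputable section

namespace InfoAcq

/-! ### The value of policies with deterministic acquisition times -/

section costIdentity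
variable {r lam π p : ℝ} {Ω : Type} [MeasurableSpace Ω] {Q : Measure Ω}
  {τ : ℕ → Ω → ℝ≥0∞} {F : ℕ → Ω → Measure ℝ} {P : ℝ≥0 → Ω → ℝ} {b : ℕ → Ω → ℝ}
  {c c₀ g U : ℝ → ℝ≥0∞}

/-- The expected discounted cost of an experiment is the expected increase of certainty. -/
lemma IsPolicy.lintegral_cost_add [IsProbabilityMeasure Q] (h : IsPolicy lam π p Q τ F P)
    (hb : IsDrawn Q τ P b) (hL : LossData r lam π c g U)
    (hlam : 0 < lam) (hπ : π ∈ Ioo (0 : ℝ) 1) (hp : p ∈ Icc (0 : ℝ) 1)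
    (hc : ∀ q ∈ Icc (0 : ℝ) 1, c q = c₀ q) (i : ℕ) :
    ∫⁻ ω, discount r (τ i ω) * (upsCost c₀ (F i ω) + (0 : ℝ≥0)) ∂Q +
        ∫⁻ ω, discount r (τ i ω) * c (meanBefore lam π p τ b i ω) ∂Q =
      ∫⁻ ω, discount r (τ i ω) * c (b i ω) ∂Q := by
  rw [h.lintegral_drawn i (hb.meas i) (hb.eq.mono fun ω hω => hω i) hL.measurable_c
      (w := fun ω => discount r (τ i ω))
      ((measurable_discount r).comp (h.measurable_time_strictPast i))
      (fun ω hω => by simp [hω, discount]),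
    lintegral_congr_ae ((h.cost_eq hb hlam hπ hp hc).mono fun ω hω => hω i),
    ← lintegral_add_left (h.measurable_cost hb hL.measurable_c i)]
  refine lintegral_congr_ae ?_
  filter_upwards [h.plausible_meanBefore hb] with ω hω
  by_cases hfin : τ i ω = ∞
  · simp [hfin, discount]
  · have hF := hω i hfin
    -- Jensen's inequality makes the truncated subtraction in the cost exact, which upgrades the
    -- earlier bound to an equality.
    have hj := hL.jensen _ hF.prob hF.ae_mem
    rw [hF.mean] at hj
    rw [← mul_add, tsub_add_cancel_of_le hj]

end costIdentity

section chainValue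
variable {r lam π p : ℝ} {T : ℕ → ℝ≥0} {Ω : Type} [MeasurableSpace Ω] {Q : Measure Ω}
  {Y : ℕ → Ω → ℝ} {c c₀ g U : ℝ → ℝ≥0∞}

/-- The loss along the drift from `q` during a time `l`. -/
def driftLoss (r lam π : ℝ) (φ : ℝ → ℝ≥0∞) (l q : ℝ) : ℝ≥0∞ :=
  ∫⁻ t in Ioc (0 : ℝ) l, disc r t * φ (drift lam π t q)

lemma measurable_driftLoss {φ : ℝ → ℝ≥0∞} (hφ : Measurable φ) (l : ℝ) :
    Measurable (driftLoss r lam π φ l) := by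
  have h1 : Measurable fun x : ℝ × ℝ => disc r x.2 * φ (drift lam π x.2 x.1) :=
    ((measurable_disc r).comp measurable_snd).mul
      (hφ.comp ((continuous_drift lam π).measurable.comp measurable_swap))
  exact h1.lintegral_prod_right'

/-- With deterministic times the expected loss depends only on the laws of the single `Y i`, which
is why a chain with the same marginal laws can replace the sampled beliefs. -/
lemma lintegral_discLoss_chainPath (hT0 : T 0 = 0) (hTm : StrictMono T)
    (hT : Tendsto T atTop atTop) (hY : ∀ i, Measurable (Y i)) {φ : ℝ → ℝ≥0∞} (hφ : Measurable φ) :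
    ∫⁻ ω, discLoss r φ (fun t => chainPath lam π T Y t.toNNReal ω) ∂Q =
      ∑' i, disc r (T i) * ∫⁻ y, driftLoss r lam π φ (T (i + 1) - T i) y ∂(Q.map (Y i)) := by
  simp_rw [discLoss_chainPath hT0 hTm hT hφ]
  change ∫⁻ ω, ∑' i, disc r (T i) * driftLoss r lam π φ (T (i + 1) - T i) (Y i ω) ∂Q = _
  have hm := fun i => measurable_driftLoss (r := r) (lam := lam) (π := π) hφ ((T (i + 1) : ℝ) - T i)
  have hmY : ∀ i, Measurable fun ω =>
      disc r (T i) * driftLoss r lam π φ (T (i + 1) - T i) (Y i ω) := fun i =>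
    ((hm i).comp (hY i)).const_mul _
  rw [lintegral_tsum fun i => (hmY i).aemeasurable]
  refine tsum_congr fun i => ?_
  rw [lintegral_map (hm i) (hY i), lintegral_const_mul' _ _ (disc_ne_top _ _)]

variable [IsProbabilityMeasure Q]

/-- A belief chain whose beliefs keep bounded certainty is feasible at the net value of its
virtual losses. -/
theorem IsBeliefChain.le_netValue (h : IsBeliefChain lam π p Q T Y) (hL : LossData r lam π c g U)
    (hr : 0 < r) (hlam : 0 < lam) (hπ : π ∈ Ioo (0 : ℝ) 1) (hp : p ∈ Icc (0 : ℝ) 1)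
    (hc : ∀ q ∈ Icc (0 : ℝ) 1, c q = c₀ q) {u : ℝ → ℝ} {M : ℝ≥0}
    (hu : ∀ q ∈ Icc (0 : ℝ) 1, u q ≤ M ∧ U q = ENNReal.ofReal (M - u q)) {C : ℝ≥0}
    (hC : ∀ i ω, c (flow lam π (T (i + 1) - T i) (Y i ω)) ≤ C) :
    ((M / r : ℝ) : EReal) -
        ((∫⁻ ω, discLoss r g (fun t => chainPath lam π T Y t.toNNReal ω) ∂Q : ℝ≥0∞) : EReal) ≤
      netValue r lam π 0 u c₀ p ∧
    ∫⁻ ω, c (Y 0 ω) ∂Q ≤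
      ∫⁻ ω, discLoss r g (fun t => chainPath lam π T Y t.toNNReal ω) ∂Q := by
  obtain ⟨ν, Z, F, hν, hZm, hlaw, hpol⟩ := h.exists_policy hlam hπ
  have hmem : ∀ i x, chainPath lam π T Z (T i) x = Z i x :=
    chainPath_jump h.time_zero h.time_mono h.time_tendsto
  set τ : ℕ → (ℕ → ℝ) → ℝ≥0∞ := fun i _ => T i with hτ
  have hb : IsDrawn ν τ (chainPath lam π T Z) Z :=
    ⟨hZm, fun i x => hmem i x ▸ hpol.mem (T i) x, ae_of_all _ fun x i _ => by
      rw [beliefAt, hτ, ENNReal.toNNReal_coe, hmem]⟩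
  have htrans : ∀ (φ : ℝ → ℝ≥0∞), Measurable φ → ∀ i,
      ∫⁻ x, φ (Z i x) ∂ν = ∫⁻ ω, φ (Y i ω) ∂Q := fun φ hφ i => by
    rw [← lintegral_map hφ (hZm i), hlaw i, lintegral_map hφ (h.meas i)]
  set κ : ℕ → ℝ≥0∞ := fun i =>
    ∫⁻ x, discount r (τ i x) * (upsCost c₀ (F i x) + (0 : ℝ≥0)) ∂ν with hκ
  set D : ℕ → ℝ≥0∞ := fun i =>
    ∫⁻ x, discount r (τ i x) * c (meanBefore lam π p τ Z i x) ∂ν with hD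
  -- `κ i` is the expected discounted cost at the `i`-th acquisition, `D i` the certainty just
  -- before it, and `V φ i` the expected `φ`-loss until the next one.
  set V : (ℝ → ℝ≥0∞) → ℕ → ℝ≥0∞ := fun φ i =>
    disc r (T i) * ∫⁻ y, driftLoss r lam π φ (T (i + 1) - T i) y ∂(Q.map (Y i)) with hV
  have hE : ∀ i, κ i + D i = disc r (T i) * ∫⁻ ω, c (Y i ω) ∂Q := fun i => by
    rw [hκ, hD]
    simp only
    rw [hpol.lintegral_cost_add hb hL hlam hπ hp hc i]
    simp only [hτ, discount_coe]
    rw [lintegral_const_mul' _ _ (disc_ne_top _ _), htrans c hL.measurable_c]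
  have hD0 : D 0 = c p := by
    simp [hD, meanBefore, hτ, h.time_zero, discount]
  have hDs : ∀ i, D (i + 1) =
      disc r (T (i + 1)) * ∫⁻ ω, c (flow lam π (T (i + 1) - T i) (Y i ω)) ∂Q := fun i => by
    have hm : Measurable fun y => c (flow lam π (T (i + 1) - T i) y) :=
      hL.measurable_c.comp ((measurable_flow lam π).comp measurable_prodMk_left)
    simp only [hD, hτ, discount_coe, meanBefore, ENNReal.toNNReal_coe]
    rw [lintegral_const_mul' _ _ (disc_ne_top _ _), ← htrans _ hm]
  have hdyn : ∀ i, V g i + D (i + 1) = disc r (T i) * ∫⁻ ω, c (Y i ω) ∂Q + V U i := fun i => by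
    have hle : T i ≤ T (i + 1) := h.time_mono.monotone (Nat.le_succ i)
    have hm : ∀ φ : ℝ → ℝ≥0∞, Measurable φ →
        Measurable (driftLoss r lam π φ (T (i + 1) - T i)) := fun φ hφ => measurable_driftLoss hφ _
    have hd : disc r (T (i + 1)) = disc r (T i) * disc r (T (i + 1) - T i) := by
      rw [← disc_add, add_sub_cancel]
    have hm1 : Measurable fun ω => driftLoss r lam π g (T (i + 1) - T i) (Y i ω) :=
      (hm g hL.measurable_g).comp (h.meas i)
    have hm2 : Measurable fun ω => c (Y i ω) := hL.measurable_c.comp (h.meas i)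
    rw [hDs, hV]
    simp only
    rw [lintegral_map (hm g hL.measurable_g) (h.meas i), lintegral_map (hm U hL.measurable_U)
      (h.meas i), hd, mul_assoc, ← mul_add, ← mul_add,
      ← lintegral_const_mul' _ _ (disc_ne_top _ _),
      ← lintegral_add_left hm1, ← lintegral_add_left hm2]
    congr 1
    refine lintegral_congr fun ω => ?_
    have := hL.dynkin (Y i ω) (h.mem i ω) (T (i + 1) - T i) (by
      rw [sub_nonneg]; exact_mod_cast hle)
    rw [flow_eq_drift, NNReal.coe_sub hle]
    exact this
  -- Telescoping: `hE` passes through an acquisition, `hdyn` through the drift that follows it.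
  have hsum : ∀ n, c p + ∑ i ∈ Finset.range n, κ i + ∑ i ∈ Finset.range n, V U i =
      ∑ i ∈ Finset.range n, V g i + D n := by
    intro n
    induction n with
    | zero => simp [hD0]
    | succ n ih =>
      rw [Finset.sum_range_succ, Finset.sum_range_succ, Finset.sum_range_succ]
      calc _ = (c p + ∑ i ∈ Finset.range n, κ i + ∑ i ∈ Finset.range n, V U i) +
            (κ n + V U n) := by ring
        _ = ∑ i ∈ Finset.range n, V g i + ((κ n + D n) + V U n) := by rw [ih]; ring
        _ = _ := by rw [hE, ← hdyn, add_assoc]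
  -- This is where the bound `C` enters: discounting kills the last certainty of the telescoped sum.
  have hDlim : Tendsto D atTop (𝓝 0) := by
    rw [← tendsto_add_atTop_iff_nat 1]
    have h1 : Tendsto (fun i => disc r (T (i + 1)) * C) atTop (𝓝 0) := by
      have h2 : Tendsto (fun i => (T (i + 1) : ℝ)) atTop atTop :=
        NNReal.tendsto_coe_atTop.2 ((tendsto_add_atTop_iff_nat 1).2 h.time_tendsto)
      simpa using ENNReal.Tendsto.mul_const ((tendsto_disc_atTop hr).comp h2)
        (Or.inr (ENNReal.coe_ne_top (r := C)))
    refine tendsto_of_tendsto_of_tendsto_of_le_of_le tendsto_const_nhds h1 (fun _ => zero_le)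
      fun i => ?_
    simp only
    rw [hDs]
    gcongr
    refine (lintegral_mono (hC i)).trans ?_
    simp
  have hident : c p + ∑' i, κ i + ∑' i, V U i = ∑' i, V g i := by
    have h1 := ((tendsto_const_nhds (x := c p)).add (ENNReal.tendsto_nat_tsum κ)).add
      (ENNReal.tendsto_nat_tsum (V U))
    have h2 := (ENNReal.tendsto_nat_tsum (V g)).add hDlim
    rw [add_zero] at h2
    exact tendsto_nhds_unique h1 (h2.congr fun n => (hsum n).symm)
  have hg : ∫⁻ ω, discLoss r g (fun t => chainPath lam π T Y t.toNNReal ω) ∂Q = ∑' i, V g i :=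
    lintegral_discLoss_chainPath h.time_zero h.time_mono h.time_tendsto h.meas hL.measurable_g
  have hUν : ∫⁻ x, discLoss r U (fun t => chainPath lam π T Z t.toNNReal x) ∂ν =
      ∑' i, V U i := by
    rw [lintegral_discLoss_chainPath h.time_zero h.time_mono h.time_tendsto hZm hL.measurable_U]
    simp only [hlaw, hV]
  rw [hg, ← hident]
  constructor
  · have h1 : ((M / r : ℝ) : EReal) - ((∑' i, V U i + ∑' i, κ i : ℝ≥0∞) : EReal) ≤
        value r lam π 0 u c₀ p := by
      rw [← hUν, ← hpol.policyPayoff_eq hL hr hlam hπ hp hc hu]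
      exact le_sSup ⟨_, _, ν, τ, F, _, hν, hpol, rfl⟩
    rw [netValue, show c p + ∑' i, κ i + ∑' i, V U i = (∑' i, V U i + ∑' i, κ i) + c p by ring,
      coe_sub_add_eq, hc p hp]
    exact EReal.sub_le_sub h1 le_rfl
  -- The expected certainty after the first draw is `c p` plus the first cost, two of the
  -- nonnegative terms in `hident`.
  · have h1 := hE 0
    rw [h.time_zero, NNReal.coe_zero, disc_zero, one_mul, hD0] at h1
    rw [← h1, add_comm (κ 0)]
    exact le_add_right (add_le_add le_rfl (ENNReal.le_tsum 0))

end chainValue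

end InfoAcq

end

noncomputable section

namespace InfoAcq

/-! ### Discretization of belief processes -/

section discretization
variable {r lam π p : ℝ} {c g U : ℝ → ℝ≥0∞} {Ω : Type}

/-- The first jump occurs at time `a + 1 / (n + 1)`, and then jumps are spaced by `1 / (n + 1)`. -/
def gridTime (a : ℝ≥0) (n : ℕ) : ℕ → ℝ≥0
  | 0 => 0
  | i + 1 => a + (i + 1 : ℕ) / (n + 1 : ℝ≥0)

/-- The beliefs of `P` at the points of a grid, after a further drift during `σ` for the first one
and during `σ + a` for the other ones. -/
def gridBelief (lam π : ℝ) (σ a : ℝ≥0) (P : ℝ≥0 → Ω → ℝ) (n : ℕ) : ℕ → Ω → ℝ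
  | 0, ω => flow lam π σ (P 0 ω)
  | i + 1, ω => flow lam π (σ + a) (P ((i + 1 : ℕ) / (n + 1 : ℝ≥0)) ω)

lemma gridTime_succ_sub (a : ℝ≥0) (n i : ℕ) :
    gridTime a n (i + 1) - gridTime a n i =
      (if i = 0 then a else 0) + 1 / (n + 1 : ℝ≥0) := by
  cases i with
  | zero => simp [gridTime]
  | succ i =>
    rw [gridTime, gridTime, if_neg (Nat.succ_ne_zero i), zero_add, add_tsub_add_eq_tsub_left,
      show ((i + 1 + 1 : ℕ) : ℝ≥0) / (n + 1) = ((i + 1 : ℕ) : ℝ≥0) / (n + 1) + 1 / (n + 1) by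
        push_cast; rw [add_div _ 1], add_tsub_cancel_left]

lemma gridTime_strictMono (a : ℝ≥0) (n : ℕ) : StrictMono (gridTime a n) := by
  refine strictMono_nat_of_lt_succ fun i => ?_
  have h : 0 < gridTime a n (i + 1) - gridTime a n i := by
    rw [gridTime_succ_sub]; positivity
  exact tsub_pos_iff_lt.1 h

lemma gridTime_tendsto (a : ℝ≥0) (n : ℕ) : Tendsto (gridTime a n) atTop atTop := by
  rw [← tendsto_add_atTop_iff_nat 1]
  refine tendsto_atTop_mono (f := fun i : ℕ => ((i + 1 : ℕ) : ℝ≥0) / (n + 1 : ℝ≥0))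
    (fun i => le_add_of_nonneg_left zero_le) ?_
  exact (tendsto_natCast_atTop_atTop.comp (tendsto_add_atTop_nat 1)).atTop_div_const
    (by positivity)

/-- The belief that the grid of mesh `1 / (n + 1)` substitutes for `flow s (P t)`. -/
def gridPath (lam π : ℝ) (s : ℝ≥0) (P : ℝ≥0 → Ω → ℝ) (n : ℕ) (t : ℝ) (ω : Ω) : ℝ :=
  flow lam π (s + (t.toNNReal + 1 / (n + 1 : ℝ≥0) - gridAbove n t.toNNReal))
    (P (gridAbove n t.toNNReal) ω)

/-- After the initial stretch `a + 1 / (n + 1)`, the extra delay of one mesh makes the chain use,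
for time `t`, the value of `P` at a grid point strictly above `t`. Right continuity of `P` then
suffices for convergence. -/
lemma gridPath_eq (σ a : ℝ≥0) (n : ℕ) {P : ℝ≥0 → Ω → ℝ} {t : ℝ} (ht : 0 ≤ t) (ω : Ω) :
    chainPath lam π (gridTime a n) (gridBelief lam π σ a P n)
        (((a + 1 / (n + 1 : ℝ≥0) : ℝ≥0) : ℝ) + t).toNNReal ω =
      gridPath lam π (σ + a) P n t ω := by
  set x := t.toNNReal
  have hx : (((a + 1 / (n + 1 : ℝ≥0) : ℝ≥0) : ℝ) + t).toNNReal = a + (1 / (n + 1 : ℝ≥0) + x) := by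
    rw [Real.toNNReal_add (NNReal.coe_nonneg _) ht, Real.toNNReal_coe, add_assoc]
  set k := ⌊(n + 1 : ℝ≥0) * x⌋₊
  have hk : gridTime a n (k + 1) = a + gridAbove n x := rfl
  rw [hx, chainPath_of_mem (i := k + 1) rfl (gridTime_strictMono a n) (gridTime_tendsto a n), hk,
    add_tsub_add_eq_tsub_left, gridPath, flow_add lam π (σ + a), add_comm (1 / _)]
  · rfl
  · rw [hk]
    gcongr
    rw [gridAbove, Nat.cast_add, Nat.cast_one, add_div, add_comm]
    gcongr
    rw [div_le_iff₀ (by positivity), mul_comm]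
    exact Nat.floor_le zero_le
  · rw [gridTime]
    gcongr
    have := lt_gridAbove n x
    rw [gridAbove] at this
    rw [Nat.cast_add _ 1, Nat.cast_one, add_div, add_comm]
    gcongr

/-- Drifting commutes with taking conditional expectations. -/
lemma condExp_flow_comp {m mΩ : MeasurableSpace Ω} (hm : m ≤ mΩ) {Q : Measure Ω}
    [IsProbabilityMeasure Q] {X : Ω → ℝ} (hX : Integrable X Q) (b : ℝ≥0) :
    Q[fun ω => flow lam π b (X ω) | m] =ᵐ[Q] fun ω => flow lam π b (Q[X | m] ω) := by
  set E := Real.exp (-lam * b)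
  have h1 := condExp_add (hX.smul E) (integrable_const ((1 - E) * π)) m
  have h2 := condExp_smul E X m (μ := Q)
  have h3 := condExp_const (μ := Q) hm ((1 - E) * π)
  filter_upwards [h1, h2] with ω e1 e2
  refine e1.trans ?_
  rw [Pi.add_apply, e2, h3, Pi.smul_apply, smul_eq_mul]
  rfl

variable [MeasurableSpace Ω] {Q : Measure Ω} [IsProbabilityMeasure Q] {P : ℝ≥0 → Ω → ℝ}

lemma measurable_flow_left (lam π : ℝ) (s : ℝ≥0) : Measurable (flow lam π s) :=
  (measurable_flow lam π).comp measurable_prodMk_left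

/-- The conditional expectation of a drifted future belief given a drifted present belief. -/
lemma IsBeliefProcess.condExp_flow (h : IsBeliefProcess lam π p Q P)
    {a b d e : ℝ≥0} (hade : a + e = d + b) (t : ℝ≥0) :
    Q[fun ω => flow lam π b (P (t + d) ω) |
        MeasurableSpace.comap (fun ω => flow lam π a (P t ω)) inferInstance] =ᵐ[Q]
      fun ω => flow lam π e (flow lam π a (P t ω)) := by
  -- The drift is injective, so conditioning on a drifted belief is the same as conditioning on the
  -- belief.
  have hinj : Function.Injective (flow lam π a) := fun x y hxy => by
    simp only [flow] at hxy
    exact mul_left_cancel₀ (Real.exp_pos _).ne' (add_right_cancel hxy)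
  have hcomap : MeasurableSpace.comap (fun ω => flow lam π a (P t ω)) inferInstance =
      MeasurableSpace.comap (P t) (inferInstance : MeasurableSpace ℝ) := by
    rw [show (fun ω => flow lam π a (P t ω)) = flow lam π a ∘ P t from rfl,
      ← MeasurableSpace.comap_comp,
      ((measurable_flow_left lam π a).measurableEmbedding hinj).comap_eq]
  rw [hcomap]
  have hint : Integrable (P (t + d)) Q := integrable_of_mem_Icc (h.meas _) (h.mem _)
  filter_upwards [condExp_flow_comp (lam := lam) (π := π) (h.meas t).comap_le hint b, h.drift t d]
    with ω e1 e2
  refine e1.trans ?_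
  refine (congrArg (flow lam π b) e2).trans ?_
  rw [← flow_add, ← hade, flow_add]

/-- Drifts compose and commute with conditional expectation. The first gap of `gridTime` is longer
by `a` precisely to account for the additional drift `a` of all beliefs but the first. -/
lemma IsBeliefProcess.isBeliefChain (h : IsBeliefProcess lam π p Q P) (hlam : 0 < lam)
    (hπ : π ∈ Ioo (0 : ℝ) 1) (σ a : ℝ≥0) (n : ℕ) :
    IsBeliefChain (Ω := Ω) lam π (flow lam π σ p) Q (gridTime a n) (gridBelief lam π σ a P n) := by
  have hm : ∀ s t, Measurable fun ω => flow lam π s (P t ω) := fun s t =>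
    (measurable_flow_left lam π s).comp (h.meas t)
  refine ⟨rfl, gridTime_strictMono a n, gridTime_tendsto a n, fun i => ?_, fun i ω => ?_, ?_,
    fun i => ?_⟩
  · cases i <;> exact hm _ _
  · cases i <;> exact flow_mem_Icc hlam hπ _ (h.mem _ _)
  · have hint : Integrable (P 0) Q := integrable_of_mem_Icc (h.meas _) (h.mem _)
    simp only [gridBelief, flow]
    rw [integral_add (hint.const_mul _) (integrable_const _), integral_const_mul, h.mean_zero]
    simp
  · rw [gridTime_succ_sub]
    cases i with
    | zero =>
      have := h.condExp_flow (a := σ) (b := σ + a) (d := ((0 + 1 : ℕ) : ℝ≥0) / (n + 1 : ℝ≥0))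
        (e := a + 1 / (n + 1 : ℝ≥0)) (by
          rw [zero_add, Nat.cast_one]; ring) 0
      rw [zero_add] at this
      exact this
    | succ i =>
      have := h.condExp_flow (a := σ + a) (b := σ + a) (d := 1 / (n + 1 : ℝ≥0))
        (e := 1 / (n + 1 : ℝ≥0)) (add_comm _ _) (((i + 1 : ℕ) : ℝ≥0) / (n + 1 : ℝ≥0))
      rw [show ((i + 1 : ℕ) : ℝ≥0) / (n + 1) + 1 / (n + 1) = ((i + 1 + 1 : ℕ) : ℝ≥0) / (n + 1) by
        rw [← add_div, ← Nat.cast_add_one]] at this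
      rw [if_neg (Nat.succ_ne_zero i), zero_add]
      exact this

lemma measurable_gridBelief (h : ∀ t, Measurable (P t)) (σ a : ℝ≥0) (n i : ℕ) :
    Measurable (gridBelief lam π σ a P n i) := by
  cases i <;> exact (measurable_flow_left lam π _).comp (h _)

lemma measurable_chainPath_path {T : ℕ → ℝ≥0} (hT0 : T 0 = 0) (hTm : StrictMono T)
    (hT : Tendsto T atTop atTop) {Y : ℕ → Ω → ℝ} (hY : ∀ i, Measurable (Y i)) (ω : Ω) :
    Measurable fun t : ℝ => chainPath lam π T Y t.toNNReal ω :=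
  ((measurable_chainPath hT0 hTm hT hY).comp
    (measurable_prodMk_right (y := ω))).comp measurable_real_toNNReal

/-- The path drifts from its first belief until `a + 1 / (n + 1)`; for the remaining loss the
discount accumulated by then is at most `1` and is dropped. -/
lemma discLoss_gridPath_le (hP : ∀ t, Measurable (P t)) (hr : 0 < r) (σ a : ℝ≥0) (n : ℕ)
    (hg : Measurable g) (ω : Ω) :
    discLoss r g (fun t => chainPath lam π (gridTime a n) (gridBelief lam π σ a P n) t.toNNReal ω) ≤
      driftLoss r lam π g (a + 1 / (n + 1)) (flow lam π σ (P 0 ω)) +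
        discLoss r g fun t => gridPath lam π (σ + a) P n t ω := by
  set l : ℝ≥0 := a + 1 / (n + 1 : ℝ≥0) with hl
  have hl' : (l : ℝ) = a + 1 / (n + 1) := by rw [hl]; push_cast; rfl
  have h1 : gridTime a n 1 = l := by simp [gridTime, hl]
  have hm : Measurable fun t : ℝ =>
      chainPath lam π (gridTime a n) (gridBelief lam π σ a P n) t.toNNReal ω := by
    exact measurable_chainPath_path rfl (gridTime_strictMono a n) (gridTime_tendsto a n)
      (measurable_gridBelief hP σ a n) ω
  have hsplit := discLoss_split (r := r) hg hm l.coe_nonneg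
  rw [hsplit]
  refine add_le_add (le_of_eq ?_) ?_
  · rw [driftLoss, ← hl', ← setLIntegral_congr Ico_ae_eq_Ioc, ← setLIntegral_congr Ico_ae_eq_Ioc]
    refine setLIntegral_congr_fun measurableSet_Ico fun t ht => ?_
    have h2 : t.toNNReal < gridTime a n 1 := by
      rw [h1, Real.toNNReal_lt_iff_lt_coe ht.1]; exact ht.2
    rw [chainPath_of_mem (i := 0) rfl (gridTime_strictMono a n) (gridTime_tendsto a n) zero_le h2,
      gridTime, tsub_zero, gridBelief, flow_eq_drift, Real.coe_toNNReal t ht.1]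
  · refine (mul_le_of_le_one_left zero_le (disc_le_one hr l.coe_nonneg)).trans (le_of_eq ?_)
    refine setLIntegral_congr_fun measurableSet_Ioi fun t ht => ?_
    beta_reduce
    rw [hl, gridPath_eq σ a n (le_of_lt ht)]

end discretization

end InfoAcq

end

noncomputable section

namespace InfoAcq

/-! ### Approximation of belief processes by belief chains -/

section limits
variable {r lam π p : ℝ} {c c₀ g U φ : ℝ → ℝ≥0∞} {Ω : Type}

/-- A function that is finite inside `(0, 1)` is bounded after some drift. -/
lemma exists_bound_drift (hlam : 0 < lam) (hπ : π ∈ Ioo (0 : ℝ) 1) (hφ : Continuous φ)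
    (hfin : ∀ q ∈ Ioo (0 : ℝ) 1, φ q ≠ ∞) {s : ℝ} (hs : 0 < s) :
    ∃ B : ℝ≥0, ∀ q ∈ Icc (0 : ℝ) 1, ∀ t, s ≤ t → φ (drift lam π t q) ≤ B := by
  obtain ⟨x, hx, hmax⟩ := (isCompact_Icc (a := drift lam π s 0) (b := drift lam π s 1)).exists_isMaxOn
    ⟨_, drift_mem_of_le hlam hπ le_rfl (left_mem_Icc.2 zero_le_one)⟩ hφ.continuousOn
  refine ⟨(φ x).toNNReal, fun q hq t hst => ?_⟩
  rw [ENNReal.coe_toNNReal (hfin x (Icc_drift_subset hlam hπ hs hx))]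
  exact hmax (drift_mem_of_le hlam hπ hst hq)

lemma driftLoss_le {B : ℝ≥0} (hr : 0 < r) {l q : ℝ}
    (hB : ∀ t, 0 < t → φ (drift lam π t q) ≤ B) :
    driftLoss r lam π φ l q ≤ B * ENNReal.ofReal l := by
  calc driftLoss r lam π φ l q ≤ ∫⁻ _ in Ioc (0 : ℝ) l, B :=
        setLIntegral_mono measurable_const fun t ht =>
          (mul_le_of_le_one_left zero_le (disc_le_one hr ht.1.le)).trans (hB t ht.1)
    _ = B * ENNReal.ofReal l := by simp

lemma driftLoss_mono {l l' : ℝ} (h : l ≤ l') (q : ℝ) :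
    driftLoss r lam π φ l q ≤ driftLoss r lam π φ l' q :=
  lintegral_mono_set (Ioc_subset_Ioc_right h)

variable [MeasurableSpace Ω] {Q : Measure Ω} {P : ℝ≥0 → Ω → ℝ}

lemma IsBeliefProcess.measurable_uncurry (h : IsBeliefProcess lam π p Q P) :
    Measurable fun z : Ω × ℝ => P z.2.toNNReal z.1 :=
  (measurable_uncurry_of_rightCont h.meas h.rightCont).comp
    ((measurable_real_toNNReal.comp measurable_snd).prodMk measurable_fst)

lemma measurable_gridPath (h : ∀ t, Measurable (P t)) (s : ℝ≥0) (n : ℕ) :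
    Measurable fun z : Ω × ℝ => gridPath lam π s P n z.2 z.1 := by
  have h1 : Measurable fun z : Ω × ℝ => z.2.toNNReal := measurable_real_toNNReal.comp measurable_snd
  have h2 := measurable_gridAbove h n h1 measurable_fst
  have h3 : Measurable fun z : Ω × ℝ => gridAbove n z.2.toNNReal := by
    have h4 : Measurable fun k : ℕ => ((k + 1 : ℕ) : ℝ≥0) / (n + 1 : ℝ≥0) :=
      measurable_of_countable _
    exact h4.comp (Nat.measurable_floor.comp (h1.const_mul _))
  exact (measurable_flow lam π).comp
    ((measurable_const.add ((h1.add measurable_const).sub h3)).prodMk h2)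

lemma continuous_flow (lam π : ℝ) : Continuous fun x : ℝ≥0 × ℝ => flow lam π x.1 x.2 := by
  unfold flow; fun_prop

lemma IsBeliefProcess.tendsto_gridPath (h : IsBeliefProcess lam π p Q P) (s : ℝ≥0) (t : ℝ) (ω : Ω) :
    Tendsto (fun n => gridPath lam π s P n t ω) atTop (𝓝 (flow lam π s (P t.toNNReal ω))) := by
  set x := t.toNNReal
  have h1 := tendsto_gridAbove x
  have h2 : Tendsto (fun n : ℕ => s + (x + 1 / ((n : ℝ≥0) + 1) - gridAbove n x)) atTop (𝓝 s) := by
    have h3 := tendsto_const_nhds (x := s).add (((tendsto_const_nhds (x := x)).add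
      (tendsto_one_div_add_atTop_nhds_zero_nat (𝕜 := ℝ≥0))).sub
        (h1.mono_right nhdsWithin_le_nhds))
    simpa using h3
  have h4 : Tendsto (fun n => P (gridAbove n x) ω) atTop (𝓝 (P x ω)) :=
    (h.rightCont ω x).tendsto.comp (h1.mono_right (nhdsWithin_mono _ Ioi_subset_Ici_self))
  have h5 := ((continuous_flow lam π).tendsto (s, P x ω)).comp (h2.prodMk_nhds h4)
  simp only [Function.comp_def] at h5
  exact h5

/-- Dominated convergence for expected discounted losses. -/
lemma tendsto_lintegral_discLoss (hφ : Continuous φ) {X : ℕ → Ω × ℝ → ℝ} {X' : Ω × ℝ → ℝ}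
    (hX : ∀ n, Measurable (X n)) (hX' : Measurable X') {G : Ω × ℝ → ℝ≥0∞} (hG : Measurable G)
    (hfin : ∫⁻ ω, (∫⁻ t in Ioi (0 : ℝ), disc r t * G (ω, t)) ∂Q ≠ ∞)
    (hle : ∀ n z, φ (X n z) ≤ G z)
    (hlim : ∀ ω, ∀ t : ℝ, 0 < t → Tendsto (fun n => X n (ω, t)) atTop (𝓝 (X' (ω, t)))) :
    Tendsto (fun n => ∫⁻ ω, discLoss r φ (fun t => X n (ω, t)) ∂Q) atTop
      (𝓝 (∫⁻ ω, discLoss r φ (fun t => X' (ω, t)) ∂Q)) := by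
  have hd : Measurable fun z : Ω × ℝ => disc r z.2 := (measurable_disc r).comp measurable_snd
  have hprod : ∀ H : Ω × ℝ → ℝ≥0∞, Measurable H →
      ∫⁻ ω, (∫⁻ t in Ioi (0 : ℝ), disc r t * H (ω, t)) ∂Q =
        ∫⁻ z, disc r z.2 * H z ∂(Q.prod (volume.restrict (Ioi (0 : ℝ)))) := fun H hH =>
    (lintegral_prod (fun z : Ω × ℝ => disc r z.2 * H z) (hd.mul hH).aemeasurable).symm
  simp only [discLoss]
  rw [hprod G hG] at hfin
  rw [hprod (fun z => φ (X' z)) (hφ.measurable.comp hX')]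
  simp_rw [fun n => hprod (fun z => φ (X n z)) (hφ.measurable.comp (hX n))]
  have hpos : ∀ᵐ z ∂(Q.prod (volume.restrict (Ioi (0 : ℝ)))), z.2 ∈ Ioi (0 : ℝ) :=
    Measure.quasiMeasurePreserving_snd.ae (ae_restrict_mem measurableSet_Ioi)
  refine tendsto_lintegral_of_dominated_convergence (fun z => disc r z.2 * G z)
    (fun n => hd.mul (hφ.measurable.comp (hX n)))
    (fun n => ae_of_all _ fun z => mul_le_mul_right (hle n z) _) hfin ?_
  filter_upwards [hpos] with z hz
  exact ENNReal.Tendsto.const_mul ((hφ.tendsto _).comp (hlim z.1 z.2 hz))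
    (Or.inr (disc_ne_top _ _))

variable [IsProbabilityMeasure Q]

lemma lintegral_disc_mul_const (hr : 0 < r) (B : ℝ≥0∞) :
    ∫⁻ _, (∫⁻ t in Ioi (0 : ℝ), disc r t * B) ∂Q = ENNReal.ofReal (1 / r) * B := by
  rw [lintegral_const, measure_univ, mul_one, lintegral_mul_const _ (measurable_disc r),
    lintegral_disc hr]

/-- The losses of the discretizations converge to those of the drifted process. -/
lemma IsBeliefProcess.tendsto_lintegral_gridPath (h : IsBeliefProcess lam π p Q P)
    (hL : LossData r lam π c g U) (hr : 0 < r) (hlam : 0 < lam) (hπ : π ∈ Ioo (0 : ℝ) 1)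
    {s : ℝ≥0} (hs : 0 < s) :
    Tendsto (fun n => ∫⁻ ω, discLoss r g (fun t => gridPath lam π s P n t ω) ∂Q) atTop
      (𝓝 (∫⁻ ω, discLoss r g (fun t => flow lam π s (P t.toNNReal ω)) ∂Q)) := by
  -- A positive extra drift keeps all beliefs in a compact part of `(0, 1)`, so a constant
  -- dominates.
  obtain ⟨B, hB⟩ := exists_bound_drift hlam hπ hL.cont_g hL.g_ne_top (NNReal.coe_pos.2 hs)
  refine tendsto_lintegral_discLoss hL.cont_g (X := fun n z => gridPath lam π s P n z.2 z.1)
    (X' := fun z => flow lam π s (P z.2.toNNReal z.1)) (measurable_gridPath h.meas s)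
    ((measurable_flow_left lam π s).comp h.measurable_uncurry) (G := fun _ => B)
    measurable_const ?_ (fun n z => hB _ (h.mem _ _) _ ?_) fun ω t _ => h.tendsto_gridPath s t ω
  · rw [lintegral_disc_mul_const hr]
    finiteness
  · exact_mod_cast le_add_of_nonneg_right zero_le

/-- The losses of slightly drifted processes converge to those of the process. -/
lemma IsBeliefProcess.tendsto_lintegral_flow (h : IsBeliefProcess lam π p Q P)
    (hL : LossData r lam π c g U) (hr : 0 < r)
    (hfin : ∫⁻ ω, discLoss r g (fun t => P t.toNNReal ω) ∂Q ≠ ∞) {s : ℕ → ℝ≥0}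
    (hs : Tendsto s atTop (𝓝 0)) :
    Tendsto (fun m => ∫⁻ ω, discLoss r g (fun t => flow lam π (s m) (P t.toNNReal ω)) ∂Q) atTop
      (𝓝 (∫⁻ ω, discLoss r g (fun t => P t.toNNReal ω) ∂Q)) := by
  obtain ⟨C, hC⟩ := hL.dominated
  have hPm := h.measurable_uncurry
  refine tendsto_lintegral_discLoss hL.cont_g
    (X := fun m z => flow lam π (s m) (P z.2.toNNReal z.1)) (X' := fun z => P z.2.toNNReal z.1)
    (fun m => (measurable_flow_left lam π _).comp hPm) hPm
    (G := fun z => g (P z.2.toNNReal z.1) + C) ((hL.measurable_g.comp hPm).add_const _) ?_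
    (fun m z => hC _ (h.mem _ _) _ (s m).coe_nonneg) fun ω t _ => ?_
  · simp only [mul_add]
    have hm : Measurable fun z : Ω × ℝ => disc r z.2 * (C : ℝ≥0∞) :=
      ((measurable_disc r).comp measurable_snd).mul_const _
    have h1 : ∀ ω, ∫⁻ t in Ioi (0 : ℝ), (disc r t * g (P t.toNNReal ω) + disc r t * C) =
        discLoss r g (fun t => P t.toNNReal ω) + ∫⁻ t in Ioi (0 : ℝ), disc r t * C := fun ω =>
      lintegral_add_right _ (hm.comp (measurable_prodMk_left (x := ω)))
    simp_rw [h1]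
    rw [lintegral_add_right _ measurable_const, lintegral_disc_mul_const hr]
    finiteness
  · have := ((continuous_flow lam π).tendsto (0, P t.toNNReal ω)).comp
      (hs.prodMk_nhds tendsto_const_nhds)
    rwa [flow_zero] at this

end limits

end InfoAcq

end

noncomputable section

namespace InfoAcq

/-! ### Belief processes are dominated by policies -/

section lowerBound
variable {r lam π p : ℝ} {c c₀ g U φ : ℝ → ℝ≥0∞} {u : ℝ → ℝ} {M : ℝ≥0} {Ω : Type}
  [MeasurableSpace Ω] {Q : Measure Ω} [IsProbabilityMeasure Q] {P : ℝ≥0 → Ω → ℝ}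

/-- The net value dominates the discretizations of a belief process. -/
lemma IsBeliefProcess.grid_le_netValue (h : IsBeliefProcess lam π p Q P)
    (hL : LossData r lam π c g U) (hr : 0 < r) (hlam : 0 < lam) (hπ : π ∈ Ioo (0 : ℝ) 1)
    (hp : p ∈ Icc (0 : ℝ) 1) (hc : ∀ q ∈ Icc (0 : ℝ) 1, c q = c₀ q)
    (hu : ∀ q ∈ Icc (0 : ℝ) 1, u q ≤ M ∧ U q = ENNReal.ofReal (M - u q)) (σ a : ℝ≥0) (n : ℕ) :
    ((M / r : ℝ) : EReal) -
        ((∫⁻ ω, driftLoss r lam π g (a + 1 / (n + 1)) (flow lam π σ (P 0 ω)) ∂Q +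
          ∫⁻ ω, discLoss r g (fun t => gridPath lam π (σ + a) P n t ω) ∂Q : ℝ≥0∞) : EReal) ≤
      netValue r lam π 0 u c₀ (flow lam π σ p) ∧
    ∫⁻ ω, c (flow lam π σ (P 0 ω)) ∂Q ≤
      ∫⁻ ω, driftLoss r lam π g (a + 1 / (n + 1)) (flow lam π σ (P 0 ω)) ∂Q +
          ∫⁻ ω, discLoss r g (fun t => gridPath lam π (σ + a) P n t ω) ∂Q := by
  have hchain := h.isBeliefChain hlam hπ σ a n
  have hn : (0 : ℝ) < 1 / ((n : ℝ) + 1) := by positivity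
  obtain ⟨C, hC⟩ := exists_bound_drift hlam hπ hL.cont_c hL.c_ne_top hn
  have hC' : ∀ i ω, c (flow lam π (gridTime a n (i + 1) - gridTime a n i)
      (gridBelief lam π σ a P n i ω)) ≤ C := fun i ω => by
    -- Consecutive times are at least `1 / (n + 1)` apart, so the belief before each later
    -- acquisition has drifted long enough for `C` to apply.
    refine hC _ (hchain.mem i ω) _ ?_
    have h1 : 1 / (n + 1 : ℝ≥0) ≤ gridTime a n (i + 1) - gridTime a n i := by
      rw [gridTime_succ_sub]; exact le_add_of_nonneg_left zero_le
    have h2 : ((1 / (n + 1 : ℝ≥0) : ℝ≥0) : ℝ) ≤ ((gridTime a n (i + 1) - gridTime a n i : ℝ≥0) : ℝ) :=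
      NNReal.coe_le_coe.2 h1
    rwa [NNReal.coe_div, NNReal.coe_add, NNReal.coe_natCast, NNReal.coe_one] at h2
  obtain ⟨h1, h2⟩ := hchain.le_netValue hL hr hlam hπ (flow_mem_Icc hlam hπ σ hp) hc hu hC'
  have hm : Measurable fun ω => driftLoss r lam π g (a + 1 / (n + 1)) (flow lam π σ (P 0 ω)) :=
    (measurable_driftLoss hL.measurable_g _).comp ((measurable_flow_left lam π σ).comp (h.meas 0))
  have h3 := lintegral_mono (μ := Q) fun ω => discLoss_gridPath_le (lam := lam) (π := π) h.meas hr
    σ a n hL.measurable_g ω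
  rw [lintegral_add_left hm] at h3
  exact ⟨(EReal.sub_le_sub le_rfl (EReal.coe_ennreal_le_coe_ennreal_iff.2 h3)).trans h1,
    h2.trans h3⟩

/-- Here all beliefs, including the first, are drifted by `s`, and `a = 0`. The initial stretch then
costs at most `B / (n + 1)`, which vanishes with the mesh. -/
lemma IsBeliefProcess.lintegral_flow_le (h : IsBeliefProcess lam π p Q P)
    (hL : LossData r lam π c g U) (hr : 0 < r) (hlam : 0 < lam) (hπ : π ∈ Ioo (0 : ℝ) 1)
    (hp : p ∈ Icc (0 : ℝ) 1) (hc : ∀ q ∈ Icc (0 : ℝ) 1, c q = c₀ q)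
    (hu : ∀ q ∈ Icc (0 : ℝ) 1, u q ≤ M ∧ U q = ENNReal.ofReal (M - u q)) {s : ℝ≥0} (hs : 0 < s) :
    ∫⁻ ω, c (flow lam π s (P 0 ω)) ∂Q ≤
      ∫⁻ ω, discLoss r g (fun t => flow lam π s (P t.toNNReal ω)) ∂Q := by
  obtain ⟨B, hB⟩ := exists_bound_drift hlam hπ hL.cont_g hL.g_ne_top (NNReal.coe_pos.2 hs)
  have h1 : ∀ n : ℕ, ∫⁻ ω, c (flow lam π s (P 0 ω)) ∂Q ≤ B * ENNReal.ofReal (1 / ((n : ℝ) + 1)) +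
      ∫⁻ ω, discLoss r g (fun t => gridPath lam π s P n t ω) ∂Q := fun n => by
    have h2 := (h.grid_le_netValue hL hr hlam hπ hp hc hu s 0 n).2
    rw [add_zero, NNReal.coe_zero, zero_add] at h2
    refine h2.trans (add_le_add_left ?_ _)
    refine (lintegral_mono fun ω => driftLoss_le (B := B) hr fun t ht => ?_).trans (by simp)
    rw [flow_eq_drift, ← drift_add]
    exact hB _ (h.mem _ _) _ (by linarith)
  have h2 : Tendsto (fun n : ℕ => (B : ℝ≥0∞) * ENNReal.ofReal (1 / ((n : ℝ) + 1))) atTop (𝓝 0) := by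
    have h3 := ENNReal.tendsto_ofReal (tendsto_one_div_add_atTop_nhds_zero_nat (𝕜 := ℝ))
    simpa using ENNReal.Tendsto.const_mul h3 (Or.inr (ENNReal.coe_ne_top (r := B)))
  have h3 := h2.add (h.tendsto_lintegral_gridPath hL hr hlam hπ hs)
  rw [zero_add] at h3
  exact ge_of_tendsto' h3 h1

/-- The expected initial certainty of a belief process is at most its expected loss. -/
lemma IsBeliefProcess.lintegral_initial_le (h : IsBeliefProcess lam π p Q P)
    (hL : LossData r lam π c g U) (hr : 0 < r) (hlam : 0 < lam) (hπ : π ∈ Ioo (0 : ℝ) 1)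
    (hp : p ∈ Icc (0 : ℝ) 1) (hc : ∀ q ∈ Icc (0 : ℝ) 1, c q = c₀ q)
    (hu : ∀ q ∈ Icc (0 : ℝ) 1, u q ≤ M ∧ U q = ENNReal.ofReal (M - u q))
    (hfin : ∫⁻ ω, discLoss r g (fun t => P t.toNNReal ω) ∂Q ≠ ∞) :
    ∫⁻ ω, c (P 0 ω) ∂Q ≤ ∫⁻ ω, discLoss r g (fun t => P t.toNNReal ω) ∂Q := by
  set s : ℕ → ℝ≥0 := fun m => 1 / ((m : ℝ≥0) + 1) with hs
  have hs0 : Tendsto s atTop (𝓝 0) := tendsto_one_div_add_atTop_nhds_zero_nat (𝕜 := ℝ≥0)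
  have hlim := h.tendsto_lintegral_flow hL hr hfin hs0
  have h1 : ∀ ω, liminf (fun m => c (flow lam π (s m) (P 0 ω))) atTop = c (P 0 ω) := fun ω => by
    have h2 := ((continuous_flow lam π).tendsto (0, P 0 ω)).comp
      (hs0.prodMk_nhds tendsto_const_nhds)
    rw [flow_zero] at h2
    exact ((hL.cont_c.tendsto _).comp h2).liminf_eq
  -- Fatou's lemma removes the drift from the initial belief, where no majorant for `c` is available
  -- yet.
  calc ∫⁻ ω, c (P 0 ω) ∂Q = ∫⁻ ω, liminf (fun m => c (flow lam π (s m) (P 0 ω))) atTop ∂Q := by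
        simp_rw [h1]
    _ ≤ liminf (fun m => ∫⁻ ω, c (flow lam π (s m) (P 0 ω)) ∂Q) atTop :=
        lintegral_liminf_le fun m =>
          hL.measurable_c.comp ((measurable_flow_left lam π _).comp (h.meas 0))
    _ ≤ liminf (fun m => ∫⁻ ω, discLoss r g (fun t => flow lam π (s m) (P t.toNNReal ω)) ∂Q)
          atTop := liminf_le_liminf (Eventually.of_forall fun m =>
            h.lintegral_flow_le hL hr hlam hπ hp hc hu (by rw [hs]; positivity))
    _ = _ := hlim.liminf_eq

/-- The expected loss along the drift from the initial belief vanishes at short horizons. -/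
lemma IsBeliefProcess.tendsto_lintegral_driftLoss (h : IsBeliefProcess lam π p Q P)
    (hL : LossData r lam π c g U) (hr : 0 < r) (hlam : 0 < lam) (hπ : π ∈ Ioo (0 : ℝ) 1)
    (hfin : ∫⁻ ω, c (P 0 ω) ∂Q ≠ ∞) {l : ℕ → ℝ} (hl : Tendsto l atTop (𝓝 0)) :
    Tendsto (fun m => ∫⁻ ω, driftLoss r lam π g (l m) (P 0 ω) ∂Q) atTop (𝓝 0) := by
  obtain ⟨B, hB⟩ := hL.U_le
  -- The loss over any horizon is part of the loss of the infinite drift, that is, of the initial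
  -- certainty plus a bounded term.
  have hle : ∀ x ω, driftLoss r lam π g x (P 0 ω) ≤ c (P 0 ω) + ENNReal.ofReal (1 / r) * B := by
    intro x ω
    have h1 := hL.discLoss_drift hr hlam hπ (h.mem 0 ω)
    have h2 := discLoss_U_le hr hB fun t => InfoAcq.drift lam π t (P 0 ω)
    calc driftLoss r lam π g x (P 0 ω) ≤ discLoss r g (fun t => InfoAcq.drift lam π t (P 0 ω)) :=
          lintegral_mono_set Ioc_subset_Ioi_self
      _ ≤ _ := by rw [h1]; gcongr
  have hcm : Measurable fun ω => c (P 0 ω) := hL.measurable_c.comp (h.meas 0)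
  have hconv := tendsto_lintegral_of_dominated_convergence (μ := Q)
    (F := fun m ω => driftLoss r lam π g (l m) (P 0 ω)) (f := fun _ => 0)
    (fun ω => c (P 0 ω) + ENNReal.ofReal (1 / r) * B)
    (fun m => (measurable_driftLoss hL.measurable_g _).comp (h.meas 0))
    (fun m => ae_of_all _ fun ω => hle _ ω) ?_ ?_
  · simpa using hconv
  · rw [lintegral_add_left hcm, lintegral_const, measure_univ]
    finiteness
  · filter_upwards [ae_lt_top hcm hfin] with ω hω
    have h1 : ∫⁻ t in Ioi (0 : ℝ), disc r t * g (InfoAcq.drift lam π t (P 0 ω)) ≠ ∞ := by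
      have h2 := hL.discLoss_drift hr hlam hπ (h.mem 0 ω)
      rw [discLoss] at h2
      rw [h2]
      exact ENNReal.add_ne_top.2 ⟨hω.ne, hL.discLoss_U_ne_top hr _⟩
    have h2 := tendsto_setLIntegral_zero h1 (l := atTop) (s := fun m => Ioc 0 (l m)) ?_
    · refine h2.congr fun m => ?_
      rw [Measure.restrict_restrict measurableSet_Ioc,
        inter_eq_self_of_subset_left Ioc_subset_Ioi_self, driftLoss]
    · have h3 : ∀ m, (volume.restrict (Ioi (0 : ℝ))) (Ioc 0 (l m)) = ENNReal.ofReal (l m) := fun m => by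
        rw [Measure.restrict_apply measurableSet_Ioc,
          inter_eq_self_of_subset_left Ioc_subset_Ioi_self, Real.volume_Ioc, sub_zero]
      simp only [Function.comp_def, h3]
      simpa using ENNReal.tendsto_ofReal hl

/-- The net value dominates the payoff of every belief process. -/
theorem IsBeliefProcess.le_netValue (h : IsBeliefProcess lam π p Q P)
    (hL : LossData r lam π c g U) (hr : 0 < r) (hlam : 0 < lam) (hπ : π ∈ Ioo (0 : ℝ) 1)
    (hp : p ∈ Icc (0 : ℝ) 1) (hc : ∀ q ∈ Icc (0 : ℝ) 1, c q = c₀ q)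
    (hu : ∀ q ∈ Icc (0 : ℝ) 1, u q ≤ M ∧ U q = ENNReal.ofReal (M - u q)) :
    ((M / r : ℝ) : EReal) -
        ((∫⁻ ω, discLoss r g (fun t => P t.toNNReal ω) ∂Q : ℝ≥0∞) : EReal) ≤
      netValue r lam π 0 u c₀ p := by
  by_cases hfin : ∫⁻ ω, discLoss r g (fun t => P t.toNNReal ω) ∂Q = ∞
  · rw [hfin]; simp
  have hc0 := ne_top_of_le_ne_top hfin (h.lintegral_initial_le hL hr hlam hπ hp hc hu hfin)
  set s : ℕ → ℝ≥0 := fun m => 1 / ((m : ℝ≥0) + 1) with hs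
  have hspos : ∀ m, 0 < s m := fun m => by rw [hs]; positivity
  have hs0 : Tendsto s atTop (𝓝 0) := tendsto_one_div_add_atTop_nhds_zero_nat (𝕜 := ℝ≥0)
  have hl : Tendsto (fun m => (s m : ℝ) + s m) atTop (𝓝 0) := by
    have h1 := NNReal.tendsto_coe.2 hs0
    simpa using h1.add h1
  set d : ℕ → ℝ≥0∞ := fun m => ∫⁻ ω, driftLoss r lam π g (s m + s m) (P 0 ω) ∂Q with hd
  -- The first belief is not drifted (`σ = 0`), so the policy starts at `p`, and the mesh tends to
  -- zero with the other drifts `s m` fixed. For `n ≥ m` the horizon `s m + 1 / (n + 1)` is at most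
  -- `s m + s m`, which removes `n` from the first term.
  have hstep : ∀ m, ((M / r : ℝ) : EReal) - ((d m +
      ∫⁻ ω, discLoss r g (fun t => flow lam π (s m) (P t.toNNReal ω)) ∂Q : ℝ≥0∞) : EReal) ≤
      netValue r lam π 0 u c₀ p := fun m => by
    have h1 := ((continuous_const_sub_coe (M / r)).tendsto _).comp
      ((tendsto_const_nhds (x := d m)).add (h.tendsto_lintegral_gridPath hL hr hlam hπ (hspos m)))
    refine le_of_tendsto h1 ?_
    filter_upwards [eventually_ge_atTop m] with n hn
    have h2 := (h.grid_le_netValue hL hr hlam hπ hp hc hu 0 (s m) n).1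
    simp only [flow_zero, zero_add] at h2
    refine (EReal.sub_le_sub le_rfl (EReal.coe_ennreal_le_coe_ennreal_iff.2 ?_)).trans h2
    refine add_le_add_left (lintegral_mono fun ω => driftLoss_mono ?_ _) _
    have h3 : (s m : ℝ) = 1 / ((m : ℝ) + 1) := by rw [hs]; push_cast; rfl
    rw [h3]
    gcongr
  have h1 := ((continuous_const_sub_coe (M / r)).tendsto _).comp
    ((h.tendsto_lintegral_driftLoss hL hr hlam hπ hc0 hl).add
      (h.tendsto_lintegral_flow hL hr hfin hs0))
  rw [zero_add] at h1
  exact le_of_tendsto' h1 hstep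

end lowerBound

end InfoAcq

end

/-! ### The two inequalities combined -/

theorem mainTheorem10 (r lam π : ℝ) (hr : 0 < r) (hlam : 0 < lam) (hπ : π ∈ Set.Ioo (0 : ℝ) 1)
    (u : ℝ → ℝ) (hu : ContinuousOn u (Set.Icc (0 : ℝ) 1))
    (c : ℝ → ℝ≥0∞) (hc : InfoAcq.IsCertaintyMeasure c)
    (p : ℝ) (hp : p ∈ Set.Icc (0 : ℝ) 1) :
    InfoAcq.netValue r lam π 0 u c p =
      InfoAcq.supOverProcesses r lam π (InfoAcq.virtualFlow r lam π u c) p := by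
  obtain ⟨M, c', g, U, hL, hc', hf, hU⟩ := InfoAcq.exists_lossData hr hlam hπ hu hc
  refine le_antisymm (InfoAcq.netValue_le hL hr hlam hπ hp hc' hU hf) (sSup_le ?_)
  rintro x ⟨Ω, _, Q, P, hQ, hP, rfl⟩
  rw [InfoAcq.extIntegral_process hr hL.measurable_g hf
    (InfoAcq.measurable_uncurry_of_rightCont hP.meas hP.rightCont) hP.mem]
  exact hP.le_netValue hL hr hlam hπ hp hc' hU
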